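/- Conventions. A polytope is a finite set of lattice points; its dimension is the dimension of its convex hull. For $S\subset\mathbb Z^4_{\ge 0}$ the Newton polyhedron is $\Gamma=\mathrm{conv}\bigl(\bigcup_{p\in S}(p+\mathbb R^4_{\ge 0})\bigr)$. A finite set $T\subset\mathbb Z^4_{\ge 0}$ is called a pyramid of height $1$ with base on a coordinate hyperplane if for some coordinate $x_i$ there is a point $p\in T$ (the apex) with $x_i(p)=1$ while $x_i(q)=0$ for every other $q\in T$. Let $\tau\subset\mathbb Z^4_{\ge 0}$ be a finite set which is a bounded $3$-dimensional facet with positive normal covector of such a Newton polyhedron $\Gamma$; that is, $\dim\tau=3$ and there are $a_1,\dots,a_4>0$ and $b\in\mathbb R$ such that $\sum_i a_ix_i\ge b$ on $\Gamma$ and $\mathrm{conv}(\tau)=\{x\in\Gamma:\sum_i a_ix_i=b\}$. Suppose that $\tau$ is a $B$-facet: for any four affinely independent points of $\tau$, the simplex formed by these four points is a pyramid of height $1$ with base on a coordinate hyperplane. **Theorem.** Then $\tau$ is of at least one of the following types: 1. **$B_1$-facet:** $\tau$ is a pyramid of height $1$ with base on a coordinate hyperplane. 2. **$B_2$-facet:**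 the projection of $\tau$ to some coordinate $2$-plane is the triangle $\{(0,0),(1,0),(0,1)\}$. 3. **Flat border:** up to a permutation of the coordinates, $\tau$ contains a (non-degenerate) triangle $ABC$ of the form $A=(0,0,*,*)$, $B=(0,0,*,*)$, $C=(1,1,*,*)$, and all the other points of $\tau$ are contained in $\{x_1=0\}\cup\{x_2=0\}$. 4. **Standard cross-polytope:** $\tau=\{(1,1,0,0),(1,0,1,0),(1,0,0,1),(0,1,1,0),(0,1,0,1),(0,0,1,1)\}$. -/

import Mathlib

/-- The real point with the coordinates of a lattice point of the non-negative orthant. -/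
def toReal {n : ℕ} (p : Fin n → ℕ) : Fin n → ℝ := fun i => (p i : ℝ)

/-- The Newton polyhedron of a set `S` of exponents: the convex hull of
`⋃ p ∈ S, (p + ℝ^n_{≥ 0})`. -/
def newtonPolyhedron {n : ℕ} (S : Set (Fin n → ℕ)) : Set (Fin n → ℝ) :=
  convexHull ℝ {x | ∃ p ∈ S, ∀ i, toReal p i ≤ x i}

/-- A finite set `τ` of lattice points represents a bounded facet of the polyhedron `P`, with
positive normal covector `a`: the convex hull of `τ` is the face of `P` on which `a` attains its
minimum `b`, and it has dimension `n - 1`. (No choice is made of which lattice points of the facet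
belong to `τ`, beyond the requirement that they span it.) -/
def IsBoundedFacet {n : ℕ} (P : Set (Fin n → ℝ)) (τ : Finset (Fin n → ℕ)) : Prop :=
  (∃ (a : Fin n → ℝ) (b : ℝ), (∀ i, 0 < a i) ∧ (∀ x ∈ P, b ≤ ∑ i, a i * x i) ∧
    convexHull ℝ (toReal '' (τ : Set (Fin n → ℕ))) = {x | x ∈ P ∧ ∑ i, a i * x i = b}) ∧
  Module.finrank ℝ (vectorSpan ℝ (toReal '' (τ : Set (Fin n → ℕ)))) + 1 = n

/-- The set `T` is a pyramid of height `1` with base on a coordinate hyperplane: for some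
coordinate `i`, the apex `p` has `i`-th coordinate `1` and all other points lie in `{x_i = 0}`. -/
def IsHeightOnePyramid {n : ℕ} (T : Set (Fin n → ℕ)) : Prop :=
  ∃ i : Fin n, ∃ p ∈ T, p i = 1 ∧ ∀ q ∈ T, q ≠ p → q i = 0

/-- A `B`-facet of `P`: a bounded facet with positive normal covector such that every
`(n-1)`-dimensional simplex with vertices in it is a pyramid of height `1` with base on a
coordinate hyperplane. -/
def IsBFacet {n : ℕ} (P : Set (Fin n → ℝ)) (τ : Finset (Fin n → ℕ)) : Prop :=
  IsBoundedFacet P τ ∧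
  ∀ v : Fin n → (Fin n → ℕ), (∀ k, v k ∈ τ) → AffineIndependent ℝ (fun k => toReal (v k)) →
    IsHeightOnePyramid (Set.range v)

/-- `B₁`-type: a pyramid of height `1` with base on a coordinate hyperplane. -/
def IsB1 (τ : Finset (Fin 4 → ℕ)) : Prop :=
  IsHeightOnePyramid (τ : Set (Fin 4 → ℕ))

/-- `B₂`-type: the projection to some coordinate 2-plane is the triangle `(0,0), (1,0), (0,1)`. -/
def IsB2 (τ : Finset (Fin 4 → ℕ)) : Prop :=
  ∃ i j : Fin 4, i ≠ j ∧ τ.image (fun p => (p i, p j)) = {(0, 0), (1, 0), (0, 1)}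

/-- Flat border: up to reordering the coordinates, `τ` contains a triangle `ABC` of the form
`(0,0,*,*), (0,0,*,*), (1,1,*,*)` and all its other points lie in `{x_1 = 0} ∪ {x_2 = 0}`. -/
def IsFlatBorder (τ : Finset (Fin 4 → ℕ)) : Prop :=
  ∃ i j : Fin 4, i ≠ j ∧ ∃ A ∈ τ, ∃ B ∈ τ, ∃ C ∈ τ,
    AffineIndependent ℝ ![toReal A, toReal B, toReal C] ∧
    (A i = 0 ∧ A j = 0) ∧ (B i = 0 ∧ B j = 0) ∧ (C i = 1 ∧ C j = 1) ∧
    ∀ D ∈ τ, D ≠ A → D ≠ B → D ≠ C → D i = 0 ∨ D j = 0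

/-- The standard cross-polytope: the six points `e_i + e_j` with `i ≠ j`. -/
def standardCrossPolytope : Finset (Fin 4 → ℕ) :=
  {![1, 1, 0, 0], ![1, 0, 1, 0], ![1, 0, 0, 1], ![0, 1, 1, 0], ![0, 1, 0, 1], ![0, 0, 1, 1]}

/-! The facet enters through two facts: its points lie on a hyperplane with positive normal covector
that misses the origin, and they span the whole space. On such a hyperplane affine and linear
independence agree, so a 3-simplex in `τ` is a basis of the 4-space. If a basis is a pyramid of
height 1 over `x_i = 0`, its `i`-th coordinates sum to 1; call `i` a colour of the basis. A
coordinate sum is never 0 on a basis, so a basis without colour `i` has `i`-th sum at least 2. The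
hypothesis becomes `Colored`: every basis has a colour.

The proof asks how many colours are needed. If one suffices for all bases, `τ` is a pyramid
(`pyramid_of_color`). If two suffice and neither alone does, the outcome is a flat border or a
triangle projection (`TwoColored.classify`). If three suffice but no two of them do, projecting
along the fourth coordinate leaves a set of points in 3-space, and excluding flat borders leads to a
contradiction (`ThreeColored.contradiction`). If all four are needed, excluding the listed types is
contradictory as well (`FullyFourColored.contradiction`), the cross-polytope being excluded there.

Two tools recur. Points whose sums already reach 2 in every admissible colour cannot be completed to
a basis; hence three such points are dependent, and two such points coincide. Conversely, if colour
`i` is indispensable, some basis has only that colour, so `x_i = 0` contains three independent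
points of `τ` (the `facet` lemmas); if the other colours are indispensable too, more than one point
lies off `x_i = 0` (the `other` lemmas).

For four colours, read the orthant as a cone over a tetrahedron with facets `x_i = 0`, and with
vertex `i` on the `i`-th axis. Points in the relative interior of the tetrahedron, then of its
facets, then of two edges with a common vertex are excluded in turn. Then every vertex carries a
point, of height at least 2, and these four points form a basis without colour. -/

/-! ### Linear algebra of lattice points on a positive hyperplane -/

/-- The determinant of a `3 × 3` integer matrix given by its rows. -/
def det3 (p1 p2 p3 q1 q2 q3 r1 r2 r3 : ℤ) : ℤ :=
  p1 * (q2 * r3 - q3 * r2) - p2 * (q1 * r3 - q3 * r1) + p3 * (q1 * r2 - q2 * r1)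

/-- The determinant of a `4 × 4` integer matrix given by its rows. -/
def det4 (p1 p2 p3 p4 q1 q2 q3 q4 r1 r2 r3 r4 s1 s2 s3 s4 : ℤ) : ℤ :=
  - det3 p2 p3 p4 q2 q3 q4 r2 r3 r4 * s1 + det3 p1 p3 p4 q1 q3 q4 r1 r3 r4 * s2
    - det3 p1 p2 p4 q1 q2 q4 r1 r2 r4 * s3 + det3 p1 p2 p3 q1 q2 q3 r1 r2 r3 * s4

/-- A set of non-negative integer points that spans `ℤ ^ 4` rationally. -/
structure NonnegSpanning (S : ℤ → ℤ → ℤ → ℤ → Prop) : Prop where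
  nonneg : ∀ {a b c d}, S a b c d → 0 ≤ a ∧ 0 ≤ b ∧ 0 ≤ c ∧ 0 ≤ d
  span : ∀ t u v w : ℤ, (∀ a b c d, S a b c d → t * a + u * b + v * c + w * d = 0) →
    t = 0 ∧ u = 0 ∧ v = 0 ∧ w = 0

/-- A spanning set of non-negative integer points on a hyperplane with positive normal
covector. -/
structure SpansPositiveHyperplane (S : ℤ → ℤ → ℤ → ℤ → Prop) : Prop
    extends NonnegSpanning S where
  lin : ∃ α β γ δ : ℝ, 0 < α ∧ 0 < β ∧ 0 < γ ∧ 0 < δ ∧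
    ∀ a b c d, S a b c d → α * a + β * b + γ * c + δ * d = 1

namespace NonnegSpanning

variable {S : ℤ → ℤ → ℤ → ℤ → Prop} {p1 p2 p3 p4 q1 q2 q3 q4 r1 r2 r3 r4 : ℤ}

/-- As a function of its last row, the determinant is a linear functional whose coefficients are the
minors up to sign. A functional vanishing on a spanning set is zero. -/
theorem minors_eq_zero (T : NonnegSpanning S)
    (h : ∀ s1 s2 s3 s4, S s1 s2 s3 s4 →
      det4 p1 p2 p3 p4 q1 q2 q3 q4 r1 r2 r3 r4 s1 s2 s3 s4 = 0) :
    det3 p1 p2 p3 q1 q2 q3 r1 r2 r3 = 0 ∧ det3 p1 p2 p4 q1 q2 q4 r1 r2 r4 = 0 ∧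
    det3 p1 p3 p4 q1 q3 q4 r1 r3 r4 = 0 ∧ det3 p2 p3 p4 q2 q3 q4 r2 r3 r4 = 0 := by
  obtain ⟨h1, h2, h3, h4⟩ := T.span (- det3 p2 p3 p4 q2 q3 q4 r2 r3 r4)
    (det3 p1 p3 p4 q1 q3 q4 r1 r3 r4) (- det3 p1 p2 p4 q1 q2 q4 r1 r2 r4)
    (det3 p1 p2 p3 q1 q2 q3 r1 r2 r3)
    (fun a b c d hs => by have := h a b c d hs; unfold det4 at this; linarith)
  exact ⟨h4, by linarith, h2, by linarith⟩

end NonnegSpanning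

namespace SpansPositiveHyperplane

variable {S : ℤ → ℤ → ℤ → ℤ → Prop} {p1 p2 p3 p4 q1 q2 q3 q4 r1 r2 r3 r4 : ℤ}

/-- The covector takes the value 1 on all three points, so applying it to the linear relation leaves
the relation between the coefficients. -/
theorem comb (T : SpansPositiveHyperplane S) (hp : S p1 p2 p3 p4) (hq : S q1 q2 q3 q4)
    (hr : S r1 r2 r3 r4) (k l m : ℤ) (h1 : k * p1 = l * q1 + m * r1)
    (h2 : k * p2 = l * q2 + m * r2) (h3 : k * p3 = l * q3 + m * r3)
    (h4 : k * p4 = l * q4 + m * r4) : k = l + m := by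
  obtain ⟨α, β, γ, δ, -, -, -, -, h⟩ := T.lin
  have ep := h _ _ _ _ hp
  have eq := h _ _ _ _ hq
  have er := h _ _ _ _ hr
  have h1' : (k : ℝ) * p1 = l * q1 + m * r1 := by exact_mod_cast h1
  have h2' : (k : ℝ) * p2 = l * q2 + m * r2 := by exact_mod_cast h2
  have h3' : (k : ℝ) * p3 = l * q3 + m * r3 := by exact_mod_cast h3
  have h4' : (k : ℝ) * p4 = l * q4 + m * r4 := by exact_mod_cast h4
  have : (k : ℝ) = l + m := by
    linear_combination -k * ep + l * eq + m * er + α * h1' + β * h2' + γ * h3' + δ * h4'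
  exact_mod_cast this

theorem smul (T : SpansPositiveHyperplane S) (hp : S p1 p2 p3 p4) (hq : S q1 q2 q3 q4)
    (k l : ℤ) (h1 : k * p1 = l * q1) (h2 : k * p2 = l * q2) (h3 : k * p3 = l * q3)
    (h4 : k * p4 = l * q4) : k = l := by
  simpa using T.comb hp hq hq k l 0 (by simpa using h1) (by simpa using h2) (by simpa using h3)
    (by simpa using h4)

/-- A positive covector is strictly monotone, so its level set is an antichain for the
coordinatewise order. -/
theorem anti (T : SpansPositiveHyperplane S) (hp : S p1 p2 p3 p4) (hq : S q1 q2 q3 q4)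
    (h1 : p1 ≤ q1) (h2 : p2 ≤ q2) (h3 : p3 ≤ q3) (h4 : p4 ≤ q4) :
    p1 = q1 ∧ p2 = q2 ∧ p3 = q3 ∧ p4 = q4 := by
  obtain ⟨α, β, γ, δ, hα, hβ, hγ, hδ, h⟩ := T.lin
  have ep := h _ _ _ _ hp
  have eq := h _ _ _ _ hq
  have h1' : (p1 : ℝ) ≤ q1 := by exact_mod_cast h1
  have h2' : (p2 : ℝ) ≤ q2 := by exact_mod_cast h2
  have h3' : (p3 : ℝ) ≤ q3 := by exact_mod_cast h3
  have h4' : (p4 : ℝ) ≤ q4 := by exact_mod_cast h4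
  have g1 : α * p1 ≤ α * q1 := by gcongr
  have g2 : β * p2 ≤ β * q2 := by gcongr
  have g3 : γ * p3 ≤ γ * q3 := by gcongr
  have g4 : δ * p4 ≤ δ * q4 := by gcongr
  have e1 : α * p1 = α * q1 := by linarith
  have e2 : β * p2 = β * q2 := by linarith
  have e3 : γ * p3 = γ * q3 := by linarith
  have e4 : δ * p4 = δ * q4 := by linarith
  refine ⟨?_, ?_, ?_, ?_⟩
  · exact_mod_cast mul_left_cancel₀ hα.ne' e1
  · exact_mod_cast mul_left_cancel₀ hβ.ne' e2
  · exact_mod_cast mul_left_cancel₀ hγ.ne' e3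
  · exact_mod_cast mul_left_cancel₀ hδ.ne' e4

theorem ne_zero (T : SpansPositiveHyperplane S) (hp : S 0 0 0 0) : False := by
  simpa using T.smul hp hp 1 0 (by simp) (by simp) (by simp) (by simp)

theorem eq_of_parallel (T : SpansPositiveHyperplane S) (hp : S p1 p2 p3 p4) (hq : S q1 q2 q3 q4)
    (h12 : p1 * q2 = p2 * q1) (h13 : p1 * q3 = p3 * q1) (h14 : p1 * q4 = p4 * q1)
    (h23 : p2 * q3 = p3 * q2) (h24 : p2 * q4 = p4 * q2) (h34 : p3 * q4 = p4 * q3) :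
    p1 = q1 ∧ p2 = q2 ∧ p3 = q3 ∧ p4 = q4 := by
  refine ⟨?_, ?_, ?_, ?_⟩
  · exact (T.smul hp hq q1 p1 (by ring) (by linarith) (by linarith) (by linarith)).symm
  · exact (T.smul hp hq q2 p2 (by linarith) (by ring) (by linarith) (by linarith)).symm
  · exact (T.smul hp hq q3 p3 (by linarith) (by linarith) (by ring) (by linarith)).symm
  · exact (T.smul hp hq q4 p4 (by linarith) (by linarith) (by linarith) (by ring)).symm

/-- Two points dependent with every third point of a spanning set are parallel, and a line through
the origin meets the hyperplane at most once. -/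
theorem eq_of_minors (T : SpansPositiveHyperplane S) (hp : S p1 p2 p3 p4) (hq : S q1 q2 q3 q4)
    (h : ∀ r1 r2 r3 r4, S r1 r2 r3 r4 → det3 p1 p2 p3 q1 q2 q3 r1 r2 r3 = 0 ∧
      det3 p1 p2 p4 q1 q2 q4 r1 r2 r4 = 0 ∧ det3 p1 p3 p4 q1 q3 q4 r1 r3 r4 = 0 ∧
      det3 p2 p3 p4 q2 q3 q4 r2 r3 r4 = 0) :
    p1 = q1 ∧ p2 = q2 ∧ p3 = q3 ∧ p4 = q4 := by
  have a := T.span (p2 * q3 - p3 * q2) (-(p1 * q3 - p3 * q1)) (p1 * q2 - p2 * q1) 0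
    (fun a b c d hs => by have := (h a b c d hs).1; unfold det3 at this; linarith)
  have b := T.span (p2 * q4 - p4 * q2) (-(p1 * q4 - p4 * q1)) 0 (p1 * q2 - p2 * q1)
    (fun a b c d hs => by have := (h a b c d hs).2.1; unfold det3 at this; linarith)
  have c := T.span (p3 * q4 - p4 * q3) 0 (-(p1 * q4 - p4 * q1)) (p1 * q3 - p3 * q1)
    (fun a b c d hs => by have := (h a b c d hs).2.2.1; unfold det3 at this; linarith)
  exact T.eq_of_parallel hp hq (by linarith) (by linarith) (by linarith) (by linarith)
    (by linarith) (by linarith)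

/-- Three points with non-vanishing minor on a coordinate facet detect linear functionals. -/
theorem _root_.eq_zero_of_det3_ne_zero {u v w : ℤ}
    (hd : det3 p1 p2 p3 q1 q2 q3 r1 r2 r3 ≠ 0) (hp : u * p1 + v * p2 + w * p3 = 0)
    (hq : u * q1 + v * q2 + w * q3 = 0) (hr : u * r1 + v * r2 + w * r3 = 0) :
    u = 0 ∧ v = 0 ∧ w = 0 := by
  refine ⟨?_, ?_, ?_⟩ <;> refine (mul_eq_zero.1 ?_).resolve_left hd <;> unfold det3
  · linear_combination (q2 * r3 - q3 * r2) * hp - (p2 * r3 - p3 * r2) * hq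
      + (p2 * q3 - p3 * q2) * hr
  · linear_combination -(q1 * r3 - q3 * r1) * hp + (p1 * r3 - p3 * r1) * hq
      - (p1 * q3 - p3 * q1) * hr
  · linear_combination (q1 * r2 - q2 * r1) * hp - (p1 * r2 - p2 * r1) * hq
      + (p1 * q2 - p2 * q1) * hr

end SpansPositiveHyperplane

/-- A set of points of `ℤ ^ 3` containing three linearly independent points. -/
def Spans3 (R : ℤ → ℤ → ℤ → Prop) : Prop :=
  ∃ p1 p2 p3 q1 q2 q3 r1 r2 r3, R p1 p2 p3 ∧ R q1 q2 q3 ∧ R r1 r2 r3 ∧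
    det3 p1 p2 p3 q1 q2 q3 r1 r2 r3 ≠ 0

theorem Spans3.eq_zero {R : ℤ → ℤ → ℤ → Prop} (h : Spans3 R) {u v w : ℤ}
    (hz : ∀ a b c, R a b c → u * a + v * b + w * c = 0) : u = 0 ∧ v = 0 ∧ w = 0 := by
  obtain ⟨p1, p2, p3, q1, q2, q3, r1, r2, r3, hp, hq, hr, hd⟩ := h
  exact eq_zero_of_det3_ne_zero hd (hz _ _ _ hp) (hz _ _ _ hq) (hz _ _ _ hr)

theorem Spans3.exists_ne {R : ℤ → ℤ → ℤ → Prop} (h : Spans3 R) (u v w : ℤ)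
    (hn : u ≠ 0 ∨ v ≠ 0 ∨ w ≠ 0) : ∃ a b c, R a b c ∧ u * a + v * b + w * c ≠ 0 := by
  by_contra! hc
  obtain ⟨h1, h2, h3⟩ := h.eq_zero hc
  omega

namespace NonnegSpanning

variable {S : ℤ → ℤ → ℤ → ℤ → Prop}
  {p1 p2 p3 p4 q1 q2 q3 q4 r1 r2 r3 r4 s1 s2 s3 s4 : ℤ}

/-- A basis with first coordinate sum at most `1` consists of an apex at height `1` and a triangle
in the first coordinate hyperplane. -/
theorem facet_of_sum_le_one (T : NonnegSpanning S) (hp : S p1 p2 p3 p4)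
    (hq : S q1 q2 q3 q4) (hr : S r1 r2 r3 r4) (hs : S s1 s2 s3 s4)
    (hd : det4 p1 p2 p3 p4 q1 q2 q3 q4 r1 r2 r3 r4 s1 s2 s3 s4 ≠ 0)
    (h1 : p1 + q1 + r1 + s1 ≤ 1) :
    Spans3 (fun b c d => S 0 b c d) ∧ ∃ b c d, S 1 b c d := by
  have hp0 := (T.nonneg hp).1
  have hq0 := (T.nonneg hq).1
  have hr0 := (T.nonneg hr).1
  have hs0 := (T.nonneg hs).1
  have hcases : (p1 = 0 ∧ q1 = 0 ∧ r1 = 0 ∧ s1 = 0) ∨ (p1 = 1 ∧ q1 = 0 ∧ r1 = 0 ∧ s1 = 0) ∨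
      (p1 = 0 ∧ q1 = 1 ∧ r1 = 0 ∧ s1 = 0) ∨ (p1 = 0 ∧ q1 = 0 ∧ r1 = 1 ∧ s1 = 0) ∨
      (p1 = 0 ∧ q1 = 0 ∧ r1 = 0 ∧ s1 = 1) := by omega
  rcases hcases with ⟨rfl, rfl, rfl, rfl⟩ | ⟨rfl, rfl, rfl, rfl⟩ | ⟨rfl, rfl, rfl, rfl⟩ |
    ⟨rfl, rfl, rfl, rfl⟩ | ⟨rfl, rfl, rfl, rfl⟩
  · exact absurd (by unfold det4 det3; ring1) hd
  · refine ⟨⟨_, _, _, _, _, _, _, _, _, hq, hr, hs, fun h0 => hd ?_⟩, _, _, _, hp⟩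
    unfold det4 det3 at *
    linear_combination h0
  · refine ⟨⟨_, _, _, _, _, _, _, _, _, hp, hr, hs, fun h0 => hd ?_⟩, _, _, _, hq⟩
    unfold det4 det3 at *
    linear_combination -h0
  · refine ⟨⟨_, _, _, _, _, _, _, _, _, hp, hq, hs, fun h0 => hd ?_⟩, _, _, _, hr⟩
    unfold det4 det3 at *
    linear_combination h0
  · refine ⟨⟨_, _, _, _, _, _, _, _, _, hp, hq, hr, fun h0 => hd ?_⟩, _, _, _, hs⟩
    unfold det4 det3 at *
    linear_combination -h0

/-- If some basis has first coordinate sum at least `2`, a point at height `1` is not the only one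
outside the first coordinate hyperplane. -/
theorem exists_other (T : NonnegSpanning S) (hp : S p1 p2 p3 p4)
    (hq : S q1 q2 q3 q4) (hr : S r1 r2 r3 r4) (hs : S s1 s2 s3 s4)
    (hd : det4 p1 p2 p3 p4 q1 q2 q3 q4 r1 r2 r3 r4 s1 s2 s3 s4 ≠ 0)
    (h1 : 2 ≤ p1 + q1 + r1 + s1) (b c d : ℤ) :
    ∃ a' b' c' d', S a' b' c' d' ∧ 0 < a' ∧ ¬ (a' = 1 ∧ b' = b ∧ c' = c ∧ d' = d) := by
  by_contra! hc
  have key : ∀ a' b' c' d', S a' b' c' d' → a' = 0 ∨ (a' = 1 ∧ b' = b ∧ c' = c ∧ d' = d) := by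
    intro a' b' c' d' h
    rcases (T.nonneg h).1.eq_or_lt with h0 | h0
    · exact Or.inl h0.symm
    · exact Or.inr (hc _ _ _ _ h h0)
  rcases key _ _ _ _ hp with rfl | ⟨rfl, rfl, rfl, rfl⟩ <;>
  rcases key _ _ _ _ hq with rfl | ⟨rfl, rfl, rfl, rfl⟩ <;>
  rcases key _ _ _ _ hr with rfl | ⟨rfl, rfl, rfl, rfl⟩ <;>
  rcases key _ _ _ _ hs with rfl | ⟨rfl, rfl, rfl, rfl⟩ <;>
  first
  | omega
  | exact hd (by unfold det4 det3; ring1)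

end NonnegSpanning

namespace SpansPositiveHyperplane

variable {S : ℤ → ℤ → ℤ → ℤ → Prop}

theorem swap12 (T : SpansPositiveHyperplane S) :
    SpansPositiveHyperplane (fun a b c d => S b a c d) where
  nonneg h := by have := T.nonneg h; tauto
  lin := by
    obtain ⟨α, β, γ, δ, hα, hβ, hγ, hδ, h⟩ := T.lin
    exact ⟨β, α, γ, δ, hβ, hα, hγ, hδ, fun a b c d hs => by linarith [h _ _ _ _ hs]⟩
  span t u v w h := by
    have := T.span u t v w (fun a b c d hs => by linarith [h _ _ _ _ hs])
    tauto

/-- If every basis has first coordinate sum `1`, there is exactly one point outside the first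
coordinate hyperplane, and it has height `1`. -/
theorem pyramid_of_color (T : SpansPositiveHyperplane S)
    (bad : ∀ {p1 p2 p3 p4 q1 q2 q3 q4 r1 r2 r3 r4 s1 s2 s3 s4}, S p1 p2 p3 p4 → S q1 q2 q3 q4 →
      S r1 r2 r3 r4 → S s1 s2 s3 s4 → 2 ≤ p1 + q1 + r1 + s1 →
      det4 p1 p2 p3 p4 q1 q2 q3 q4 r1 r2 r3 r4 s1 s2 s3 s4 = 0) :
    ∃ b c d, S 1 b c d ∧
      ∀ a' b' c' d', S a' b' c' d' → ¬ (a' = 1 ∧ b' = b ∧ c' = c ∧ d' = d) → a' = 0 := by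
  have uniq : ∀ {p1 p2 p3 p4 q1 q2 q3 q4}, S p1 p2 p3 p4 → S q1 q2 q3 q4 → 2 ≤ p1 + q1 →
      p1 = q1 ∧ p2 = q2 ∧ p3 = q3 ∧ p4 = q4 := by
    intro p1 p2 p3 p4 q1 q2 q3 q4 hp hq h2
    -- Two points with first coordinates summing to 2 or more lie in no common basis, hence
    -- coincide.
    refine T.eq_of_minors hp hq fun r1 r2 r3 r4 hr => T.minors_eq_zero fun s1 s2 s3 s4 hs =>
      bad hp hq hr hs ?_
    have := T.nonneg hr
    have := T.nonneg hs
    omega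
  obtain ⟨a, b, c, d, hp, ha⟩ : ∃ a b c d, S a b c d ∧ a ≠ 0 := by
    by_contra! hc
    have := T.span 1 0 0 0 (fun a b c d h => by simp [hc a b c d h])
    omega
  have hp0 := T.nonneg hp
  have ha1 : a = 1 := by
    by_contra hne
    have hall : ∀ q1 q2 q3 q4, S q1 q2 q3 q4 → a = q1 ∧ b = q2 ∧ c = q3 ∧ d = q4 := by
      intro q1 q2 q3 q4 hq
      have := T.nonneg hq
      exact uniq hp hq (by omega)
    -- A point of height at least 2 would be the only point of `S`, and the functional `(b, -a, 0,
    -- 0)` kills it.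
    have := T.span b (-a) 0 0 (fun q1 q2 q3 q4 h => by
      obtain ⟨rfl, rfl, rfl, rfl⟩ := hall _ _ _ _ h; ring)
    omega
  subst ha1
  refine ⟨b, c, d, hp, fun a' b' c' d' h hne => ?_⟩
  by_contra h0
  have := T.nonneg h
  obtain ⟨rfl, rfl, rfl, rfl⟩ := uniq hp h (by omega)
  exact hne ⟨rfl, rfl, rfl, rfl⟩

end SpansPositiveHyperplane

/-! ### Two colours: flat border or triangle projection -/

/-- Every basis has first or second coordinate sum `1`, and neither of these two coordinates
suffices alone. -/
structure TwoColored (S : ℤ → ℤ → ℤ → ℤ → Prop) : Prop extends SpansPositiveHyperplane S where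
  bad : ∀ {p1 p2 p3 p4 q1 q2 q3 q4 r1 r2 r3 r4 s1 s2 s3 s4}, S p1 p2 p3 p4 → S q1 q2 q3 q4 →
    S r1 r2 r3 r4 → S s1 s2 s3 s4 → 2 ≤ p1 + q1 + r1 + s1 → 2 ≤ p2 + q2 + r2 + s2 →
    det4 p1 p2 p3 p4 q1 q2 q3 q4 r1 r2 r3 r4 s1 s2 s3 s4 = 0
  excl₁ : ∃ p1 p2 p3 p4 q1 q2 q3 q4 r1 r2 r3 r4 s1 s2 s3 s4, S p1 p2 p3 p4 ∧ S q1 q2 q3 q4 ∧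
    S r1 r2 r3 r4 ∧ S s1 s2 s3 s4 ∧ 2 ≤ p2 + q2 + r2 + s2 ∧
    det4 p1 p2 p3 p4 q1 q2 q3 q4 r1 r2 r3 r4 s1 s2 s3 s4 ≠ 0
  excl₂ : ∃ p1 p2 p3 p4 q1 q2 q3 q4 r1 r2 r3 r4 s1 s2 s3 s4, S p1 p2 p3 p4 ∧ S q1 q2 q3 q4 ∧
    S r1 r2 r3 r4 ∧ S s1 s2 s3 s4 ∧ 2 ≤ p1 + q1 + r1 + s1 ∧
    det4 p1 p2 p3 p4 q1 q2 q3 q4 r1 r2 r3 r4 s1 s2 s3 s4 ≠ 0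

/-- The flat border condition with respect to the first two coordinates. -/
def FlatBorder (S : ℤ → ℤ → ℤ → ℤ → Prop) : Prop :=
  ∃ c d c' d' e f, S 0 0 c d ∧ S 0 0 c' d' ∧ ¬ (c = c' ∧ d = d') ∧ S 1 1 e f ∧
    ∀ a' b' c' d', S a' b' c' d' → 0 < a' → 0 < b' → a' = 1 ∧ b' = 1 ∧ c' = e ∧ d' = f

/-- The projection to the first two coordinates is the standard triangle. -/
def TriangleProjection (S : ℤ → ℤ → ℤ → ℤ → Prop) : Prop :=
  (∃ c d, S 0 0 c d) ∧ ∀ a b c d, S a b c d → a = 0 ∧ b = 0 ∨ a = 1 ∧ b = 0 ∨ a = 0 ∧ b = 1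

namespace TwoColored

variable {S : ℤ → ℤ → ℤ → ℤ → Prop} {p1 p2 p3 p4 q1 q2 q3 q4 r1 r2 r3 r4 : ℤ}

theorem swap (T : TwoColored S) : TwoColored (fun a b c d => S b a c d) where
  toSpansPositiveHyperplane := T.toSpansPositiveHyperplane.swap12
  bad hp hq hr hs h1 h2 := by
    have := T.bad hp hq hr hs h2 h1
    unfold det4 det3 at *
    linarith
  excl₁ := by
    obtain ⟨p1, p2, p3, p4, q1, q2, q3, q4, r1, r2, r3, r4, s1, s2, s3, s4, hp, hq, hr, hs, h, hd⟩
      := T.excl₂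
    exact ⟨_, _, _, _, _, _, _, _, _, _, _, _, _, _, _, _, hp, hq, hr, hs, h,
      fun h0 => hd (by unfold det4 det3 at *; linarith)⟩
  excl₂ := by
    obtain ⟨p1, p2, p3, p4, q1, q2, q3, q4, r1, r2, r3, r4, s1, s2, s3, s4, hp, hq, hr, hs, h, hd⟩
      := T.excl₁
    exact ⟨_, _, _, _, _, _, _, _, _, _, _, _, _, _, _, _, hp, hq, hr, hs, h,
      fun h0 => hd (by unfold det4 det3 at *; linarith)⟩

theorem minors (T : TwoColored S) (hp : S p1 p2 p3 p4) (hq : S q1 q2 q3 q4) (hr : S r1 r2 r3 r4)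
    (h1 : 2 ≤ p1 + q1 + r1) (h2 : 2 ≤ p2 + q2 + r2) :
    det3 p1 p2 p3 q1 q2 q3 r1 r2 r3 = 0 ∧ det3 p1 p2 p4 q1 q2 q4 r1 r2 r4 = 0 ∧
    det3 p1 p3 p4 q1 q3 q4 r1 r3 r4 = 0 ∧ det3 p2 p3 p4 q2 q3 q4 r2 r3 r4 = 0 :=
  T.minors_eq_zero fun s1 s2 s3 s4 hs => by
    have := T.nonneg hs
    exact T.bad hp hq hr hs (by omega) (by omega)

theorem unique (T : TwoColored S) (hp : S p1 p2 p3 p4) (hq : S q1 q2 q3 q4)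
    (h1 : 2 ≤ p1 + q1) (h2 : 2 ≤ p2 + q2) : p1 = q1 ∧ p2 = q2 ∧ p3 = q3 ∧ p4 = q4 :=
  T.eq_of_minors hp hq fun r1 r2 r3 r4 hr => by
    have := T.nonneg hr
    exact T.minors hp hq hr (by omega) (by omega)

/-- A basis without the second colour must have the first one, so it has three vertices on `x₁ = 0`.
-/
theorem facet (T : TwoColored S) : Spans3 (fun b c d => S 0 b c d) := by
  obtain ⟨p1, p2, p3, p4, q1, q2, q3, q4, r1, r2, r3, r4, s1, s2, s3, s4, hp, hq, hr, hs, h, hd⟩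
    := T.excl₁
  refine (T.facet_of_sum_le_one hp hq hr hs hd ?_).1
  by_contra hlt
  exact hd (T.bad hp hq hr hs (by omega) h)

theorem other (T : TwoColored S) (b c d : ℤ) :
    ∃ a' b' c' d', S a' b' c' d' ∧ 0 < a' ∧ ¬ (a' = 1 ∧ b' = b ∧ c' = c ∧ d' = d) := by
  obtain ⟨p1, p2, p3, p4, q1, q2, q3, q4, r1, r2, r3, r4, s1, s2, s3, s4, hp, hq, hr, hs, h, hd⟩
    := T.excl₂
  exact T.exists_other hp hq hr hs hd h b c d

/-- A point of the first facet that is not on the second one. -/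
theorem exists_facet_diff (T : TwoColored S) : ∃ b c d, S 0 b c d ∧ 0 < b := by
  obtain ⟨b, c, d, h, h0⟩ := T.facet.exists_ne 1 0 0 (by simp)
  have := T.nonneg h
  exact ⟨b, c, d, h, by omega⟩

/-- Three independent points of the facet `x₁ = 0` do not all have second coordinate 0. If `a ≥ 2`,
adding the given point yields a basis with both sums at least 2. -/
theorem interior_left (T : TwoColored S) {a b c d : ℤ} (h : S a b c d) (ha : 0 < a) (hb : 0 < b) :
    a = 1 := by
  obtain ⟨p2, p3, p4, q2, q3, q4, r2, r3, r4, hp, hq, hr, hd⟩ := T.facet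
  by_contra hne
  have hp0 := T.nonneg hp
  have hq0 := T.nonneg hq
  have hr0 := T.nonneg hr
  by_cases h0 : p2 + q2 + r2 = 0
  · have e1 : p2 = 0 := by omega
    have e2 : q2 = 0 := by omega
    have e3 : r2 = 0 := by omega
    subst e1 e2 e3
    exact hd (by unfold det3; ring)
  · have := T.bad hp hq hr h (by omega) (by omega)
    have h2 : a * det3 p2 p3 p4 q2 q3 q4 r2 r3 r4 = 0 := by
      unfold det4 det3 at *
      linear_combination -this
    rcases mul_eq_zero.1 h2 with h3 | h3
    · omega
    · exact hd h3

/-- The point is `C = (1, 1, e, f)`, the only one with both coordinates positive. Together with a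
point `p` of `x₂ = 0` off `x₁ = 0`, it determines the point `q` of `x₁ = 0` off `x₂ = 0`. So `x₁ =
0` carries only `q` and points with `x₁ = x₂ = 0`; as it spans 3-space, there are two of the latter.
-/
theorem flat_of_interior (T : TwoColored S) {a b e f : ℤ} (hn : S a b e f) (ha : 0 < a)
    (hb : 0 < b) : FlatBorder S := by
  obtain rfl := T.interior_left hn ha hb
  obtain rfl := T.swap.interior_left hn hb ha
  have huniq : ∀ a' b' c' d', S a' b' c' d' → 0 < a' → 0 < b' →
      a' = 1 ∧ b' = 1 ∧ c' = e ∧ d' = f := fun a' b' c' d' h h1 h2 =>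
    T.unique h hn (by omega) (by omega)
  obtain ⟨p1, p3, p4, hp, hp1⟩ := T.swap.exists_facet_diff
  obtain ⟨q2, q3, q4, hq, hq2⟩ := T.exists_facet_diff
  have key : ∀ {q2 q3 q4 : ℤ}, S 0 q2 q3 q4 → 0 < q2 →
      e * p1 * q2 = p3 * q2 + p1 * q3 ∧ f * p1 * q2 = p4 * q2 + p1 * q4 := by
    intro q2 q3 q4 hq hq2
    obtain ⟨h1, h2, -, -⟩ := T.minors hn hp hq (by omega) (by omega)
    unfold det3 at h1 h2
    exact ⟨by linarith, by linarith⟩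
  obtain ⟨k1, k2⟩ := key hq hq2
  have uniq_diff : ∀ {r2 r3 r4 : ℤ}, S 0 r2 r3 r4 → 0 < r2 → r2 = q2 ∧ r3 = q3 ∧ r4 = q4 := by
    intro r2 r3 r4 hr hr2
    obtain ⟨l1, l2⟩ := key hr hr2
    have m3 : r2 * q3 = r3 * q2 := by
      refine mul_left_cancel₀ hp1.ne' ?_
      linear_combination q2 * l1 - r2 * k1
    have m4 : r2 * q4 = r4 * q2 := by
      refine mul_left_cancel₀ hp1.ne' ?_
      linear_combination q2 * l2 - r2 * k2
    have m34 : r3 * q4 = r4 * q3 := by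
      refine mul_left_cancel₀ hq2.ne' ?_
      linear_combination q3 * m4 - q4 * m3
    exact (T.eq_of_parallel hr hq (by ring) (by ring) (by ring) (by linarith) (by linarith)
      (by linarith)).2
  have on_edge : ∀ u v w : ℤ, (u ≠ 0 ∨ v ≠ 0 ∨ w ≠ 0) → u * q2 + v * q3 + w * q4 = 0 →
      ∃ c d, S 0 0 c d ∧ v * c + w * d ≠ 0 := by
    intro u v w hne hz
    obtain ⟨b, c, d, h, h0⟩ := T.facet.exists_ne u v w hne
    rcases (T.nonneg h).2.1.eq_or_lt with h1 | h1
    · subst h1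
      exact ⟨c, d, h, by simpa using h0⟩
    · obtain ⟨rfl, rfl, rfl⟩ := uniq_diff h h1
      exact absurd hz h0
  obtain ⟨c, d, h, hne⟩ := on_edge q3 (-q2) 0 (Or.inr (Or.inl (by omega))) (by ring)
  have hc : c ≠ 0 := by
    rintro rfl
    simp at hne
  -- This functional vanishes on both `q` and `(0, c, d)`, so the point it detects differs from `(c,
  -- d)`.
  obtain ⟨c', d', h', hne'⟩ := on_edge (q3 * d - q4 * c) (-q2 * d) (q2 * c)
    (Or.inr (Or.inr (mul_ne_zero hq2.ne' hc))) (by ring)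
  refine ⟨c, d, c', d', _, _, h, h', ?_, hn, huniq⟩
  rintro ⟨rfl, rfl⟩
  exact hne' (by ring)

theorem exists_edge (T : TwoColored S) : ∃ c d, S 0 0 c d := by
  by_contra! hL
  have pos1 : ∀ {b c d}, S 0 b c d → 0 < b := by
    intro b c d h
    rcases (T.nonneg h).2.1.eq_or_lt with h0 | h0
    · subst h0; exact absurd h (hL _ _)
    · exact h0
  have pos2 : ∀ {a c d}, S a 0 c d → 0 < a := by
    intro a c d h
    rcases (T.nonneg h).1.eq_or_lt with h0 | h0
    · subst h0; exact absurd h (hL _ _)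
    · exact h0
  obtain ⟨q2, q3, q4, hq, hq2⟩ := T.exists_facet_diff
  obtain ⟨r1, r3, r4, hr, hr1⟩ := T.swap.exists_facet_diff
  -- Without points on `x₁ = x₂ = 0`, two points of each facet reach both sums 2 and so are
  -- dependent. As the second facet spans, this makes the projections of `p` and `q` to the
  -- coordinates 2, 3 parallel for every `p` on the first facet, against its spanning.
  obtain ⟨-, h, -⟩ := T.facet.eq_zero (u := q3) (v := -q2) (w := 0) (fun p2 p3 p4 hp => by
    have hp2 := pos1 hp
    obtain ⟨-, -, h3⟩ := T.swap.facet.eq_zero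
      (u := - det3 p2 p3 p4 q2 q3 q4 0 r3 r4)
      (v := - det3 0 p2 p4 0 q2 q4 r1 0 r4) (w := det3 0 p2 p3 0 q2 q3 r1 0 r3)
      (fun s1 s3 s4 hs => by
        have hs1 := pos2 hs
        have := T.bad hp hq hr hs (by omega) (by omega)
        unfold det4 at this
        linarith)
    refine (mul_eq_zero.1 ?_).resolve_left hr1.ne'
    unfold det3 at h3
    linear_combination h3)
  omega

/-- If `p1 ≥ 2`, every point with positive second coordinate has it equal to 1, and any two of these
are dependent with `p`. Then only one point lies off `x₂ = 0`, which `other` forbids. -/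
theorem height_le_one (T : TwoColored S)
    (hN : ∀ a b c d, S a b c d → 0 < a → 0 < b → False) {p1 p2 p3 p4 : ℤ} (hp : S p1 p2 p3 p4) :
    p1 ≤ 1 := by
  by_contra hlt
  have hp0 := T.nonneg hp
  obtain rfl : p2 = 0 := by
    by_contra h
    exact hN _ _ _ _ hp (by omega) (by omega)
  have vals : ∀ {a b c d}, S a b c d → 0 < b → a = 0 ∧ b = 1 := by
    intro a b c d h hb
    have h0 := T.nonneg h
    have ha : a = 0 := by
      by_contra ha
      exact hN _ _ _ _ h (by omega) (by omega)
    subst ha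
    refine ⟨rfl, ?_⟩
    by_contra hne
    have := T.unique hp h (by omega) (by omega)
    omega
  obtain ⟨m1, m2, m3, m4, hm, hm2⟩ : ∃ a b c d, S a b c d ∧ 0 < b := by
    obtain ⟨b, c, d, h, hb⟩ := T.exists_facet_diff
    exact ⟨_, _, _, _, h, hb⟩
  obtain ⟨rfl, rfl⟩ := vals hm hm2
  obtain ⟨k2, k1, k3, k4, hk, hk2, hne⟩ := T.swap.other 0 m3 m4
  obtain ⟨rfl, rfl⟩ := vals hk hk2
  obtain ⟨h1, h2, h3, -⟩ := T.minors hp hm hk (by omega) (by omega)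
  unfold det3 at h1 h2 h3
  have hp1 : p1 ≠ 0 := by omega
  have e3 : k3 = m3 := mul_left_cancel₀ hp1 (by linarith)
  have e4 : k4 = m4 := mul_left_cancel₀ hp1 (by linarith)
  exact hne ⟨rfl, rfl, e3, e4⟩

theorem classify (T : TwoColored S) : FlatBorder S ∨ TriangleProjection S := by
  by_cases hN : ∀ a b c d, S a b c d → 0 < a → 0 < b → False
  · refine Or.inr ⟨T.exists_edge, fun a b c d h => ?_⟩
    have h1 := T.height_le_one hN h
    have h2 := T.swap.height_le_one (fun a b c d h ha hb => hN _ _ _ _ h hb ha) h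
    have h3 := T.nonneg h
    have h4 : ¬ (0 < a ∧ 0 < b) := fun h5 => hN _ _ _ _ h h5.1 h5.2
    omega
  · push Not at hN
    obtain ⟨a, b, c, d, h, ha, hb, -⟩ := hN
    exact Or.inl (T.flat_of_interior h ha hb)

end TwoColored

/-! ### Three colours: no further types -/

/-- An affinely spanning set of non-negative points of `ℤ ^ 3` in which every tetrahedron has some
coordinate sum `1`, no two of the coordinates suffice for that, and which is not a flat border. -/
structure ThreeColored (S : ℤ → ℤ → ℤ → Prop) : Prop where
  spanning : NonnegSpanning (fun a b c d => S a b c ∧ d = 1)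
  bad : ∀ {p1 p2 p3 q1 q2 q3 r1 r2 r3 s1 s2 s3}, S p1 p2 p3 → S q1 q2 q3 →
    S r1 r2 r3 → S s1 s2 s3 → 2 ≤ p1 + q1 + r1 + s1 → 2 ≤ p2 + q2 + r2 + s2 →
    2 ≤ p3 + q3 + r3 + s3 → det4 p1 p2 p3 1 q1 q2 q3 1 r1 r2 r3 1 s1 s2 s3 1 = 0
  excl₁ : ∃ p1 p2 p3 q1 q2 q3 r1 r2 r3 s1 s2 s3, S p1 p2 p3 ∧ S q1 q2 q3 ∧
    S r1 r2 r3 ∧ S s1 s2 s3 ∧ 2 ≤ p2 + q2 + r2 + s2 ∧ 2 ≤ p3 + q3 + r3 + s3 ∧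
    det4 p1 p2 p3 1 q1 q2 q3 1 r1 r2 r3 1 s1 s2 s3 1 ≠ 0
  excl₂ : ∃ p1 p2 p3 q1 q2 q3 r1 r2 r3 s1 s2 s3, S p1 p2 p3 ∧ S q1 q2 q3 ∧
    S r1 r2 r3 ∧ S s1 s2 s3 ∧ 2 ≤ p1 + q1 + r1 + s1 ∧ 2 ≤ p3 + q3 + r3 + s3 ∧
    det4 p1 p2 p3 1 q1 q2 q3 1 r1 r2 r3 1 s1 s2 s3 1 ≠ 0
  excl₃ : ∃ p1 p2 p3 q1 q2 q3 r1 r2 r3 s1 s2 s3, S p1 p2 p3 ∧ S q1 q2 q3 ∧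
    S r1 r2 r3 ∧ S s1 s2 s3 ∧ 2 ≤ p1 + q1 + r1 + s1 ∧ 2 ≤ p2 + q2 + r2 + s2 ∧
    det4 p1 p2 p3 1 q1 q2 q3 1 r1 r2 r3 1 s1 s2 s3 1 ≠ 0
  flat₁₂ : ∀ {c c' e}, S 0 0 c → S 0 0 c' → c ≠ c' → S 1 1 e →
    (∀ x y z, S x y z → 0 < x → 0 < y → x = 1 ∧ y = 1 ∧ z = e) → False
  flat₁₃ : ∀ {c c' e}, S 0 c 0 → S 0 c' 0 → c ≠ c' → S 1 e 1 →
    (∀ x y z, S x y z → 0 < x → 0 < z → x = 1 ∧ z = 1 ∧ y = e) → False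
  flat₂₃ : ∀ {c c' e}, S c 0 0 → S c' 0 0 → c ≠ c' → S e 1 1 →
    (∀ x y z, S x y z → 0 < y → 0 < z → y = 1 ∧ z = 1 ∧ x = e) → False

namespace ThreeColored

variable {S : ℤ → ℤ → ℤ → Prop} {p1 p2 p3 q1 q2 q3 r1 r2 r3 : ℤ}

theorem nonneg (T : ThreeColored S) {a b c : ℤ} (h : S a b c) : 0 ≤ a ∧ 0 ≤ b ∧ 0 ≤ c := by
  have := T.spanning.nonneg ⟨h, rfl⟩
  tauto

theorem swap12 (T : ThreeColored S) : ThreeColored (fun a b c => S b a c) where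
  spanning :=
    { nonneg := fun h => by have := T.spanning.nonneg h; tauto
      span := fun t u v w h => by
        have := T.spanning.span u t v w (fun a b c d hs => by linarith [h _ _ _ _ hs])
        tauto }
  bad hp hq hr hs h1 h2 h3 := by
    have := T.bad hp hq hr hs h2 h1 h3
    unfold det4 det3 at *
    linarith
  excl₁ := by
    obtain ⟨p1, p2, p3, q1, q2, q3, r1, r2, r3, s1, s2, s3, hp, hq, hr, hs, h, h', hd⟩ := T.excl₂
    exact ⟨_, _, _, _, _, _, _, _, _, _, _, _, hp, hq, hr, hs, h, h',
      fun h0 => hd (by unfold det4 det3 at *; linarith)⟩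
  excl₂ := by
    obtain ⟨p1, p2, p3, q1, q2, q3, r1, r2, r3, s1, s2, s3, hp, hq, hr, hs, h, h', hd⟩ := T.excl₁
    exact ⟨_, _, _, _, _, _, _, _, _, _, _, _, hp, hq, hr, hs, h, h',
      fun h0 => hd (by unfold det4 det3 at *; linarith)⟩
  excl₃ := by
    obtain ⟨p1, p2, p3, q1, q2, q3, r1, r2, r3, s1, s2, s3, hp, hq, hr, hs, h, h', hd⟩ := T.excl₃
    exact ⟨_, _, _, _, _, _, _, _, _, _, _, _, hp, hq, hr, hs, h', h,
      fun h0 => hd (by unfold det4 det3 at *; linarith)⟩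
  flat₁₂ h h' hne hc hu := T.flat₁₂ h h' hne hc fun x y z hs hx hy => by
    have := hu _ _ _ hs hy hx
    tauto
  flat₁₃ h h' hne hc hu := T.flat₂₃ h h' hne hc fun x y z hs hx hy => hu _ _ _ hs hx hy
  flat₂₃ h h' hne hc hu := T.flat₁₃ h h' hne hc fun x y z hs hx hy => hu _ _ _ hs hx hy

theorem swap23 (T : ThreeColored S) : ThreeColored (fun a b c => S a c b) where
  spanning :=
    { nonneg := fun h => by have := T.spanning.nonneg h; tauto
      span := fun t u v w h => by
        have := T.spanning.span t v u w (fun a b c d hs => by linarith [h _ _ _ _ hs])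
        tauto }
  bad hp hq hr hs h1 h2 h3 := by
    have := T.bad hp hq hr hs h1 h3 h2
    unfold det4 det3 at *
    linarith
  excl₁ := by
    obtain ⟨p1, p2, p3, q1, q2, q3, r1, r2, r3, s1, s2, s3, hp, hq, hr, hs, h, h', hd⟩ := T.excl₁
    exact ⟨_, _, _, _, _, _, _, _, _, _, _, _, hp, hq, hr, hs, h', h,
      fun h0 => hd (by unfold det4 det3 at *; linarith)⟩
  excl₂ := by
    obtain ⟨p1, p2, p3, q1, q2, q3, r1, r2, r3, s1, s2, s3, hp, hq, hr, hs, h, h', hd⟩ := T.excl₃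
    exact ⟨_, _, _, _, _, _, _, _, _, _, _, _, hp, hq, hr, hs, h, h',
      fun h0 => hd (by unfold det4 det3 at *; linarith)⟩
  excl₃ := by
    obtain ⟨p1, p2, p3, q1, q2, q3, r1, r2, r3, s1, s2, s3, hp, hq, hr, hs, h, h', hd⟩ := T.excl₂
    exact ⟨_, _, _, _, _, _, _, _, _, _, _, _, hp, hq, hr, hs, h, h',
      fun h0 => hd (by unfold det4 det3 at *; linarith)⟩
  flat₁₂ h h' hne hc hu := T.flat₁₃ h h' hne hc fun x y z hs hx hy => hu _ _ _ hs hx hy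
  flat₁₃ h h' hne hc hu := T.flat₁₂ h h' hne hc fun x y z hs hx hy => hu _ _ _ hs hx hy
  flat₂₃ h h' hne hc hu := T.flat₂₃ h h' hne hc fun x y z hs hx hy => by
    have := hu _ _ _ hs hy hx
    tauto

theorem minor_eq_zero (T : ThreeColored S) (hp : S p1 p2 p3) (hq : S q1 q2 q3) (hr : S r1 r2 r3)
    (h1 : 2 ≤ p1 + q1 + r1) (h2 : 2 ≤ p2 + q2 + r2) (h3 : 2 ≤ p3 + q3 + r3) :
    det3 p1 p2 p3 q1 q2 q3 r1 r2 r3 = 0 :=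
  (T.spanning.minors_eq_zero (p4 := 1) (q4 := 1) (r4 := 1) fun s1 s2 s3 s4 hs => by
    obtain ⟨hs, rfl⟩ := hs
    have := T.nonneg hs
    exact T.bad hp hq hr hs (by omega) (by omega) (by omega)).1

theorem facet (T : ThreeColored S) : Spans3 (fun b c d => S 0 b c ∧ d = 1) := by
  obtain ⟨p1, p2, p3, q1, q2, q3, r1, r2, r3, s1, s2, s3, hp, hq, hr, hs, h, h', hd⟩ := T.excl₁
  refine (T.spanning.facet_of_sum_le_one ⟨hp, rfl⟩ ⟨hq, rfl⟩ ⟨hr, rfl⟩ ⟨hs, rfl⟩ hd ?_).1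
  by_contra hlt
  exact hd (T.bad hp hq hr hs (by omega) h h')

theorem exists_facet_off (T : ThreeColored S) (u v w : ℤ) (hne : u ≠ 0 ∨ v ≠ 0 ∨ w ≠ 0) :
    ∃ b c, S 0 b c ∧ u * b + v * c + w ≠ 0 := by
  obtain ⟨b, c, d, ⟨h, rfl⟩, h0⟩ := T.facet.exists_ne u v w hne
  exact ⟨b, c, h, by simpa using h0⟩

theorem exists_facet_diff (T : ThreeColored S) : ∃ b c, S 0 b c ∧ 0 < b := by
  obtain ⟨b, c, h, h0⟩ := T.exists_facet_off 1 0 0 (by simp)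
  have := T.nonneg h
  exact ⟨b, c, h, by omega⟩

theorem other (T : ThreeColored S) (b c : ℤ) :
    ∃ a' b' c', S a' b' c' ∧ 0 < a' ∧ ¬ (a' = 1 ∧ b' = b ∧ c' = c) := by
  obtain ⟨p1, p2, p3, q1, q2, q3, r1, r2, r3, s1, s2, s3, hp, hq, hr, hs, h, h', hd⟩ := T.excl₂
  obtain ⟨a', b', c', d', ⟨h1, rfl⟩, h2, h3⟩ := T.spanning.exists_other ⟨hp, rfl⟩ ⟨hq, rfl⟩
    ⟨hr, rfl⟩ ⟨hs, rfl⟩ hd h b c 1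
  exact ⟨a', b', c', h1, h2, by tauto⟩

/-- All three coordinate sums are at least 2, while the determinant of a matrix with zero diagonal
and positive entries elsewhere is positive. -/
theorem not_all_facet_interiors (T : ThreeColored S) {b c a' c' a'' b'' : ℤ} (h1 : S 0 b c)
    (h2 : S a' 0 c') (h3 : S a'' b'' 0) (hb : 0 < b) (hc : 0 < c) (ha' : 0 < a') (hc' : 0 < c')
    (ha'' : 0 < a'') (hb'' : 0 < b'') : False := by
  have h := T.minor_eq_zero h1 h2 h3 (by omega) (by omega) (by omega)
  unfold det3 at h
  exact absurd (show b * c' * a'' + c * a' * b'' = 0 by linear_combination h) (by positivity)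

theorem interior_left (T : ThreeColored S) {a b c : ℤ} (h : S a b c) (ha : 0 < a) (hb : 0 < b)
    (hc : 0 < c) : a = 1 := by
  obtain ⟨p2, p3, p4, q2, q3, q4, r2, r3, r4, ⟨hp, rfl⟩, ⟨hq, rfl⟩, ⟨hr, rfl⟩, hd⟩ := T.facet
  by_contra hne
  have hp0 := T.nonneg hp
  have hq0 := T.nonneg hq
  have hr0 := T.nonneg hr
  by_cases h0 : p2 + q2 + r2 = 0
  · have e1 : p2 = 0 := by omega
    have e2 : q2 = 0 := by omega
    have e3 : r2 = 0 := by omega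
    subst e1 e2 e3
    exact hd (by unfold det3; ring)
  by_cases h1 : p3 + q3 + r3 = 0
  · have e1 : p3 = 0 := by omega
    have e2 : q3 = 0 := by omega
    have e3 : r3 = 0 := by omega
    subst e1 e2 e3
    exact hd (by unfold det3; ring)
  have := T.bad hp hq hr h (by omega) (by omega) (by omega)
  have h2 : a * det3 p2 p3 1 q2 q3 1 r2 r3 1 = 0 := by
    unfold det4 det3 at *
    linear_combination -this
  exact (mul_ne_zero ha.ne' hd) h2

theorem exists_axis₂ (T : ThreeColored S) (hD : ∀ b c, S 0 b c → 0 < b → 0 < c → False) :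
    ∃ y, S 0 y 0 ∧ 0 < y := by
  obtain ⟨b, c, h, hb⟩ := T.exists_facet_diff
  have hc : c = 0 := by
    by_contra hc
    have := T.nonneg h
    exact hD _ _ h hb (by omega)
  subst hc
  exact ⟨b, h, hb⟩

theorem exists_axis₃ (T : ThreeColored S) (hD : ∀ b c, S 0 b c → 0 < b → 0 < c → False) :
    ∃ z, S 0 0 z ∧ 0 < z :=
  T.swap23.exists_axis₂ fun b c h hb hc => hD c b h hc hb

end ThreeColored

namespace ThreeColored

variable {S : ℤ → ℤ → ℤ → Prop} {p1 p2 p3 q1 q2 q3 r1 r2 r3 : ℤ}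

/-- If the first facet has no relative interior points, then there are no interior points. -/
theorem no_interior (T : ThreeColored S) (hD : ∀ b c, S 0 b c → 0 < b → 0 < c → False)
    {a b c : ℤ} (hn : S a b c) (ha : 0 < a) (hb : 0 < b) (hc : 0 < c) : False := by
  obtain rfl := T.interior_left hn ha hb hc
  obtain rfl := T.swap12.interior_left hn hb ha hc
  obtain rfl := T.swap23.swap12.interior_left hn hc ha hb
  obtain ⟨y, hy, hy0⟩ := T.exists_axis₂ hD
  obtain ⟨z, hz, hz0⟩ := T.exists_axis₃ hD
  -- Together with `(1,1,1)`, `(0,y,0)` and `(0,0,z)`, a point off `x₁ = 0` reaches all sums 2, so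
  -- it lies in their plane.
  have plane : ∀ {y z r1 r2 r3 : ℤ}, S 0 y 0 → 0 < y → S 0 0 z → 0 < z → S r1 r2 r3 → 0 < r1 →
      r2 * z + r3 * y + (y * z - y - z) * r1 = y * z := by
    intro y z r1 r2 r3 hy hy0 hz hz0 hr hr1
    have := T.nonneg hr
    have h := T.bad hn hy hz hr (by omega) (by omega) (by omega)
    unfold det4 det3 at h
    linarith
  obtain ⟨r1, r3, hr, hr1⟩ := T.swap12.exists_facet_diff
  obtain ⟨t1, t2, ht, ht1⟩ := T.swap23.swap12.exists_facet_diff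
  have hr0 := T.nonneg hr
  have ht0 := T.nonneg ht
  have er := plane hy hy0 hz hz0 hr hr1
  have et := plane hy hy0 hz hz0 ht ht1
  -- The plane equation at the fixed point `r` is linear and nontrivial in the intercept `y`.
  have uy : ∀ y', S 0 y' 0 → 0 < y' → y' = y := by
    intro y' hy' hy0'
    have er' := plane hy' hy0' hz hz0 hr hr1
    by_contra hne
    have h1 : r3 + (z - 1) * r1 - z = 0 :=
      (mul_eq_zero.1 (show (y' - y) * (r3 + (z - 1) * r1 - z) = 0 by
        linear_combination er' - er)).resolve_left (by omega)
    exact absurd (show z * r1 = 0 by linear_combination y * h1 - er) (by positivity)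
  have uz : ∀ z', S 0 0 z' → 0 < z' → z' = z := by
    intro z' hz' hz0'
    have et' := plane hy hy0 hz' hz0' ht ht1
    by_contra hne
    have h1 : t2 + (y - 1) * t1 - y = 0 :=
      (mul_eq_zero.1 (show (z' - z) * (t2 + (y - 1) * t1 - y) = 0 by
        linear_combination et' - et)).resolve_left (by omega)
    exact absurd (show y * t1 = 0 by linear_combination z * h1 - et) (by positivity)
  -- The facet needs a point off the line through its two axis points; only the origin is left.
  have hv : S 0 0 0 := by
    obtain ⟨b, c, h, h0⟩ := T.exists_facet_off z y (-(y * z)) (Or.inl hz0.ne')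
    have hbc := T.nonneg h
    have hbc' : ¬ (0 < b ∧ 0 < c) := fun h' => hD _ _ h h'.1 h'.2
    by_cases hb : 0 < b
    · obtain rfl : c = 0 := by omega
      obtain rfl := uy _ h hb
      exact absurd (by ring) h0
    · obtain rfl : b = 0 := by omega
      by_cases hc : 0 < c
      · obtain rfl := uz _ h hc
        exact absurd (by ring) h0
      · obtain rfl : c = 0 := by omega
        exact h
  by_cases y1 : y = 1
  · subst y1
    have hz1 : t1 = z * (t2 - 1) := by linear_combination -et
    have ht2 : 2 ≤ t2 := by
      by_contra hlt
      nlinarith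
    have h := T.bad hv hr ht hz (by omega) (by omega) (by linarith)
    unfold det4 det3 at h
    exact absurd (show r1 * t2 * z = 0 by linear_combination -h) (by positivity)
  by_cases z1 : z = 1
  · subst z1
    have hz1 : r1 = y * (r3 - 1) := by linear_combination -er
    have hr3 : 2 ≤ r3 := by
      by_contra hlt
      nlinarith
    have h := T.bad hv hr ht hy (by omega) (by linarith) (by omega)
    unfold det4 det3 at h
    exact absurd (show t1 * r3 * y = 0 by linear_combination -h) (by positivity)
  have hr1' : r1 = 1 := by
    by_contra hne
    have h := T.bad hv hy hz hr (by omega) (by omega) (by omega)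
    unfold det4 det3 at h
    exact absurd (show y * z * r1 = 0 by linear_combination -h) (by positivity)
  have ht1' : t1 = 1 := by
    by_contra hne
    have h := T.bad hv hy hz ht (by omega) (by omega) (by omega)
    unfold det4 det3 at h
    exact absurd (show y * z * t1 = 0 by linear_combination -h) (by positivity)
  subst hr1' ht1'
  have h3 : r3 ≤ 1 := by
    by_contra hlt
    have h := T.bad hv hr ht hy (by omega) (by omega) (by omega)
    unfold det4 det3 at h
    have hr3 : 0 < r3 := by omega
    exact absurd (show 1 * r3 * y = 0 by linear_combination -h) (by positivity)
  nlinarith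

/-- If there is a point in the relative interior of the third facet and none in that of the
first, then all points of the third axis have height at most `1`. -/
theorem axis₃_le_one (T : ThreeColored S) (hD : ∀ b c, S 0 b c → 0 < b → 0 < c → False)
    {d1 d2 z : ℤ} (hd : S d1 d2 0) (hd1 : 0 < d1) (hd2 : 0 < d2) (hz : S 0 0 z) : z ≤ 1 := by
  by_contra hlt
  obtain ⟨y, hy, hy0⟩ := T.exists_axis₂ hD
  have hz0 : 0 < z := by omega
  have left_one : ∀ {d1 d2 : ℤ}, S d1 d2 0 → 0 < d1 → 0 < d2 → d1 = 1 := by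
    intro d1 d2 hd hd1 hd2
    by_contra hne
    have h := T.minor_eq_zero hd hy hz (by omega) (by omega) (by omega)
    unfold det3 at h
    exact absurd (show d1 * y * z = 0 by linear_combination h) (by positivity)
  obtain rfl := left_one hd hd1 hd2
  have plane : ∀ {y r1 r2 r3 : ℤ}, S 0 y 0 → 0 < y → S r1 r2 r3 → 0 < r1 →
      r2 * z + r3 * y + (y * z - d2 * z) * r1 = y * z := by
    intro y r1 r2 r3 hy hy0 hr hr1
    have := T.nonneg hr
    have h := T.bad hd hy hz hr (by omega) (by omega) (by omega)
    unfold det4 det3 at h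
    linarith
  obtain ⟨r1, r3, hr, hr1⟩ := T.swap12.exists_facet_diff
  have hr0 := T.nonneg hr
  have er := plane hy hy0 hr hr1
  have uy : ∀ y', S 0 y' 0 → 0 < y' → y' = y := by
    intro y' hy' hy0'
    have er' := plane hy' hy0' hr hr1
    by_contra hne
    have h1 : r3 + z * r1 - z = 0 :=
      (mul_eq_zero.1 (show (y' - y) * (r3 + z * r1 - z) = 0 by
        linear_combination er' - er)).resolve_left (by omega)
    exact absurd (show d2 * z * r1 = 0 by linear_combination y * h1 - er) (by positivity)
  have hv : S 0 0 0 := by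
    -- This affine functional vanishes on the trace of the plane on `x₃ = 0`, the line through `(1,
    -- d2)` and `(0, y)`.
    obtain ⟨a, b, h, h0⟩ := T.swap23.swap12.exists_facet_off (y - d2) 1 (-y) (by simp)
    have hab := T.nonneg h
    by_cases ha : 0 < a
    · have e := plane hy hy0 h ha
      exact absurd (show z * ((y - d2) * a + 1 * b + -y) = 0 by linear_combination e)
        (mul_ne_zero hz0.ne' h0)
    · obtain rfl : a = 0 := by omega
      by_cases hb : 0 < b
      · obtain rfl := uy _ h hb
        exact absurd (by ring) h0
      · obtain rfl : b = 0 := by omega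
        exact h
  have right_one : ∀ {d2 : ℤ}, S 1 d2 0 → 0 < d2 → d2 = 1 := by
    intro d2 hd hd2
    by_contra hne
    have h := T.bad hv hd hz hr (by omega) (by omega) (by omega)
    unfold det4 det3 at h
    exact absurd (show d2 * z * r1 = 0 by linear_combination -h) (by positivity)
  obtain rfl := right_one hd hd2
  -- The excluded flat border has `A = (0,0,0)`, `B = (0,0,z)` and `C = (1,1,0)`.
  refine T.flat₁₂ hv hz hz0.ne hd fun a b c h ha hb => ?_
  have hc : c = 0 := by
    by_contra hc
    have := T.nonneg h
    exact T.no_interior hD h ha hb (by omega)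
  subst hc
  obtain rfl := left_one h ha hb
  exact ⟨rfl, right_one h hb, rfl⟩

theorem no_facet_interior₃ (T : ThreeColored S) (hD : ∀ b c, S 0 b c → 0 < b → 0 < c → False)
    {d1 d2 : ℤ} (hd : S d1 d2 0) (hd1 : 0 < d1) (hd2 : 0 < d2) : False := by
  by_cases hE : ∃ e1 e3, S e1 0 e3 ∧ 0 < e1 ∧ 0 < e3
  · obtain ⟨e1, e3, he, he1, he3⟩ := hE
    have facet_pt : ∀ {b c}, S 0 b c → (b = 0 ∧ c = 0) ∨ (b = 1 ∧ c = 0) ∨ (b = 0 ∧ c = 1) := by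
      intro b c h
      have h0 := T.nonneg h
      have h1 : ¬ (0 < b ∧ 0 < c) := fun h' => hD _ _ h h'.1 h'.2
      by_cases hb : b = 0
      · subst hb
        have := T.axis₃_le_one hD hd hd1 hd2 h
        omega
      · obtain rfl : c = 0 := by omega
        have := T.swap23.axis₃_le_one (fun b c h hb hc => hD c b h hc hb) he he1 he3 h
        omega
    obtain ⟨p1, p2, p3, q1, q2, q3, r1, r2, r3, s1, s2, s3, hp, hq, hr, hs, h, h', hdet⟩ := T.excl₁
    have hsum : p1 + q1 + r1 + s1 ≤ 1 := by
      by_contra hlt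
      exact hdet (T.bad hp hq hr hs (by omega) h h')
    have hp0 := T.nonneg hp
    have hq0 := T.nonneg hq
    have hr0 := T.nonneg hr
    have hs0 := T.nonneg hs
    have key : ∀ {p1 p2 p3}, S p1 p2 p3 → (p1 = 0 ∧ p2 = 0 ∧ p3 = 0) ∨
        (p1 = 0 ∧ p2 = 1 ∧ p3 = 0) ∨ (p1 = 0 ∧ p2 = 0 ∧ p3 = 1) ∨
        (0 < p1 ∧ p2 = 0) ∨ (0 < p1 ∧ p3 = 0) := by
      intro p1 p2 p3 h
      have h0 := T.nonneg h
      have h1 : ¬ (0 < p1 ∧ 0 < p2 ∧ 0 < p3) := fun h' => T.no_interior hD h h'.1 h'.2.1 h'.2.2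
      by_cases hp : p1 = 0
      · subst hp
        have := facet_pt h
        omega
      · omega
    -- The basis must consist of the three listed points with `x₁ = 0` and one apex. These three
    -- contribute 1 to each of the second and third sums, but the apex is positive in at most one of
    -- the two coordinates.
    rcases key hp with ⟨rfl, rfl, rfl⟩ | ⟨rfl, rfl, rfl⟩ | ⟨rfl, rfl, rfl⟩ | hp' | hp' <;>
    rcases key hq with ⟨rfl, rfl, rfl⟩ | ⟨rfl, rfl, rfl⟩ | ⟨rfl, rfl, rfl⟩ | hq' | hq' <;>
    first
    | omega
    | exact hdet (by unfold det4 det3; ring1)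
    | (rcases key hr with ⟨rfl, rfl, rfl⟩ | ⟨rfl, rfl, rfl⟩ | ⟨rfl, rfl, rfl⟩ | hr' | hr' <;>
      first
      | omega
      | exact hdet (by unfold det4 det3; ring1)
      | (rcases key hs with ⟨rfl, rfl, rfl⟩ | ⟨rfl, rfl, rfl⟩ | ⟨rfl, rfl, rfl⟩ | hs' | hs' <;>
        first
        | omega
        | exact hdet (by unfold det4 det3; ring1)))
  · obtain ⟨c, a, b, h, hc, hne⟩ := T.swap23.swap12.other 0 0
    have h0 := T.nonneg h
    have h1 : ¬ (0 < a ∧ 0 < b) := fun h' => T.no_interior hD h h'.1 h'.2 hc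
    have ha : a = 0 := by
      by_contra ha
      obtain rfl : b = 0 := by omega
      exact hE ⟨_, _, h, by omega, hc⟩
    subst ha
    have hb : b = 0 := by
      by_contra hb
      exact hD _ _ h (by omega) hc
    subst hb
    have := T.axis₃_le_one hD hd hd1 hd2 h
    omega

/-- Otherwise all points lie on the axes, each axis carries a point of height at least 2, and a
fourth point on `x₁ = 0` completes these to a tetrahedron without colour. -/
theorem exists_facet_interior₁ (T : ThreeColored S) : ∃ b c, S 0 b c ∧ 0 < b ∧ 0 < c := by
  by_contra! hD'
  have hD : ∀ b c, S 0 b c → 0 < b → 0 < c → False := fun b c h hb hc =>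
    absurd (hD' b c h hb) (by omega)
  have hD2 : ∀ {b c}, S 0 b c → b = 0 ∨ c = 0 := by
    intro b c h
    have := T.nonneg h
    by_contra hne
    exact hD _ _ h (by omega) (by omega)
  have h3 : ∀ {a b}, S a b 0 → a = 0 ∨ b = 0 := by
    intro a b h
    have := T.nonneg h
    by_contra hne
    exact T.no_facet_interior₃ hD h (by omega) (by omega)
  have h2 : ∀ {a c}, S a 0 c → a = 0 ∨ c = 0 := by
    intro a c h
    have := T.nonneg h
    by_contra hne
    exact T.swap23.no_facet_interior₃ (fun b c h hb hc => hD c b h hc hb) h (by omega) (by omega)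
  have axis : ∀ {a b c}, S a b c → (b = 0 ∧ c = 0) ∨ (a = 0 ∧ c = 0) ∨ (a = 0 ∧ b = 0) := by
    intro a b c h
    have h0 := T.nonneg h
    have h1 : ¬ (0 < a ∧ 0 < b ∧ 0 < c) := fun h' => T.no_interior hD h h'.1 h'.2.1 h'.2.2
    by_cases ha : a = 0
    · subst ha
      have := hD2 h
      omega
    by_cases hb : b = 0
    · subst hb
      have := h2 h
      omega
    obtain rfl : c = 0 := by omega
    have := h3 h
    omega
  obtain ⟨x, hx, hx2⟩ : ∃ x, S x 0 0 ∧ 2 ≤ x := by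
    obtain ⟨x, b, c, h, hx, hne⟩ := T.other 0 0
    obtain ⟨rfl, rfl⟩ : b = 0 ∧ c = 0 := by have := axis h; omega
    exact ⟨x, h, by omega⟩
  obtain ⟨y, hy, hy2⟩ : ∃ y, S 0 y 0 ∧ 2 ≤ y := by
    obtain ⟨x, b, c, h, hx, hne⟩ := T.swap12.other 0 0
    obtain ⟨rfl, rfl⟩ : b = 0 ∧ c = 0 := by have := axis h; omega
    exact ⟨x, h, by omega⟩
  obtain ⟨z, hz, hz2⟩ : ∃ z, S 0 0 z ∧ 2 ≤ z := by
    obtain ⟨x, b, c, h, hx, hne⟩ := T.swap23.swap12.other 0 0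
    obtain ⟨rfl, rfl⟩ : b = 0 ∧ c = 0 := by have := axis h; omega
    exact ⟨x, h, by omega⟩
  obtain ⟨b, c, h, h0⟩ := T.exists_facet_off z y (-(y * z)) (Or.inl (by omega))
  have hbc := T.nonneg h
  have hdet := T.bad h hx hy hz (by omega) (by omega) (by omega)
  unfold det4 det3 at hdet
  exact absurd (show x * (z * b + y * c + -(y * z)) = 0 by linear_combination hdet)
    (mul_ne_zero (by omega) h0)

theorem contradiction (T : ThreeColored S) : False := by
  obtain ⟨b, c, h1, hb, hc⟩ := T.exists_facet_interior₁
  obtain ⟨a', c', h2, ha', hc'⟩ := T.swap12.exists_facet_interior₁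
  obtain ⟨a'', b'', h3, ha'', hb''⟩ := T.swap23.swap12.exists_facet_interior₁
  exact T.not_all_facet_interiors h1 h2 h3 hb hc ha' hc' ha'' hb''

end ThreeColored

/-! ### Four colours: setup -/

/-- The set of points is the standard cross-polytope. -/
def IsCrossPolytope (S : ℤ → ℤ → ℤ → ℤ → Prop) : Prop :=
  S 1 1 0 0 ∧ S 1 0 1 0 ∧ S 1 0 0 1 ∧ S 0 1 1 0 ∧ S 0 1 0 1 ∧ S 0 0 1 1 ∧
    ∀ a b c d, S a b c d → a ≤ 1 ∧ b ≤ 1 ∧ c ≤ 1 ∧ d ≤ 1 ∧ a + b + c + d = 2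

/-- Every basis has some coordinate sum `1`, the first coordinate is indispensable for that, and
`S` is neither a flat border nor has a triangle projection with respect to the first two
coordinates, nor is it the standard cross-polytope. -/
structure FourColored (S : ℤ → ℤ → ℤ → ℤ → Prop) : Prop extends SpansPositiveHyperplane S where
  bad : ∀ {p1 p2 p3 p4 q1 q2 q3 q4 r1 r2 r3 r4 s1 s2 s3 s4}, S p1 p2 p3 p4 → S q1 q2 q3 q4 →
    S r1 r2 r3 r4 → S s1 s2 s3 s4 → 2 ≤ p1 + q1 + r1 + s1 → 2 ≤ p2 + q2 + r2 + s2 →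
    2 ≤ p3 + q3 + r3 + s3 → 2 ≤ p4 + q4 + r4 + s4 →
    det4 p1 p2 p3 p4 q1 q2 q3 q4 r1 r2 r3 r4 s1 s2 s3 s4 = 0
  excl : ∃ p1 p2 p3 p4 q1 q2 q3 q4 r1 r2 r3 r4 s1 s2 s3 s4, S p1 p2 p3 p4 ∧ S q1 q2 q3 q4 ∧
    S r1 r2 r3 r4 ∧ S s1 s2 s3 s4 ∧ 2 ≤ p2 + q2 + r2 + s2 ∧ 2 ≤ p3 + q3 + r3 + s3 ∧
    2 ≤ p4 + q4 + r4 + s4 ∧ det4 p1 p2 p3 p4 q1 q2 q3 q4 r1 r2 r3 r4 s1 s2 s3 s4 ≠ 0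
  not_flat : ¬ FlatBorder S
  not_triangle : ¬ TriangleProjection S
  not_cross : ¬ IsCrossPolytope S

/-- `Reorder S R` says that `R` arises from `S` by a permutation of the coordinates. -/
inductive Reorder (S : ℤ → ℤ → ℤ → ℤ → Prop) : (ℤ → ℤ → ℤ → ℤ → Prop) → Prop
  | refl : Reorder S S
  | swap12 {R} : Reorder S R → Reorder S (fun a b c d => R b a c d)
  | swap23 {R} : Reorder S R → Reorder S (fun a b c d => R a c b d)
  | swap34 {R} : Reorder S R → Reorder S (fun a b c d => R a b d c)

theorem Reorder.trans {S R Q : ℤ → ℤ → ℤ → ℤ → Prop} (h : Reorder S R) (h' : Reorder R Q) :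
    Reorder S Q := by
  induction h' with
  | refl => exact h
  | swap12 _ ih => exact ih.swap12
  | swap23 _ ih => exact ih.swap23
  | swap34 _ ih => exact ih.swap34

/-- `FourColored` for all orders of the coordinates. -/
def FullyFourColored (S : ℤ → ℤ → ℤ → ℤ → Prop) : Prop :=
  ∀ R, Reorder S R → FourColored R

namespace FullyFourColored

variable {S : ℤ → ℤ → ℤ → ℤ → Prop}
  {p1 p2 p3 p4 q1 q2 q3 q4 r1 r2 r3 r4 s1 s2 s3 s4 a b c d : ℤ}

theorem core (T : FullyFourColored S) : FourColored S := T S .refl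

theorem swap12 (T : FullyFourColored S) : FullyFourColored (fun a b c d => S b a c d) :=
  fun R h => T R (Reorder.trans (.swap12 .refl) h)

theorem swap23 (T : FullyFourColored S) : FullyFourColored (fun a b c d => S a c b d) :=
  fun R h => T R (Reorder.trans (.swap23 .refl) h)

theorem swap34 (T : FullyFourColored S) : FullyFourColored (fun a b c d => S a b d c) :=
  fun R h => T R (Reorder.trans (.swap34 .refl) h)

theorem swap13 (T : FullyFourColored S) : FullyFourColored (fun a b c d => S c b a d) :=
  T.swap12.swap23.swap12

theorem swap24 (T : FullyFourColored S) : FullyFourColored (fun a b c d => S a d c b) :=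
  T.swap23.swap34.swap23

theorem swap14 (T : FullyFourColored S) : FullyFourColored (fun a b c d => S d b c a) :=
  T.swap12.swap24.swap12

theorem nonneg (T : FullyFourColored S) (h : S a b c d) : 0 ≤ a ∧ 0 ≤ b ∧ 0 ≤ c ∧ 0 ≤ d :=
  T.core.nonneg h

theorem bad (T : FullyFourColored S) (hp : S p1 p2 p3 p4) (hq : S q1 q2 q3 q4)
    (hr : S r1 r2 r3 r4) (hs : S s1 s2 s3 s4) (h1 : 2 ≤ p1 + q1 + r1 + s1)
    (h2 : 2 ≤ p2 + q2 + r2 + s2) (h3 : 2 ≤ p3 + q3 + r3 + s3) (h4 : 2 ≤ p4 + q4 + r4 + s4) :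
    det4 p1 p2 p3 p4 q1 q2 q3 q4 r1 r2 r3 r4 s1 s2 s3 s4 = 0 :=
  T.core.bad hp hq hr hs h1 h2 h3 h4

theorem anti (T : FullyFourColored S) (hp : S p1 p2 p3 p4) (hq : S q1 q2 q3 q4)
    (h1 : p1 ≤ q1) (h2 : p2 ≤ q2) (h3 : p3 ≤ q3) (h4 : p4 ≤ q4) :
    p1 = q1 ∧ p2 = q2 ∧ p3 = q3 ∧ p4 = q4 :=
  T.core.anti hp hq h1 h2 h3 h4

theorem minors (T : FullyFourColored S) (hp : S p1 p2 p3 p4) (hq : S q1 q2 q3 q4)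
    (hr : S r1 r2 r3 r4) (h1 : 2 ≤ p1 + q1 + r1) (h2 : 2 ≤ p2 + q2 + r2)
    (h3 : 2 ≤ p3 + q3 + r3) (h4 : 2 ≤ p4 + q4 + r4) :
    det3 p1 p2 p3 q1 q2 q3 r1 r2 r3 = 0 ∧ det3 p1 p2 p4 q1 q2 q4 r1 r2 r4 = 0 ∧
    det3 p1 p3 p4 q1 q3 q4 r1 r3 r4 = 0 ∧ det3 p2 p3 p4 q2 q3 q4 r2 r3 r4 = 0 :=
  T.core.minors_eq_zero fun s1 s2 s3 s4 hs => by
    have := T.nonneg hs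
    exact T.bad hp hq hr hs (by omega) (by omega) (by omega) (by omega)

theorem facet_apex (T : FullyFourColored S) :
    Spans3 (fun b c d => S 0 b c d) ∧ ∃ b c d, S 1 b c d := by
  obtain ⟨p1, p2, p3, p4, q1, q2, q3, q4, r1, r2, r3, r4, s1, s2, s3, s4, hp, hq, hr, hs,
    h2, h3, h4, hd⟩ := T.core.excl
  refine T.core.facet_of_sum_le_one hp hq hr hs hd ?_
  by_contra hlt
  exact hd (T.bad hp hq hr hs (by omega) h2 h3 h4)

theorem facet (T : FullyFourColored S) : Spans3 (fun b c d => S 0 b c d) := T.facet_apex.1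

theorem exists_facet_diff (T : FullyFourColored S) : ∃ b c d, S 0 b c d ∧ 0 < b := by
  obtain ⟨b, c, d, h, h0⟩ := T.facet.exists_ne 1 0 0 (by simp)
  have := T.nonneg h
  exact ⟨b, c, d, h, by omega⟩

theorem other (T : FullyFourColored S) (b c d : ℤ) :
    ∃ a' b' c' d', S a' b' c' d' ∧ 0 < a' ∧ ¬ (a' = 1 ∧ b' = b ∧ c' = c ∧ d' = d) := by
  obtain ⟨p1, p2, p3, p4, q1, q2, q3, q4, r1, r2, r3, r4, s1, s2, s3, s4, hp, hq, hr, hs,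
    h2, h3, h4, hd⟩ := T.swap12.core.excl
  exact T.core.exists_other hp hq hr hs
    (fun h0 => hd (by unfold det4 det3 at *; linear_combination -h0)) h2 b c d

/-- The point `(1,0,0,0)` would lie below any other point off `x₁ = 0`, contradicting the antichain
property. -/
theorem two_le_vertex (T : FullyFourColored S) (h : S a 0 0 0) : 2 ≤ a := by
  have h0 := T.nonneg h
  by_contra hlt
  have ha : a = 0 ∨ a = 1 := by omega
  rcases ha with rfl | rfl
  · exact T.core.ne_zero h
  · obtain ⟨a', b', c', d', h', ha', hne⟩ := T.other 0 0 0
    have := T.nonneg h'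
    have := T.anti h h' (by omega) (by omega) (by omega) (by omega)
    omega

theorem interior_left (T : FullyFourColored S) (h : S a b c d) (ha : 0 < a) (hb : 0 < b)
    (hc : 0 < c) (hd : 0 < d) : a = 1 := by
  obtain ⟨p2, p3, p4, q2, q3, q4, r2, r3, r4, hp, hq, hr, hdet⟩ := T.facet
  by_contra hne
  have hp0 := T.nonneg hp
  have hq0 := T.nonneg hq
  have hr0 := T.nonneg hr
  by_cases h0 : p2 + q2 + r2 = 0
  · obtain ⟨rfl, rfl, rfl⟩ : p2 = 0 ∧ q2 = 0 ∧ r2 = 0 := by omega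
    exact hdet (by unfold det3; ring1)
  by_cases h1 : p3 + q3 + r3 = 0
  · obtain ⟨rfl, rfl, rfl⟩ : p3 = 0 ∧ q3 = 0 ∧ r3 = 0 := by omega
    exact hdet (by unfold det3; ring1)
  by_cases h2 : p4 + q4 + r4 = 0
  · obtain ⟨rfl, rfl, rfl⟩ : p4 = 0 ∧ q4 = 0 ∧ r4 = 0 := by omega
    exact hdet (by unfold det3; ring1)
  have := T.bad hp hq hr h (by omega) (by omega) (by omega) (by omega)
  have h2 : a * det3 p2 p3 p4 q2 q3 q4 r2 r3 r4 = 0 := by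
    unfold det4 det3 at *
    linear_combination -this
  exact (mul_ne_zero ha.ne' hdet) h2

/-! ### Four colours: no point with all coordinates positive -/

section Interior

variable {u w u3 u4 : ℤ}

/-- The last degenerate case: missing colours force `s3 = r3 = 0`, and then either the antichain
property fails or all four vertices of the tetrahedron occur. -/
theorem no_interior_of_vertex (T : FullyFourColored S) (hn : S 1 1 1 1) (hp : S 0 0 0 p4)
    (hp4 : 0 < p4) (hq : S 0 0 q3 q4) (hq3 : 0 < q3) (hs : S s1 0 s3 s4) (hs1 : 0 < s1)
    (hr : S 0 r2 r3 r4) (hr2 : 0 < r2) (hu : S w w 0 u4) (hw : 0 < w) : False := by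
  have hp2 : 2 ≤ p4 := T.swap14.two_le_vertex hp
  have hq0 := T.nonneg hq
  have hs0 := T.nonneg hs
  have hr0 := T.nonneg hr
  have hu0 := T.nonneg hu
  have hs3 : s3 = 0 := by
    by_contra hne
    have h := T.bad hn hu hp hs (by omega) (by omega) (by omega) (by omega)
    unfold det4 det3 at h
    exact absurd (show p4 * w * s1 = 0 by linear_combination h) (by positivity)
  have hr3 : r3 = 0 := by
    by_contra hne
    have h := T.bad hn hu hp hr (by omega) (by omega) (by omega) (by omega)
    unfold det4 det3 at h
    exact absurd (show p4 * w * r2 = 0 by linear_combination -h) (by positivity)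
  subst hs3 hr3
  -- The expression vanishes exactly when `(1,1,1,1)`, `u` and `q` are dependent.
  by_cases hD : w * q4 + (u4 - w) * q3 = 0
  · have h1 : w = 1 ∨ q3 = 1 := by
      by_contra! hne
      have h := T.bad hu hq hp hr (by omega) (by omega) (by omega) (by omega)
      unfold det4 det3 at h
      exact absurd (show w * q3 * p4 * r2 = 0 by linear_combination h) (by positivity)
    rcases h1 with rfl | rfl
    · have : u4 ≤ 1 := by nlinarith
      have := T.anti hu hn le_rfl le_rfl (by omega) (by omega)
      omega
    · have : q4 ≤ 1 := by nlinarith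
      have := T.anti hq hn (by omega) (by omega) (by omega) (by omega)
      omega
  · have h1 : u4 + q4 + r4 = 0 := by
      by_contra hne
      have h := T.bad hn hu hq hr (by omega) (by omega) (by omega) (by omega)
      unfold det4 det3 at h
      exact absurd (show r2 * (w * q4 + (u4 - w) * q3) = 0 by linear_combination -h)
        (mul_ne_zero hr2.ne' hD)
    have h2 : u4 + q4 + s4 = 0 := by
      by_contra hne
      have h := T.bad hn hu hq hs (by omega) (by omega) (by omega) (by omega)
      unfold det4 det3 at h
      exact absurd (show s1 * (w * q4 + (u4 - w) * q3) = 0 by linear_combination h)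
        (mul_ne_zero hs1.ne' hD)
    obtain ⟨rfl, rfl, rfl⟩ : q4 = 0 ∧ r4 = 0 ∧ s4 = 0 := by omega
    have := T.two_le_vertex hs
    have := T.swap12.two_le_vertex hr
    have := T.swap13.two_le_vertex hq
    have h := T.bad hs hr hq hp (by omega) (by omega) (by omega) (by omega)
    unfold det4 det3 at h
    exact absurd (show s1 * r2 * q3 * p4 = 0 by linear_combination h) (by positivity)

/-- By `hD` the points `n`, `u`, `p`, `r` form a basis. Its colour can only be 3 or 4, and then `u`
and `p` degenerate to the case of a vertex. -/
theorem no_interior_of_edge (T : FullyFourColored S) (hn : S 1 1 1 1) (hp : S 0 0 p3 p4)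
    (hq : S 0 0 q3 q4) (hpq : p3 * q4 ≠ p4 * q3) (hs : S s1 0 s3 s4) (hs1 : 0 < s1)
    (hr : S 0 r2 r3 r4) (hr2 : 0 < r2) (hu : S w w u3 u4) (hw : 0 < w)
    (hD : (u3 - w) * p4 ≠ (u4 - w) * p3) : False := by
  have hp0 := T.nonneg hp
  have hq0 := T.nonneg hq
  have hr0 := T.nonneg hr
  have hu0 := T.nonneg hu
  by_cases h3 : u3 + p3 + r3 = 0
  · obtain ⟨rfl, rfl⟩ : u3 = 0 ∧ p3 = 0 := by omega
    have hp4 : p4 ≠ 0 := by rintro rfl; simp at hpq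
    have hq3 : q3 ≠ 0 := by rintro rfl; simp at hpq
    exact T.no_interior_of_vertex hn hp (by omega) hq (by omega) hs hs1 hr hr2 hu hw
  by_cases h4 : u4 + p4 + r4 = 0
  · obtain ⟨rfl, rfl⟩ : u4 = 0 ∧ p4 = 0 := by omega
    have hp3 : p3 ≠ 0 := by rintro rfl; simp at hpq
    have hq4 : q4 ≠ 0 := by rintro rfl; simp at hpq
    exact T.swap34.no_interior_of_vertex hn hp (by omega) hq (by omega) hs hs1 hr hr2 hu hw
  have h := T.bad hn hu hp hr (by omega) (by omega) (by omega) (by omega)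
  unfold det4 det3 at h
  exact absurd (show r2 * ((u3 - w) * p4 - (u4 - w) * p3) = 0 by linear_combination h)
    (mul_ne_zero hr2.ne' (sub_ne_zero.2 hD))

/-- The points `p`, `q` and `(1,1,1,1)` form a flat border unless another point `u` has both first
coordinates positive. Since `u` is not a multiple of `(1,1,1,1)`, one of `p`, `q` is independent of
these two. -/
theorem no_interior_of_edge_pair (T : FullyFourColored S) (hn : S 1 1 1 1) (hp : S 0 0 p3 p4)
    (hq : S 0 0 q3 q4) (hpq : p3 * q4 ≠ p4 * q3) (hs : S s1 0 s3 s4) (hs1 : 0 < s1) : False := by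
  obtain ⟨r2, r3, r4, hr, hr2⟩ := T.exists_facet_diff
  have hp0 := T.nonneg hp
  have hq0 := T.nonneg hq
  refine T.core.not_flat ⟨p3, p4, q3, q4, 1, 1, hp, hq, ?_, hn, fun u v u3 u4 hu hu1 hv => ?_⟩
  · rintro ⟨rfl, rfl⟩
    exact hpq (mul_comm _ _)
  by_contra hne
  have hu0 := T.nonneg hu
  have h3 : p3 + q3 ≠ 0 := by
    intro h
    obtain ⟨rfl, rfl⟩ : p3 = 0 ∧ q3 = 0 := by omega
    simp at hpq
  have h4 : p4 + q4 ≠ 0 := by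
    intro h
    obtain ⟨rfl, rfl⟩ : p4 = 0 ∧ q4 = 0 := by omega
    simp at hpq
  have huv : u = v := by
    have h := T.bad hn hp hq hu (by omega) (by omega) (by omega) (by omega)
    unfold det4 det3 at h
    have h' : (p3 * q4 - p4 * q3) * (u - v) = 0 := by
      linear_combination -h
    have := (mul_eq_zero.1 h').resolve_left (sub_ne_zero.2 hpq)
    omega
  subst huv
  by_cases hDp : (u3 - u) * p4 = (u4 - u) * p3
  · by_cases hDq : (u3 - u) * q4 = (u4 - u) * q3
    · have e3 : u3 - u = 0 := (mul_eq_zero.1 (show (p3 * q4 - p4 * q3) * (u3 - u) = 0 by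
        linear_combination p3 * hDq - q3 * hDp)).resolve_left (sub_ne_zero.2 hpq)
      have e4 : u4 - u = 0 := (mul_eq_zero.1 (show (p3 * q4 - p4 * q3) * (u4 - u) = 0 by
        linear_combination p4 * hDq - q4 * hDp)).resolve_left (sub_ne_zero.2 hpq)
      obtain ⟨rfl, rfl⟩ : u3 = u ∧ u4 = u := by omega
      have := T.core.smul hn hu u4 1 (by ring) (by ring) (by ring) (by ring)
      omega
    · exact T.no_interior_of_edge hn hq hp (fun h => hpq (by linarith)) hs hs1 hr hr2 hu hu1 hDq
  · exact T.no_interior_of_edge hn hp hq hpq hs hs1 hr hr2 hu hu1 hDp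

theorem no_interior_of_basis (T : FullyFourColored S) (hn : S 1 1 1 1) (hs : S s1 s2 s3 s4)
    (hs1 : 0 < s1) (hp : S 0 p2 p3 p4) (hq : S 0 q2 q3 q4)
    (hd : det4 1 1 1 1 s1 s2 s3 s4 0 p2 p3 p4 0 q2 q3 q4 ≠ 0) : False := by
  have hp0 := T.nonneg hp
  have hq0 := T.nonneg hq
  have hs0 := T.nonneg hs
  by_cases h2 : s2 + p2 + q2 = 0
  · obtain ⟨rfl, rfl, rfl⟩ : s2 = 0 ∧ p2 = 0 ∧ q2 = 0 := by omega
    refine T.no_interior_of_edge_pair hn hp hq (fun h => hd ?_) hs hs1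
    unfold det4 det3
    linear_combination -s1 * h
  by_cases h3 : s3 + p3 + q3 = 0
  · obtain ⟨rfl, rfl, rfl⟩ : s3 = 0 ∧ p3 = 0 ∧ q3 = 0 := by omega
    refine T.swap23.no_interior_of_edge_pair hn hp hq (fun h => hd ?_) hs hs1
    unfold det4 det3
    linear_combination s1 * h
  by_cases h4 : s4 + p4 + q4 = 0
  · obtain ⟨rfl, rfl, rfl⟩ : s4 = 0 ∧ p4 = 0 ∧ q4 = 0 := by omega
    refine T.swap24.no_interior_of_edge_pair hn hp hq (fun h => hd ?_) hs hs1
    unfold det4 det3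
    linear_combination s1 * h
  exact hd (T.bad hn hs hp hq (by omega) (by omega) (by omega) (by omega))

theorem no_interior (T : FullyFourColored S) (hn : S a b c d) (ha : 0 < a) (hb : 0 < b)
    (hc : 0 < c) (hd : 0 < d) : False := by
  obtain rfl := T.interior_left hn ha hb hc hd
  obtain rfl := T.swap12.interior_left hn hb ha hc hd
  obtain rfl := T.swap13.interior_left hn hc hb ha hd
  obtain rfl := T.swap14.interior_left hn hd hb hc ha
  obtain ⟨p2, p3, p4, q2, q3, q4, r2, r3, r4, hp, hq, hr, hdet⟩ := T.facet
  obtain ⟨s1, s2, s3, s4, hs, hs1, hne⟩ := T.other 1 1 1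
  have hpq : det4 1 1 1 1 s1 s2 s3 s4 0 p2 p3 p4 0 q2 q3 q4 = 0 := by
    by_contra h
    exact T.no_interior_of_basis hn hs hs1 hp hq h
  have hpr : det4 1 1 1 1 s1 s2 s3 s4 0 p2 p3 p4 0 r2 r3 r4 = 0 := by
    by_contra h
    exact T.no_interior_of_basis hn hs hs1 hp hr h
  have hqr : det4 1 1 1 1 s1 s2 s3 s4 0 q2 q3 q4 0 r2 r3 r4 = 0 := by
    by_contra h
    exact T.no_interior_of_basis hn hs hs1 hq hr h
  -- Dependence with all pairs from a basis of `x₁ = 0` makes `s` a multiple of `(1,1,1,1)`.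
  have e2 : s2 - s1 = 0 := (mul_eq_zero.1 (show det3 p2 p3 p4 q2 q3 q4 r2 r3 r4 * (s2 - s1) = 0 by
    unfold det4 det3 at *
    linear_combination p2 * hqr - q2 * hpr + r2 * hpq)).resolve_left hdet
  have e3 : s3 - s1 = 0 := (mul_eq_zero.1 (show det3 p2 p3 p4 q2 q3 q4 r2 r3 r4 * (s3 - s1) = 0 by
    unfold det4 det3 at *
    linear_combination p3 * hqr - q3 * hpr + r3 * hpq)).resolve_left hdet
  have e4 : s4 - s1 = 0 := (mul_eq_zero.1 (show det3 p2 p3 p4 q2 q3 q4 r2 r3 r4 * (s4 - s1) = 0 by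
    unfold det4 det3 at *
    linear_combination p4 * hqr - q4 * hpr + r4 * hpq)).resolve_left hdet
  have := T.core.smul hn hs s1 1 (by ring) (by linarith) (by linarith) (by linarith)
  omega

end Interior

end FullyFourColored

namespace FullyFourColored

variable {S : ℤ → ℤ → ℤ → ℤ → Prop}
  {p1 p2 p3 p4 q1 q2 q3 q4 r1 r2 r3 r4 s1 s2 s3 s4 a b c d : ℤ}

/-! ### Four colours: no points inside two different facets -/

section TwoFacets

variable {a' c' d' t t' : ℤ}

/-- The two facet points already reach sum 2 in coordinates 3 and 4 and sum at least 1 in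
coordinates 1 and 2. A point positive in both of the latter would be dependent on them, which makes
it interior. -/
theorem eq_zero_of_two_facets (T : FullyFourColored S) (hd1 : S 0 b c d) (hb : 0 < b) (hc : 0 < c)
    (hd : 0 < d) (hd2 : S a' 0 c' d') (ha' : 0 < a') (hc' : 0 < c') (hd' : 0 < d')
    (h : S p1 p2 p3 p4) : p1 = 0 ∨ p2 = 0 := by
  have h0 := T.nonneg h
  by_contra! hne
  have hp1 : 0 < p1 := by omega
  have hp2 : 0 < p2 := by omega
  obtain ⟨h123, h124, -, -⟩ := T.minors hd1 hd2 h (by omega) (by omega) (by omega) (by omega)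
  unfold det3 at h123 h124
  have hp3 : p3 ≠ 0 := by
    rintro rfl
    exact absurd (show b * c' * p1 + c * a' * p2 = 0 by linear_combination h123) (by positivity)
  have hp4 : p4 ≠ 0 := by
    rintro rfl
    exact absurd (show b * d' * p1 + d * a' * p2 = 0 by linear_combination h124) (by positivity)
  exact T.no_interior h hp1 hp2 (by omega) (by omega)

/-- Without vertex 4, the facet `x₃ = 0` carries only points `(x1,0,0,x4)` and `(0,y2,0,y4)`. The
vanishing determinant determines each from the other, so there is one of each and they cannot span.
-/
theorem exists_vertex_of_two_facets (T : FullyFourColored S) (hd1 : S 0 b c d) (hb : 0 < b)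
    (hc : 0 < c) (hd : 0 < d) (hd2 : S a' 0 c' d') (ha' : 0 < a') (hc' : 0 < c') (hd' : 0 < d') :
    ∃ t, S 0 0 0 t := by
  by_contra! hV
  have h12 : ∀ {p1 p2 p3 p4}, S p1 p2 p3 p4 → p1 = 0 ∨ p2 = 0 :=
    T.eq_zero_of_two_facets hd1 hb hc hd hd2 ha' hc' hd'
  obtain ⟨x1, x4, hx, hx1⟩ : ∃ x1 x4, S x1 0 0 x4 ∧ 0 < x1 := by
    obtain ⟨y, x, w, h, hne⟩ := T.swap13.facet.exists_ne 0 1 0 (by simp)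
    have h0 := T.nonneg h
    have hx : x ≠ 0 := by simpa using hne
    obtain rfl := (h12 h).resolve_left hx
    exact ⟨_, _, h, by omega⟩
  obtain ⟨y2, y4, hy, hy2⟩ : ∃ y2 y4, S 0 y2 0 y4 ∧ 0 < y2 := by
    obtain ⟨y, x, w, h, hne⟩ := T.swap13.facet.exists_ne 1 0 0 (by simp)
    have h0 := T.nonneg h
    have hy : y ≠ 0 := by simpa using hne
    obtain rfl := (h12 h).resolve_right hy
    exact ⟨_, _, h, by omega⟩
  have key : ∀ {x1 x4 y2 y4}, S x1 0 0 x4 → 0 < x1 → S 0 y2 0 y4 → 0 < y2 →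
      c * a' * x4 * y2 = c' * b * x1 * y4 + (c * d' - c' * d) * (x1 * y2) := by
    intro x1 x4 y2 y4 hx hx1 hy hy2
    have := T.nonneg hx
    have := T.nonneg hy
    have h := T.bad hd1 hd2 hx hy (by omega) (by omega) (by omega) (by omega)
    unfold det4 det3 at h
    linear_combination -h
  have ux : ∀ {x1' x4'}, S x1' 0 0 x4' → 0 < x1' → x1' = x1 ∧ x4' = x4 := by
    intro x1' x4' hx' hx1'
    have hpar : x1' * x4 = x4' * x1 := by
      refine mul_left_cancel₀ (show c * a' * y2 ≠ 0 by positivity) ?_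
      linear_combination x1' * key hx hx1 hy hy2 - x1 * key hx' hx1' hy hy2
    have := T.core.eq_of_parallel hx' hx (by ring) (by ring) hpar (by ring) (by ring) (by ring)
    tauto
  have uy : ∀ {y2' y4'}, S 0 y2' 0 y4' → 0 < y2' → y2' = y2 ∧ y4' = y4 := by
    intro y2' y4' hy' hy2'
    have hpar : y2' * y4 = y4' * y2 := by
      refine mul_left_cancel₀ (show c' * b * x1 ≠ 0 by positivity) ?_
      linear_combination -y2' * key hx hx1 hy hy2 + y2 * key hx hx1 hy' hy2'
    have := T.core.eq_of_parallel hy' hy (by ring) (by ring) (by ring) (by ring) hpar (by ring)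
    tauto
  obtain ⟨y, x, w, h, hne⟩ := T.swap13.facet.exists_ne (y4 * x1) (x4 * y2) (-(x1 * y2))
    (Or.inr (Or.inr (neg_ne_zero.2 (by positivity))))
  have h0 := T.nonneg h
  by_cases hx0 : x = 0
  · subst hx0
    by_cases hy0 : y = 0
    · subst hy0
      exact hV _ h
    · obtain ⟨rfl, rfl⟩ := uy h (by omega)
      exact hne (by ring)
  · obtain rfl := (h12 h).resolve_left hx0
    obtain ⟨rfl, rfl⟩ := ux h (by omega)
    exact hne (by ring)

theorem height_le_one_of_two_facets (T : FullyFourColored S) (hd1 : S 0 b c d) (hb : 0 < b)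
    (hc : 0 < c) (hd : 0 < d) (hd2 : S a' 0 c' d') (ha' : 0 < a') (hc' : 0 < c') (hd' : 0 < d')
    (hy : S 0 p2 p3 p4) : p2 ≤ 1 := by
  by_contra hlt
  have hy0 := T.nonneg hy
  obtain ⟨t, ht⟩ := T.exists_vertex_of_two_facets hd1 hb hc hd hd2 ha' hc' hd'
  obtain ⟨t', ht'⟩ := T.swap34.exists_vertex_of_two_facets hd1 hb hd hc hd2 ha' hd' hc'
  have ht2 := T.swap14.two_le_vertex ht
  have ht2' := T.swap13.two_le_vertex ht'
  have one : ∀ {k1 k3 k4}, S k1 0 k3 k4 → 0 < k1 → k1 = 1 := by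
    intro k1 k3 k4 hk hk1
    have := T.nonneg hk
    by_contra hne
    have h := T.bad hk hy ht ht' (by omega) (by omega) (by omega) (by omega)
    have hp2 : 0 < p2 := by omega
    unfold det4 det3 at h
    exact absurd (show k1 * p2 * t * t' = 0 by linear_combination -h) (by positivity)
  obtain ⟨x1, x4, hx, hx1⟩ : ∃ x1 x4, S x1 0 0 x4 ∧ 0 < x1 := by
    obtain ⟨y, x, w, h, hne⟩ := T.swap13.facet.exists_ne 0 1 0 (by simp)
    have h0 := T.nonneg h
    have hx : x ≠ 0 := by simpa using hne
    obtain rfl := (T.eq_zero_of_two_facets hd1 hb hc hd hd2 ha' hc' hd' h).resolve_left hx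
    exact ⟨_, _, h, by omega⟩
  obtain rfl := one hx hx1
  obtain rfl := one hd2 ha'
  have hx4 : x4 = d' := by
    have h := T.bad hy hd2 hx ht' (by omega) (by omega) (by omega)
      (by
        have := T.nonneg hx
        by_contra h4
        obtain rfl : x4 = 0 := by omega
        have := T.two_le_vertex hx
        omega)
    unfold det4 det3 at h
    have h' : p2 * t' * (x4 - d') = 0 := by
      linear_combination h
    have := (mul_eq_zero.1 h').resolve_left (mul_ne_zero (by omega) (by omega))
    omega
  subst hx4
  have := T.anti hx hd2 le_rfl le_rfl hc'.le le_rfl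
  omega

theorem not_two_facet_interiors (T : FullyFourColored S) (hd1 : S 0 b c d) (hb : 0 < b)
    (hc : 0 < c) (hd : 0 < d) (hd2 : S a' 0 c' d') (ha' : 0 < a') (hc' : 0 < c') (hd' : 0 < d') :
    False := by
  obtain ⟨t, ht⟩ := T.exists_vertex_of_two_facets hd1 hb hc hd hd2 ha' hc' hd'
  refine T.core.not_triangle ⟨⟨0, t, ht⟩, fun x y z w h => ?_⟩
  have h0 := T.nonneg h
  rcases T.eq_zero_of_two_facets hd1 hb hc hd hd2 ha' hc' hd' h with rfl | rfl
  · have := T.height_le_one_of_two_facets hd1 hb hc hd hd2 ha' hc' hd' h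
    omega
  · have := T.swap12.height_le_one_of_two_facets hd2 ha' hc' hd' hd1 hb hc hd h
    omega

end TwoFacets

/-! ### Four colours: no point inside a single facet -/

section OneFacet

variable {d1 d2 d3 t4 g2 g3 h1 h3 u : ℤ}

/-- If the facet `x₄ = 0` has a relative interior point, points outside this facet lie on edges
through the fourth vertex. -/
theorem on_edge_of_facet_interior (T : FullyFourColored S) (hd : S d1 d2 d3 0) (hd1 : 0 < d1)
    (hd2 : 0 < d2) (hd3 : 0 < d3) (h : S p1 p2 p3 p4) (hp4 : 0 < p4) :
    (p1 = 0 ∧ p2 = 0) ∨ (p1 = 0 ∧ p3 = 0) ∨ (p2 = 0 ∧ p3 = 0) := by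
  have h0 := T.nonneg h
  by_cases h1 : p1 = 0
  · subst h1
    by_contra hne
    exact T.swap24.not_two_facet_interiors h hp4 (by omega) (by omega) hd hd1 hd3 hd2
  by_cases h2 : p2 = 0
  · subst h2
    by_contra hne
    exact T.swap14.not_two_facet_interiors hd hd2 hd3 hd1 h hp4 (by omega) (by omega)
  by_cases h3 : p3 = 0
  · subst h3
    exact (T.swap13.swap24.not_two_facet_interiors h hp4 (by omega) (by omega) hd hd3 hd1
      hd2).elim
  exact (T.no_interior h (by omega) (by omega) (by omega) hp4).elim

theorem not_three_edges_of_facet_interior (T : FullyFourColored S) (hd : S d1 d2 d3 0)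
    (hd1 : 0 < d1) (hd2 : 0 < d2) (hd3 : 0 < d3) (hp : S p1 0 0 p4) (hp1 : 0 < p1) (hp4 : 0 < p4)
    (hq : S 0 q2 0 q4) (hq2 : 0 < q2) (hq4 : 0 < q4) (hr : S 0 0 r3 r4) (hr3 : 0 < r3)
    (hr4 : 0 < r4) : False := by
  have h := T.bad hd hp hq hr (by omega) (by omega) (by omega) (by omega)
  unfold det4 det3 at h
  exact absurd (show d1 * p4 * q2 * r3 + d2 * p1 * q4 * r3 + d3 * p1 * q2 * r4 = 0 by
    linear_combination h) (by positivity)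

theorem facet_interior_height (T : FullyFourColored S) (hd : S d1 d2 d3 0) (hd1 : 0 < d1)
    (hd2 : 0 < d2) (hd3 : 0 < d3) (hs : S s1 0 0 s4) (hs1 : 0 < s1) (hs4 : 0 < s4)
    (ht : S 0 s2 0 t4) (hs2 : 0 < s2) (ht4 : 0 < t4) : d3 = 1 := by
  by_contra hne
  obtain ⟨h, -⟩ := T.minors hd hs ht (by omega) (by omega) (by omega) (by omega)
  unfold det3 at h
  exact absurd (show d3 * s1 * s2 = 0 by linear_combination h) (by positivity)

/-- The facet `x₁ = 0` has a point outside the plane of `t` and `g`. It forms a basis with `d`, `g`,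
`s` whose only possible colour is 4, so `s4 = 1` and its own fourth coordinate is 0. -/
theorem edge_height_one (T : FullyFourColored S) (hd : S d1 d2 1 0) (hd1 : 0 < d1)
    (hd2 : 0 < d2) (hs : S s1 0 0 s4) (hs1 : 0 < s1) (hs4 : 0 < s4)
    (ht : S 0 s2 0 t4) (hs2 : 0 < s2) (ht4 : 0 < t4) (hg : S 0 g2 1 0) (hg2 : 0 < g2)
    (hK : ∀ {a b c e}, S a b c e → 0 < c → c = 1 ∧ e = 0) :
    s4 = 1 ∧ (∃ y, S 0 y 0 0) ∧ ∀ u, ¬ S 0 0 0 u := by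
  have heq : t4 * s1 * g2 = s4 * s2 * d1 + t4 * s1 * d2 := by
    have h := T.bad hd hs ht hg (by omega) (by omega) (by omega) (by omega)
    unfold det4 det3 at h
    linear_combination -h
  have key : ∀ {y w}, S 0 y 0 w → t4 * y - s2 * w ≠ 0 → s4 = 1 ∧ w = 0 := by
    intro y w hy hne
    have hy0 := T.nonneg hy
    by_contra hw
    have h := T.bad hd hg hs hy (by omega) (by omega) (by omega) (by omega)
    unfold det4 det3 at h
    exact absurd (show d1 * s4 * (t4 * y - s2 * w) = 0 by
      linear_combination t4 * h + w * heq) (mul_ne_zero (by positivity) hne)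
  obtain ⟨y, z, w, h, hne⟩ := T.facet.exists_ne t4 (-(g2 * t4)) (-s2) (Or.inl ht4.ne')
  have h0 := T.nonneg h
  by_cases hz : 0 < z
  · obtain ⟨rfl, rfl⟩ := hK h hz
    have hyg : y = g2 := by
      rcases le_total y g2 with hle | hle
      · exact (T.anti h hg le_rfl hle le_rfl le_rfl).2.1
      · exact (T.anti hg h le_rfl hle le_rfl le_rfl).2.1.symm
    subst hyg
    exact absurd (by ring) hne
  · obtain rfl : z = 0 := by omega
    obtain ⟨rfl, rfl⟩ := key h (by simpa [sub_eq_add_neg] using hne)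
    refine ⟨rfl, ⟨y, h⟩, fun u hu => ?_⟩
    have hu2 := T.swap14.two_le_vertex hu
    have hu0 : 0 < s2 * u := by positivity
    have := key hu (by omega)
    omega

theorem not_two_edges_of_facet_interior (T : FullyFourColored S) (hd : S d1 d2 d3 0)
    (hd1 : 0 < d1) (hd2 : 0 < d2) (hd3 : 0 < d3) (hs : S s1 0 0 s4) (hs1 : 0 < s1) (hs4 : 0 < s4)
    (ht : S 0 s2 0 t4) (hs2 : 0 < s2) (ht4 : 0 < t4)
    (hE : ∀ c e, S 0 0 c e → 0 < c → 0 < e → False) : False := by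
  have edge : ∀ {a b c e}, S a b c e → 0 < e →
      (a = 0 ∧ b = 0) ∨ (a = 0 ∧ c = 0) ∨ (b = 0 ∧ c = 0) :=
    T.on_edge_of_facet_interior hd hd1 hd2 hd3
  have height : ∀ {d1 d2 d3}, S d1 d2 d3 0 → 0 < d1 → 0 < d2 → 0 < d3 → d3 = 1 :=
    fun hd hd1 hd2 hd3 => T.facet_interior_height hd hd1 hd2 hd3 hs hs1 hs4 ht hs2 ht4
  obtain rfl := height hd hd1 hd2 hd3
  have hK0 : ∀ {a b c e}, S a b c e → 0 < c → e = 0 := by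
    intro a b c e h hc
    have h0 := T.nonneg h
    by_contra he
    obtain ⟨rfl, rfl⟩ : a = 0 ∧ b = 0 := by
      have := edge h (by omega)
      omega
    exact hE _ _ h hc (by omega)
  have plane : ∀ {a b c}, S a b c 0 → 0 < c →
      s4 * s2 * a + t4 * s1 * b = c * (s4 * s2 * d1 + t4 * s1 * d2) := by
    intro a b c h hc
    have h0 := T.nonneg h
    have h := T.bad hd hs ht h (by omega) (by omega) (by omega) (by omega)
    unfold det4 det3 at h
    linear_combination -h
  have hV : ∀ c, S 0 0 c 0 → False := by
    intro c h
    have hc := T.swap13.two_le_vertex h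
    have h := plane h (by omega)
    exact absurd (show c * (s4 * s2 * d1 + t4 * s1 * d2) = 0 by linear_combination -h)
      (by positivity)
  obtain ⟨g2, g3, hg, hg3⟩ : ∃ b c, S 0 b c 0 ∧ 0 < c := by
    obtain ⟨b, c, e, h, hne⟩ := T.facet.exists_ne 0 1 0 (by simp)
    have h0 := T.nonneg h
    have hc : 0 < c := by
      have : c ≠ 0 := by simpa using hne
      omega
    obtain rfl := hK0 h hc
    exact ⟨_, _, h, hc⟩
  obtain ⟨h1, h3, hh, hh3⟩ : ∃ a c, S a 0 c 0 ∧ 0 < c := by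
    obtain ⟨b, c, e, h, hne⟩ := T.swap12.facet.exists_ne 0 1 0 (by simp)
    have h0 := T.nonneg h
    have hc : 0 < c := by
      have : c ≠ 0 := by simpa using hne
      omega
    obtain rfl := hK0 h hc
    exact ⟨_, _, h, hc⟩
  have one : ∀ {g2 g3 h1 h3}, S 0 g2 g3 0 → 0 < g3 → S h1 0 h3 0 → 0 < h3 →
      0 < g2 ∧ 0 < h1 ∧ g3 = 1 ∧ h3 = 1 := by
    intro g2 g3 h1 h3 hg hg3 hh hh3
    have hg2 : 0 < g2 := by
      rcases (T.nonneg hg).2.1.eq_or_lt with rfl | h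
      · exact (hV _ hg).elim
      · exact h
    have hh1 : 0 < h1 := by
      rcases (T.nonneg hh).1.eq_or_lt with rfl | h
      · exact (hV _ hh).elim
      · exact h
    have eg := plane hg hg3
    have eh := plane hh hh3
    have ez : g2 * h1 * 1 = d2 * h1 * g3 + d1 * g2 * h3 := by
      refine mul_left_cancel₀ (show s4 * s2 * (t4 * s1) ≠ 0 by positivity) ?_
      linear_combination s4 * s2 * h1 * eg + g3 * (s4 * s2 * d1 + t4 * s1 * d2) * eh
        - d2 * g3 * t4 * s1 * eh - d1 * h3 * s4 * s2 * eg
    -- Here `d` is a positive combination of `g` and `h`. Comparing the sum of its weights with its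
    -- third coordinate forces `g3 = h3 = 1`.
    have ec := T.core.comb hd hg hh (g2 * h1) (d2 * h1) (d1 * g2) (by ring) (by ring) ez (by ring)
    have e0 : d2 * h1 * (g3 - 1) + d1 * g2 * (h3 - 1) = 0 := by linear_combination ec - ez
    have n1 : 0 ≤ d2 * h1 * (g3 - 1) := mul_nonneg (by positivity) (by omega)
    have n2 : 0 ≤ d1 * g2 * (h3 - 1) := mul_nonneg (by positivity) (by omega)
    have z1 := (mul_eq_zero.1 (show d2 * h1 * (g3 - 1) = 0 by omega)).resolve_left (by positivity)
    have z2 := (mul_eq_zero.1 (show d1 * g2 * (h3 - 1) = 0 by omega)).resolve_left (by positivity)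
    exact ⟨hg2, hh1, by omega, by omega⟩
  have hK : ∀ {a b c e}, S a b c e → 0 < c → c = 1 ∧ e = 0 := by
    intro a b c e h hc
    have h0 := T.nonneg h
    obtain rfl := hK0 h hc
    refine ⟨?_, rfl⟩
    by_cases ha : a = 0
    · subst ha
      exact (one h hc hh hh3).2.2.1
    by_cases hb : b = 0
    · subst hb
      exact (one hg hg3 h hc).2.2.2
    exact height h (by omega) (by omega) hc
  obtain ⟨hg2, hh1, rfl, rfl⟩ := one hg hg3 hh hh3
  obtain ⟨-, ⟨y, hy⟩, hV4⟩ := T.edge_height_one hd hd1 hd2 hs hs1 hs4 ht hs2 ht4 hg hg2 hK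
  refine T.swap13.swap24.core.not_triangle ⟨⟨0, y, hy⟩, fun c e a b h => ?_⟩
  have h0 := T.nonneg h
  by_cases hc : 0 < c
  · have := hK h hc
    omega
  obtain rfl : c = 0 := by omega
  by_cases he : 0 < e
  · have hab : (a = 0 ∧ b ≠ 0) ∨ (a ≠ 0 ∧ b = 0) := by
      have := edge h he
      by_contra hne
      obtain ⟨rfl, rfl⟩ : a = 0 ∧ b = 0 := by omega
      exact hV4 _ h
    rcases hab with ⟨rfl, hb⟩ | ⟨ha, rfl⟩
    · have := (T.swap12.edge_height_one hd hd2 hd1 h (by omega) he hs hs1 hs4 hh hh1 hK).1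
      omega
    · have := (T.edge_height_one hd hd1 hd2 h (by omega) he ht hs2 ht4 hg hg2 hK).1
      omega
  · omega

end OneFacet

end FullyFourColored

namespace FullyFourColored

variable {S : ℤ → ℤ → ℤ → ℤ → Prop}

section OneEdge

variable {d1 d2 d3 u s1 v2 g2 g3 : ℤ}

/-- Bases through vertex 4 and the edge point `s` force `d = (1,1,1,0)`. With vertices 2 and 4 this
is a flat border in the coordinates 1 and 3. -/
theorem not_edge_and_vertex (T : FullyFourColored S) (hd : S d1 d2 d3 0) (hd1 : 0 < d1)
    (hd2 : 0 < d2) (hd3 : 0 < d3)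
    (hK : ∀ {a b c e}, S a b c e → 0 < e → b = 0 ∧ c = 0)
    (hu : S 0 0 0 u) (hs : S s1 0 0 1) (hs1 : 0 < s1) (hg : S 0 g2 g3 0) (hg2 : 0 < g2)
    (hg3 : 0 < g3) (hv : S 0 v2 0 0) : False := by
  have hu2 := T.swap14.two_le_vertex hu
  have hv2 := T.swap12.two_le_vertex hv
  have third : ∀ {d1 d2 d3}, S d1 d2 d3 0 → 0 < d1 → 0 < d2 → 0 < d3 → d3 = 1 := by
    intro d1 d2 d3 hd hd1 hd2 hd3
    by_contra hne
    have h := T.bad hu hs hd hv (by omega) (by omega) (by omega) (by omega)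
    unfold det4 det3 at h
    exact absurd (show u * s1 * d3 * v2 = 0 by linear_combination h) (by positivity)
  have ratio : ∀ {d1 d2}, S d1 d2 1 0 → 0 < d1 → 0 < d2 → g2 = g3 * d2 := by
    intro d1 d2 hd hd1 hd2
    have h := T.bad hu hs hd hg (by omega) (by omega) (by omega) (by omega)
    unfold det4 det3 at h
    have h' : u * s1 * (g2 - g3 * d2) = 0 := by
      linear_combination h
    have := (mul_eq_zero.1 h').resolve_left (by positivity)
    omega
  obtain rfl := third hd hd1 hd2 hd3
  obtain rfl := ratio hd hd1 hd2
  have hg32 : 2 ≤ g3 := by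
    by_contra hlt
    obtain rfl : g3 = 1 := by omega
    have := T.anti hg hd hd1.le (by omega) le_rfl le_rfl
    omega
  have hg22 : 2 ≤ g3 * d2 := by nlinarith
  have hs1' : s1 = 1 := by
    by_contra hne
    have h := T.bad hu hs hg hv (by omega) (by omega) (by omega) (by omega)
    unfold det4 det3 at h
    exact absurd (show u * s1 * g3 * v2 = 0 by linear_combination h) (by positivity)
  subst hs1'
  obtain ⟨h1, h3, hh, hh3⟩ : ∃ a c, S a 0 c 0 ∧ 0 < c := by
    obtain ⟨b, c, e, h, hne⟩ := T.swap12.facet.exists_ne 0 1 0 (by simp)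
    have h0 := T.nonneg h
    have hc : c ≠ 0 := by simpa using hne
    have he : e = 0 := by
      by_contra he
      exact hc (hK h (by omega)).2
    subst he
    exact ⟨_, _, h, by omega⟩
  have off : ∀ {h1 h3}, S h1 0 h3 0 → 0 < h3 → h1 = 0 := by
    intro h1 h3 hh hh3
    have hh0 := T.nonneg hh
    by_contra hne
    have h := T.bad hu hs hg hh (by omega) (by omega) (by omega) (by omega)
    unfold det4 det3 at h
    exact absurd (show u * 1 * (g3 * d2) * h3 = 0 by linear_combination -h) (by positivity)
  have second : ∀ {d1 d2}, S d1 d2 1 0 → 0 < d1 → 0 < d2 → d2 = 1 := by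
    intro d1 d2 hd hd1 hd2
    have hh0 := T.nonneg hh
    by_contra hne
    have h := T.bad hu hs hd hh (by omega) (by omega) (by omega) (by omega)
    unfold det4 det3 at h
    exact absurd (show u * 1 * d2 * h3 = 0 by linear_combination -h) (by positivity)
  obtain rfl := off hh hh3
  have first : ∀ {d1}, S d1 1 1 0 → 0 < d1 → d1 = 1 := by
    intro d1 hd hd1
    by_contra hne
    have h := T.bad hu hv hh hd (by omega) (by omega) (by omega) (by omega)
    unfold det4 det3 at h
    exact absurd (show u * v2 * h3 * d1 = 0 by linear_combination -h) (by positivity)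
  obtain rfl := second hd hd1 hd2
  obtain rfl := first hd hd1
  refine T.swap23.core.not_flat ⟨v2, 0, 0, u, 1, 0, hv, hu, by omega, hd, fun a c b e h ha hc => ?_⟩
  have h0 := T.nonneg h
  have he : e = 0 := by
    by_contra he
    have := hK h (by omega)
    omega
  subst he
  have hb : b ≠ 0 := by
    rintro rfl
    have := off h hc
    omega
  obtain rfl := third h ha (by omega) hc
  obtain rfl := second h ha (by omega)
  obtain rfl := first h ha
  simp

theorem not_edge_of_facet_interior (T : FullyFourColored S) (hd : S d1 d2 d3 0) (hd1 : 0 < d1)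
    (hd2 : 0 < d2) (hd3 : 0 < d3)
    (hK : ∀ {a b c e}, S a b c e → 0 < e → b = 0 ∧ c = 0) : False := by
  obtain ⟨u, hu⟩ : ∃ u, S 0 0 0 u := by
    obtain ⟨b, c, e, h, hne⟩ := T.facet.exists_ne 0 0 1 (by simp)
    have h0 := T.nonneg h
    have he : e ≠ 0 := by simpa using hne
    obtain ⟨rfl, rfl⟩ := hK h (by omega)
    exact ⟨_, h⟩
  have hu2 := T.swap14.two_le_vertex hu
  obtain ⟨s1, hs, hs1⟩ : ∃ s, S s 0 0 1 ∧ 0 < s := by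
    obtain ⟨b, c, a, h⟩ := T.swap14.facet_apex.2
    obtain ⟨rfl, rfl⟩ := hK h one_pos
    have h0 := T.nonneg h
    refine ⟨_, h, ?_⟩
    by_contra hlt
    obtain rfl : a = 0 := by omega
    have := T.swap14.two_le_vertex h
    omega
  by_cases hE : ∃ g2 g3, S 0 g2 g3 0 ∧ 0 < g2 ∧ 0 < g3
  · obtain ⟨g2, g3, hg, hg2, hg3⟩ := hE
    -- The functional vanishes on `u`, `s` and `d`, so the point found completes them to a basis.
    obtain ⟨b, c, e, h, hne⟩ := T.facet.exists_ne d3 (-d2) 0 (Or.inl hd3.ne')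
    have h0 := T.nonneg h
    have he : e = 0 := by
      by_contra he
      obtain ⟨rfl, rfl⟩ := hK h (by omega)
      simp at hne
    subst he
    by_cases hb : b = 0
    · subst hb
      exact T.swap23.not_edge_and_vertex hd hd1 hd3 hd2 (fun h he => (hK h he).symm) hu hs hs1 hg
        hg3 hg2 h
    by_cases hc : c = 0
    · subst hc
      exact T.not_edge_and_vertex hd hd1 hd2 hd3 hK hu hs hs1 hg hg2 hg3 h
    have hdet := T.bad hu hs hd h (by omega) (by omega) (by omega) (by omega)
    unfold det4 det3 at hdet
    refine absurd (show u * s1 * (d3 * b + -d2 * c + 0 * 0) = 0 from ?_)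
      (mul_ne_zero (by positivity) hne)
    linear_combination hdet
  · obtain ⟨v2, hv⟩ : ∃ v, S 0 v 0 0 := by
      obtain ⟨b, c, e, h, hb⟩ := T.exists_facet_diff
      have h0 := T.nonneg h
      have he : e = 0 := by
        by_contra he
        have := hK h (by omega)
        omega
      subst he
      have hc : c = 0 := by
        by_contra hc
        exact hE ⟨_, _, h, hb, by omega⟩
      subst hc
      exact ⟨_, h⟩
    obtain ⟨v3, hv'⟩ : ∃ v, S 0 0 v 0 := by
      obtain ⟨c, b, e, h, hc⟩ := T.swap23.exists_facet_diff
      have h0 := T.nonneg h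
      have he : e = 0 := by
        by_contra he
        have := hK h (by omega)
        omega
      subst he
      have hb : b = 0 := by
        by_contra hb
        exact hE ⟨_, _, h, by omega, hc⟩
      subst hb
      exact ⟨_, h⟩
    have hv2 := T.swap12.two_le_vertex hv
    have hv3 := T.swap13.two_le_vertex hv'
    have first : ∀ {a b c e}, S a b c e → 0 < a → a = 1 := by
      intro a b c e h ha
      have h0 := T.nonneg h
      by_contra hne
      have hdet := T.bad hu hv hv' h (by omega) (by omega) (by omega) (by omega)
      unfold det4 det3 at hdet
      refine absurd (show u * v2 * v3 * a = 0 from ?_) (by positivity)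
      linear_combination -hdet
    have third : ∀ {d1 d2 d3}, S d1 d2 d3 0 → 0 < d1 → 0 < d2 → 0 < d3 → d3 = 1 := by
      intro d1 d2 d3 hd hd1 hd2 hd3
      by_contra hne
      have h := T.bad hu hs hd hv (by omega) (by omega) (by omega) (by omega)
      unfold det4 det3 at h
      exact absurd (show u * s1 * d3 * v2 = 0 by linear_combination h) (by positivity)
    have second : ∀ {d1 d2 d3}, S d1 d2 d3 0 → 0 < d1 → 0 < d2 → 0 < d3 → d2 = 1 := by
      intro d1 d2 d3 hd hd1 hd2 hd3
      by_contra hne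
      have h := T.bad hu hs hd hv' (by omega) (by omega) (by omega) (by omega)
      unfold det4 det3 at h
      exact absurd (show u * s1 * d2 * v3 = 0 by linear_combination -h) (by positivity)
    have unit : ∀ {d1 d2 d3}, S d1 d2 d3 0 → 0 < d1 → 0 < d2 → 0 < d3 →
        d1 = 1 ∧ d2 = 1 ∧ d3 = 1 := fun h h1 h2 h3 =>
      ⟨first h h1, second h h1 h2 h3, third h h1 h2 h3⟩
    have hpos : ∀ {a b c e}, S a b c e → 0 < b ∨ 0 < c → e = 0 := by
      intro a b c e h hbc
      have h0 := T.nonneg h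
      by_contra he
      have := hK h (by omega)
      omega
    obtain ⟨rfl, rfl, rfl⟩ := unit hd hd1 hd2 hd3
    -- Without such a point, `(1,1,1,0)` and vertices 2 and 4 would give a flat border.
    obtain ⟨h3, hh, hh3⟩ : ∃ c, S 1 0 c 0 ∧ 0 < c := by
      by_contra! hno
      refine T.swap23.core.not_flat ⟨v2, 0, 0, u, 1, 0, hv, hu, by omega, hd,
        fun a c b e h ha hc => ?_⟩
      have h0 := T.nonneg h
      obtain rfl := hpos h (Or.inr hc)
      by_cases hb : b = 0
      · subst hb
        obtain rfl := first h ha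
        have := hno _ h
        omega
      · obtain ⟨rfl, rfl, rfl⟩ := unit h ha (by omega) hc
        simp
    obtain ⟨k2, hk, hk2⟩ : ∃ b, S 1 b 0 0 ∧ 0 < b := by
      by_contra! hno
      refine T.core.not_flat ⟨v3, 0, 0, u, 1, 0, hv', hu, by omega, hd,
        fun a b c e h ha hb => ?_⟩
      have h0 := T.nonneg h
      obtain rfl := hpos h (Or.inl hb)
      by_cases hc : c = 0
      · subst hc
        obtain rfl := first h ha
        have := hno _ h
        omega
      · obtain ⟨rfl, rfl, rfl⟩ := unit h ha hb (by omega)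
        simp
    have hone : k2 = 1 ∨ h3 = 1 := by
      by_contra! hne
      have h := T.bad hu hs hh hk (by omega) (by omega) (by omega) (by omega)
      unfold det4 det3 at h
      exact absurd (show u * s1 * h3 * k2 = 0 by linear_combination h) (by positivity)
    have h := T.bad hu hh hk hd (by omega) (by omega) (by omega) (by omega)
    unfold det4 det3 at h
    have h' : u * (k2 + h3 - h3 * k2) = 0 := by
      linear_combination -h
    have h'' := (mul_eq_zero.1 h').resolve_left (by positivity)
    rcases hone with rfl | rfl <;> omega

end OneEdge

/-- No point lies in the relative interior of the facet `x₄ = 0`. -/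
theorem no_facet_interior (T : FullyFourColored S) {d1 d2 d3 : ℤ} (hd : S d1 d2 d3 0)
    (hd1 : 0 < d1) (hd2 : 0 < d2) (hd3 : 0 < d3) : False := by
  have edge : ∀ {a b c e}, S a b c e → 0 < e →
      (a = 0 ∧ b = 0) ∨ (a = 0 ∧ c = 0) ∨ (b = 0 ∧ c = 0) :=
    T.on_edge_of_facet_interior hd hd1 hd2 hd3
  by_cases h1 : ∃ s e, S s 0 0 e ∧ 0 < s ∧ 0 < e <;>
  by_cases h2 : ∃ s e, S 0 s 0 e ∧ 0 < s ∧ 0 < e <;>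
  by_cases h3 : ∃ s e, S 0 0 s e ∧ 0 < s ∧ 0 < e
  · obtain ⟨_, _, hp, hp1, hp4⟩ := h1
    obtain ⟨_, _, hq, hq1, hq4⟩ := h2
    obtain ⟨_, _, hr, hr1, hr4⟩ := h3
    exact T.not_three_edges_of_facet_interior hd hd1 hd2 hd3 hp hp1 hp4 hq hq1 hq4 hr hr1 hr4
  · obtain ⟨_, _, hp, hp1, hp4⟩ := h1
    obtain ⟨_, _, hq, hq1, hq4⟩ := h2
    exact T.not_two_edges_of_facet_interior hd hd1 hd2 hd3 hp hp1 hp4 hq hq1 hq4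
      fun c e h hc he => h3 ⟨c, e, h, hc, he⟩
  · obtain ⟨_, _, hp, hp1, hp4⟩ := h1
    obtain ⟨_, _, hr, hr1, hr4⟩ := h3
    exact T.swap23.not_two_edges_of_facet_interior hd hd1 hd3 hd2 hp hp1 hp4 hr hr1 hr4
      fun c e h hc he => h2 ⟨c, e, h, hc, he⟩
  · refine T.not_edge_of_facet_interior hd hd1 hd2 hd3 fun {a b c e} h he => ?_
    have h0 := T.nonneg h
    have hcase := edge h he
    by_contra hne
    rcases (by omega : (a = 0 ∧ b = 0 ∧ 0 < c) ∨ (a = 0 ∧ c = 0 ∧ 0 < b)) with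
      ⟨rfl, rfl, hc⟩ | ⟨rfl, rfl, hb⟩
    · exact h3 ⟨_, _, h, hc, he⟩
    · exact h2 ⟨_, _, h, hb, he⟩
  · obtain ⟨_, _, hq, hq1, hq4⟩ := h2
    obtain ⟨_, _, hr, hr1, hr4⟩ := h3
    exact T.swap13.not_two_edges_of_facet_interior hd hd3 hd2 hd1 hr hr1 hr4 hq hq1 hq4
      fun c e h hc he => h1 ⟨c, e, h, hc, he⟩
  · refine T.swap12.not_edge_of_facet_interior hd hd2 hd1 hd3 fun {b a c e} h he => ?_
    have h0 := T.nonneg h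
    have hcase := edge h he
    by_contra hne
    rcases (by omega : (a = 0 ∧ b = 0 ∧ 0 < c) ∨ (b = 0 ∧ c = 0 ∧ 0 < a)) with
      ⟨rfl, rfl, hc⟩ | ⟨rfl, rfl, hb⟩
    · exact h3 ⟨_, _, h, hc, he⟩
    · exact h1 ⟨_, _, h, hb, he⟩
  · refine T.swap13.not_edge_of_facet_interior hd hd3 hd2 hd1 fun {c b a e} h he => ?_
    have h0 := T.nonneg h
    have hcase := edge h he
    by_contra hne
    rcases (by omega : (a = 0 ∧ c = 0 ∧ 0 < b) ∨ (b = 0 ∧ c = 0 ∧ 0 < a)) with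
      ⟨rfl, rfl, hc⟩ | ⟨rfl, rfl, hb⟩
    · exact h2 ⟨_, _, h, hc, he⟩
    · exact h1 ⟨_, _, h, hb, he⟩
  · refine T.not_edge_of_facet_interior hd hd1 hd2 hd3 fun {a b c e} h he => ?_
    have h0 := T.nonneg h
    have hcase := edge h he
    by_contra hne
    rcases (by omega : (a = 0 ∧ b = 0 ∧ 0 < c) ∨ (a = 0 ∧ c = 0 ∧ 0 < b)) with
      ⟨rfl, rfl, hc⟩ | ⟨rfl, rfl, hb⟩
    · exact h3 ⟨_, _, h, hc, he⟩
    · exact h2 ⟨_, _, h, hb, he⟩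

end FullyFourColored

/-! ### Four colours: points on the edges and vertices of the tetrahedron -/

namespace FullyFourColored

variable {S : ℤ → ℤ → ℤ → ℤ → Prop}
  {p1 p2 p3 p4 q1 q2 q3 q4 r1 r2 r3 r4 s1 s2 s3 s4 t1 t2 t3 t4 a b c d u v : ℤ}

theorem two_zeros (T : FullyFourColored S) (h : S a b c d) :
    (a = 0 ∧ b = 0) ∨ (a = 0 ∧ c = 0) ∨ (a = 0 ∧ d = 0) ∨ (b = 0 ∧ c = 0) ∨ (b = 0 ∧ d = 0) ∨
      (c = 0 ∧ d = 0) := by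
  have h0 := T.nonneg h
  by_contra hne
  by_cases ha : a = 0
  · subst ha
    exact T.swap14.no_facet_interior h (by omega) (by omega) (by omega)
  by_cases hb : b = 0
  · subst hb
    exact T.swap24.no_facet_interior h (by omega) (by omega) (by omega)
  by_cases hc : c = 0
  · subst hc
    exact T.swap34.no_facet_interior h (by omega) (by omega) (by omega)
  by_cases hd : d = 0
  · subst hd
    exact T.no_facet_interior h (by omega) (by omega) (by omega)
  exact T.no_interior h (by omega) (by omega) (by omega) (by omega)

section Triangle

/-- Points on the edges 12, 13, 23 are independent and reach sum 2 in the first three colours, so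
only colour 4 is left. -/
theorem height_of_triangle (T : FullyFourColored S) (hp : S p1 p2 0 0) (hp1 : 0 < p1)
    (hp2 : 0 < p2) (hq : S q1 0 q3 0) (hq1 : 0 < q1) (hq3 : 0 < q3) (hr : S 0 r2 r3 0)
    (hr2 : 0 < r2) (hr3 : 0 < r3) (h : S a b c d) : d ≤ 1 := by
  have h0 := T.nonneg h
  by_contra hlt
  have hd : 0 < d := by omega
  have h := T.bad hp hq hr h (by omega) (by omega) (by omega) (by omega)
  unfold det4 det3 at h
  exact absurd (show d * (p1 * q3 * r2 + p2 * q1 * r3) = 0 by linear_combination -h)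
    (by positivity)

theorem not_triangle_and_two_edges (T : FullyFourColored S) (hp : S p1 p2 0 0) (hp1 : 0 < p1)
    (hp2 : 0 < p2) (hq : S q1 0 q3 0) (hq1 : 0 < q1) (hq3 : 0 < q3) (hr : S 0 r2 r3 0)
    (hr2 : 0 < r2) (hr3 : 0 < r3) (hs : S s1 0 0 s4) (hs1 : 0 < s1) (hs4 : 0 < s4)
    (ht : S 0 t2 0 t4) (ht2 : 0 < t2) (ht4 : 0 < t4)
    (hE : ∀ c d, S 0 0 c d → 0 < c → 0 < d → False) : False := by
  refine T.swap13.swap24.core.not_triangle ⟨⟨p1, p2, hp⟩, fun c d a b h => ?_⟩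
  have h0 := T.nonneg h
  have hd := T.height_of_triangle hp hp1 hp2 hq hq1 hq3 hr hr2 hr3 h
  have hc := T.swap34.height_of_triangle hp hp1 hp2 hs hs1 hs4 ht ht2 ht4 h
  have hcd : ¬ (0 < c ∧ 0 < d) := by
    rintro ⟨hc0, hd0⟩
    obtain ⟨rfl, rfl⟩ : a = 0 ∧ b = 0 := by
      have := T.two_zeros h
      omega
    exact hE _ _ h hc0 hd0
  omega

theorem not_complete (T : FullyFourColored S) (hp : S p1 p2 0 0) (hp1 : 0 < p1)
    (hp2 : 0 < p2) (hq : S q1 0 q3 0) (hq1 : 0 < q1) (hq3 : 0 < q3) (hr : S 0 r2 r3 0)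
    (hr2 : 0 < r2) (hr3 : 0 < r3) (hs : S s1 0 0 s4) (hs1 : 0 < s1) (hs4 : 0 < s4)
    (ht : S 0 t2 0 t4) (ht2 : 0 < t2) (ht4 : 0 < t4) (hu : S 0 0 u v) (hu0 : 0 < u)
    (hv0 : 0 < v) : False := by
  have le4 : ∀ {a b c d}, S a b c d → d ≤ 1 := fun h =>
    T.height_of_triangle hp hp1 hp2 hq hq1 hq3 hr hr2 hr3 h
  have le3 : ∀ {a b c d}, S a b c d → c ≤ 1 := fun h =>
    T.swap34.height_of_triangle hp hp1 hp2 hs hs1 hs4 ht ht2 ht4 h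
  have le2 : ∀ {a b c d}, S a b c d → b ≤ 1 := fun h =>
    T.swap24.height_of_triangle hs hs1 hs4 hq hq1 hq3 hu hv0 hu0 h
  have le1 : ∀ {a b c d}, S a b c d → a ≤ 1 := fun h =>
    T.swap14.height_of_triangle ht ht4 ht2 hu hv0 hu0 hr hr2 hr3 h
  obtain ⟨rfl, rfl⟩ : p1 = 1 ∧ p2 = 1 := by
    have := le1 hp
    have := le2 hp
    omega
  obtain ⟨rfl, rfl⟩ : q1 = 1 ∧ q3 = 1 := by
    have := le1 hq
    have := le3 hq
    omega
  obtain ⟨rfl, rfl⟩ : r2 = 1 ∧ r3 = 1 := by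
    have := le2 hr
    have := le3 hr
    omega
  obtain ⟨rfl, rfl⟩ : s1 = 1 ∧ s4 = 1 := by
    have := le1 hs
    have := le4 hs
    omega
  obtain ⟨rfl, rfl⟩ : t2 = 1 ∧ t4 = 1 := by
    have := le2 ht
    have := le4 ht
    omega
  obtain ⟨rfl, rfl⟩ : u = 1 ∧ v = 1 := by
    have := le3 hu
    have := le4 hu
    omega
  refine T.core.not_cross ⟨hp, hq, hs, hr, ht, hu, fun a b c d h => ?_⟩
  have h0 := T.nonneg h
  have h1 := le1 h
  have h2 := le2 h
  have h3 := le3 h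
  have h4 := le4 h
  refine ⟨h1, h2, h3, h4, ?_⟩
  have hz := T.two_zeros h
  by_contra hne
  rcases (by omega : (b = 0 ∧ c = 0 ∧ d = 0) ∨ (a = 0 ∧ c = 0 ∧ d = 0) ∨ (a = 0 ∧ b = 0 ∧ d = 0) ∨
    (a = 0 ∧ b = 0 ∧ c = 0)) with ⟨rfl, rfl, rfl⟩ | ⟨rfl, rfl, rfl⟩ | ⟨rfl, rfl, rfl⟩ |
    ⟨rfl, rfl, rfl⟩
  · have := T.two_le_vertex h
    omega
  · have := T.swap12.two_le_vertex h
    omega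
  · have := T.swap13.two_le_vertex h
    omega
  · have := T.swap14.two_le_vertex h
    omega

/-- Vertex 4 is absent, having height at least 2, yet each other facet has a point with `x₄ > 0`. So
at least two of the edges 14, 24, 34 carry points: two give a triangle projection, three the
cross-polytope. -/
theorem not_triangle (T : FullyFourColored S) (hp : S p1 p2 0 0) (hp1 : 0 < p1)
    (hp2 : 0 < p2) (hq : S q1 0 q3 0) (hq1 : 0 < q1) (hq3 : 0 < q3) (hr : S 0 r2 r3 0)
    (hr2 : 0 < r2) (hr3 : 0 < r3) : False := by
  have le4 : ∀ {a b c d}, S a b c d → d ≤ 1 := fun h =>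
    T.height_of_triangle hp hp1 hp2 hq hq1 hq3 hr hr2 hr3 h
  have hV : ∀ {d}, ¬ S 0 0 0 d := by
    intro d h
    have := T.swap14.two_le_vertex h
    have := le4 h
    omega
  have h1 : (∃ b d, S 0 b 0 d ∧ 0 < b ∧ 0 < d) ∨ ∃ c d, S 0 0 c d ∧ 0 < c ∧ 0 < d := by
    obtain ⟨d, c, b, h, hd⟩ := T.swap24.exists_facet_diff
    have h0 := T.nonneg h
    have hz := T.two_zeros h
    by_cases hb : b = 0
    · subst hb
      by_cases hc : c = 0
      · subst hc
        exact (hV h).elim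
      · exact Or.inr ⟨_, _, h, by omega, hd⟩
    · obtain rfl : c = 0 := by omega
      exact Or.inl ⟨_, _, h, by omega, hd⟩
  have h2 : (∃ a d, S a 0 0 d ∧ 0 < a ∧ 0 < d) ∨ ∃ c d, S 0 0 c d ∧ 0 < c ∧ 0 < d := by
    obtain ⟨d, c, a, h, hd⟩ := T.swap12.swap24.exists_facet_diff
    have h0 := T.nonneg h
    have hz := T.two_zeros h
    by_cases ha : a = 0
    · subst ha
      by_cases hc : c = 0
      · subst hc
        exact (hV h).elim
      · exact Or.inr ⟨_, _, h, by omega, hd⟩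
    · obtain rfl : c = 0 := by omega
      exact Or.inl ⟨_, _, h, by omega, hd⟩
  have h3 : (∃ a d, S a 0 0 d ∧ 0 < a ∧ 0 < d) ∨ ∃ b d, S 0 b 0 d ∧ 0 < b ∧ 0 < d := by
    obtain ⟨d, a, b, h, hd⟩ := T.swap13.swap24.exists_facet_diff
    have h0 := T.nonneg h
    have hz := T.two_zeros h
    by_cases ha : a = 0
    · subst ha
      by_cases hb : b = 0
      · subst hb
        exact (hV h).elim
      · exact Or.inr ⟨_, _, h, by omega, hd⟩
    · obtain rfl : b = 0 := by omega
      exact Or.inl ⟨_, _, h, by omega, hd⟩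
  by_cases hE1 : ∃ a d, S a 0 0 d ∧ 0 < a ∧ 0 < d
  · obtain ⟨s1, s4, hs, hs1, hs4⟩ := hE1
    by_cases hE2 : ∃ b d, S 0 b 0 d ∧ 0 < b ∧ 0 < d
    · obtain ⟨t2, t4, ht, ht2, ht4⟩ := hE2
      by_cases hE3 : ∃ c d, S 0 0 c d ∧ 0 < c ∧ 0 < d
      · obtain ⟨u, v, hu, hu0, hv0⟩ := hE3
        exact T.not_complete hp hp1 hp2 hq hq1 hq3 hr hr2 hr3 hs hs1 hs4 ht ht2 ht4 hu hu0 hv0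
      · exact T.not_triangle_and_two_edges hp hp1 hp2 hq hq1 hq3 hr hr2 hr3 hs hs1 hs4 ht ht2 ht4
          fun c d h hc hd => hE3 ⟨c, d, h, hc, hd⟩
    · obtain ⟨u, v, hu, hu0, hv0⟩ := h1.resolve_left hE2
      exact T.swap23.not_triangle_and_two_edges hq hq1 hq3 hp hp1 hp2 hr hr3 hr2 hs hs1 hs4
        hu hu0 hv0 fun c d h hc hd => hE2 ⟨c, d, h, hc, hd⟩
  · obtain ⟨u, v, hu, hu0, hv0⟩ := h2.resolve_left hE1
    obtain ⟨t2, t4, ht, ht2, ht4⟩ := h3.resolve_left hE1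
    exact T.swap13.not_triangle_and_two_edges hr hr3 hr2 hq hq3 hq1 hp hp2 hp1 hu hu0 hv0
        ht ht2 ht4 fun c d h hc hd => hE1 ⟨c, d, h, hc, hd⟩

end Triangle

/-- A point `(1,1,0,0)` and two points of the opposite edge form a flat border, once `h1` makes the
former the only point inside its edge. -/
theorem edge_not_flat (T : FullyFourColored S) (hp : S 1 1 0 0) (hr : S 0 0 r3 r4)
    (hs : S 0 0 s3 s4) (hne : ¬ (r3 = s3 ∧ r4 = s4))
    (h1 : ∀ {a b}, S a b 0 0 → 0 < a → 0 < b → a = 1) : False := by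
  refine T.core.not_flat ⟨r3, r4, s3, s4, 0, 0, hr, hs, hne, hp, fun a b c d h ha hb => ?_⟩
  obtain ⟨rfl, rfl⟩ : c = 0 ∧ d = 0 := by
    have := T.two_zeros h
    omega
  obtain rfl := h1 h ha hb
  refine ⟨rfl, ?_, rfl, rfl⟩
  rcases le_total b 1 with hle | hle
  · exact (T.anti h hp le_rfl hle le_rfl le_rfl).2.1
  · exact (T.anti hp h le_rfl hle le_rfl le_rfl).2.1.symm

/-- There cannot be three vertices together with points on two edges through the fourth one. -/
theorem not_wedge (T : FullyFourColored S) (hp : S p1 p2 0 0) (hp1 : 0 < p1) (hp2 : 0 < p2)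
    (hq : S q1 0 q3 0) (hq1 : 0 < q1) (hq3 : 0 < q3) (h2 : S 0 t2 0 0) (h3 : S 0 0 t3 0)
    (h4 : S 0 0 0 t4) : False := by
  have g2 := T.swap12.two_le_vertex h2
  have g3 := T.swap13.two_le_vertex h3
  have g4 := T.swap14.two_le_vertex h4
  have one : ∀ {a b c d}, S a b c d → 0 < a → a = 1 := by
    intro a b c d h ha
    have h0 := T.nonneg h
    by_contra hne
    have h := T.bad h h2 h3 h4 (by omega) (by omega) (by omega) (by omega)
    unfold det4 det3 at h
    exact absurd (show a * t2 * t3 * t4 = 0 by linear_combination h) (by positivity)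
  obtain rfl := one hp hp1
  obtain rfl := one hq hq1
  have hp2' : p2 ≠ 1 := by
    rintro rfl
    exact T.edge_not_flat hp h3 h4 (by omega) fun h ha _ => one h ha
  have hq3' : q3 ≠ 1 := by
    rintro rfl
    exact T.swap23.edge_not_flat hq h2 h4 (by omega) fun h ha _ => one h ha
  have h := T.bad hp hq h2 h4 (by omega) (by omega) (by omega) (by omega)
  unfold det4 det3 at h
  exact absurd (show q3 * t2 * t4 = 0 by linear_combination -h) (by positivity)

/-- There cannot be points on three consecutive edges and at both ends of this path. -/
theorem not_path (T : FullyFourColored S) (hp : S p1 p2 0 0) (hp1 : 0 < p1) (hp2 : 0 < p2)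
    (hq : S 0 q2 q3 0) (hq2 : 0 < q2) (hq3 : 0 < q3) (hr : S 0 0 r3 r4) (hr3 : 0 < r3)
    (hr4 : 0 < r4) (h1 : S t1 0 0 0) (h4 : S 0 0 0 t4) : False := by
  have g1 := T.two_le_vertex h1
  have g4 := T.swap14.two_le_vertex h4
  have one4 : ∀ {c d}, S 0 0 c d → 0 < c → 0 < d → d = 1 := by
    intro c d hr hr3 hr4
    by_contra hne
    have h := T.bad h1 hp hq hr (by omega) (by omega) (by omega) (by omega)
    unfold det4 det3 at h
    exact absurd (show t1 * p2 * q3 * d = 0 by linear_combination h) (by positivity)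
  have one1 : ∀ {a b}, S a b 0 0 → 0 < a → 0 < b → a = 1 := by
    intro a b hp hp1 hp2
    by_contra hne
    have h := T.bad h4 hr hq hp (by omega) (by omega) (by omega) (by omega)
    unfold det4 det3 at h
    exact absurd (show a * q2 * r3 * t4 = 0 by linear_combination h) (by positivity)
  obtain rfl := one4 hr hr3 hr4
  obtain rfl := one1 hp hp1 hp2
  have hp2' : p2 ≠ 1 := by
    rintro rfl
    exact T.edge_not_flat hp h4 hr (by omega) one1
  have hr3' : r3 ≠ 1 := by
    rintro rfl
    exact T.swap14.swap23.edge_not_flat hr h1 hp (by omega) fun h ha hb => one4 h hb ha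
  have h := T.bad h1 hp hr h4 (by omega) (by omega) (by omega) (by omega)
  unfold det4 det3 at h
  exact absurd (show t1 * p2 * r3 * t4 = 0 by linear_combination h) (by positivity)

section Cycle

/-- Vertex 1 forces the coordinates 2 and 4 to be at most 1; they are never both positive, so the
projection to them is the triangle. -/
theorem not_cycle_and_vertex (T : FullyFourColored S) (hp : S p1 p2 0 0) (hp1 : 0 < p1)
    (hp2 : 0 < p2) (hq : S 0 q2 q3 0) (hq2 : 0 < q2) (hq3 : 0 < q3) (hr : S 0 0 r3 r4)
    (hr3 : 0 < r3) (hr4 : 0 < r4) (hs : S s1 0 0 s4) (hs1 : 0 < s1) (hs4 : 0 < s4)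
    (hE : ∀ {b d}, S 0 b 0 d → 0 < b → 0 < d → False) (h1 : S t1 0 0 0) : False := by
  have g1 := T.two_le_vertex h1
  have r4_one : ∀ {c d}, S 0 0 c d → 0 < c → 0 < d → d = 1 := by
    intro c d hr hr3 hr4
    by_contra hne
    have h := T.bad h1 hp hq hr (by omega) (by omega) (by omega) (by omega)
    unfold det4 det3 at h
    exact absurd (show t1 * p2 * q3 * d = 0 by linear_combination h) (by positivity)
  have q2_one : ∀ {b c}, S 0 b c 0 → 0 < b → 0 < c → b = 1 := by
    intro b c hq hq2 hq3
    by_contra hne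
    have h := T.bad h1 hs hr hq (by omega) (by omega) (by omega) (by omega)
    unfold det4 det3 at h
    exact absurd (show t1 * s4 * r3 * b = 0 by linear_combination -h) (by positivity)
  have hr3' : r3 ≠ 1 := by
    rintro rfl
    obtain rfl := r4_one hr hr3 hr4
    exact T.swap14.swap23.edge_not_flat hr h1 hp (by omega) fun h ha hb => r4_one h hb ha
  have hq3' : q3 ≠ 1 := by
    rintro rfl
    obtain rfl := q2_one hq hq2 hq3
    exact T.swap12.swap23.edge_not_flat hq h1 hs (by omega) q2_one
  have p2_one : ∀ {a b}, S a b 0 0 → 0 < a → 0 < b → b = 1 := by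
    intro a b hp hp1 hp2
    by_contra hne
    have h := T.bad h1 hp hr hs (by omega) (by omega) (by omega) (by omega)
    unfold det4 det3 at h
    exact absurd (show t1 * b * r3 * s4 = 0 by linear_combination h) (by positivity)
  have s4_one : ∀ {a d}, S a 0 0 d → 0 < a → 0 < d → d = 1 := by
    intro a d hs hs1 hs4
    by_contra hne
    have h := T.bad h1 hp hq hs (by omega) (by omega) (by omega) (by omega)
    unfold det4 det3 at h
    exact absurd (show t1 * p2 * q3 * d = 0 by linear_combination h) (by positivity)
  have hV2 : ∀ {b}, ¬ S 0 b 0 0 := by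
    intro b h2
    have g2 := T.swap12.two_le_vertex h2
    have h := T.bad h2 hp hs hr (by omega) (by omega) (by omega) (by omega)
    unfold det4 det3 at h
    exact absurd (show b * p1 * r3 * s4 = 0 by linear_combination h) (by positivity)
  have hV4 : ∀ {d}, ¬ S 0 0 0 d := by
    intro d h4
    have g4 := T.swap14.two_le_vertex h4
    have h := T.bad h4 hs hp hq (by omega) (by omega) (by omega) (by omega)
    unfold det4 det3 at h
    exact absurd (show d * s1 * p2 * q3 = 0 by linear_combination -h) (by positivity)
  refine T.swap34.swap12.swap23.core.not_triangle ⟨⟨t1, 0, h1⟩, fun b d a c h => ?_⟩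
  have h0 := T.nonneg h
  have hz := T.two_zeros h
  by_cases hb : b = 0
  · subst hb
    by_cases hd : d = 0
    · exact Or.inl ⟨rfl, hd⟩
    refine Or.inr (Or.inr ⟨rfl, ?_⟩)
    by_cases ha : a = 0
    · subst ha
      by_cases hc : c = 0
      · subst hc
        exact (hV4 h).elim
      · exact r4_one h (by omega) (by omega)
    · obtain rfl : c = 0 := by omega
      exact s4_one h (by omega) (by omega)
  · by_cases hd : d = 0
    · subst hd
      refine Or.inr (Or.inl ⟨?_, rfl⟩)
      by_cases ha : a = 0
      · subst ha
        by_cases hc : c = 0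
        · subst hc
          exact (hV2 h).elim
        · exact q2_one h (by omega) (by omega)
      · obtain rfl : c = 0 := by omega
        exact p2_one h (by omega) (by omega)
    · obtain ⟨rfl, rfl⟩ : a = 0 ∧ c = 0 := by omega
      exact (hE h (by omega) (by omega)).elim

theorem not_cycle (T : FullyFourColored S) (hp : S p1 p2 0 0) (hp1 : 0 < p1)
    (hp2 : 0 < p2) (hq : S 0 q2 q3 0) (hq2 : 0 < q2) (hq3 : 0 < q3) (hr : S 0 0 r3 r4)
    (hr3 : 0 < r3) (hr4 : 0 < r4) (hs : S s1 0 0 s4) (hs1 : 0 < s1) (hs4 : 0 < s4)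
    (hE : ∀ {b d}, S 0 b 0 d → 0 < b → 0 < d → False)
    (hE' : ∀ {a c}, S a 0 c 0 → 0 < a → 0 < c → False) : False := by
  have rel : ∀ {p1 p2 q2 q3}, S p1 p2 0 0 → 0 < p1 → 0 < p2 → S 0 q2 q3 0 → 0 < q2 → 0 < q3 →
      p1 * q2 * r3 * s4 = p2 * q3 * r4 * s1 := by
    intro p1 p2 q2 q3 hp hp1 hp2 hq hq2 hq3
    have h := T.bad hp hq hr hs (by omega) (by omega) (by omega) (by omega)
    unfold det4 det3 at h
    linear_combination h
  -- The functional vanishes on `p` and `q`. By `rel` these are the only points inside the edges 12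
  -- and 23, so the point found must be a vertex.
  obtain ⟨y, z, x, h, hne⟩ := T.swap14.facet.exists_ne (-(p1 * q3)) (p1 * q2) (p2 * q3)
    (Or.inr (Or.inl (by positivity)))
  have h0 := T.nonneg h
  have hz := T.two_zeros h
  by_cases hx : x = 0
  · subst hx
    by_cases hy : y = 0
    · subst hy
      exact T.swap13.not_cycle_and_vertex hq hq3 hq2 hp hp2 hp1 hs hs1 hs4 hr hr3 hr4 hE h
    by_cases hz : z = 0
    · subst hz
      exact T.swap12.swap34.not_cycle_and_vertex hp hp2 hp1 hs hs1 hs4 hr hr4 hr3 hq hq2 hq3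
        (fun h hb hd => hE' h hb hd) h
    have e := rel hp hp1 hp2 hq hq2 hq3
    have e' := rel hp hp1 hp2 h (by omega) (by omega)
    have hpar : y * q3 = z * q2 := by
      refine mul_left_cancel₀ (show p1 * r3 * s4 ≠ 0 by positivity) ?_
      linear_combination q3 * e' - z * e
    exact hne (by linear_combination -p1 * hpar)
  · by_cases hy : y = 0
    · subst hy
      by_cases hz : z = 0
      · subst hz
        exact T.not_cycle_and_vertex hp hp1 hp2 hq hq2 hq3 hr hr3 hr4 hs hs1 hs4 hE h
      · exact hE' h (by omega) (by omega)
    · obtain rfl : z = 0 := by omega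
      have e := rel hp hp1 hp2 hq hq2 hq3
      have e' := rel h (by omega) (by omega) hq hq2 hq3
      have hpar : x * p2 = y * p1 := by
        refine mul_left_cancel₀ (show q2 * r3 * s4 ≠ 0 by positivity) ?_
        linear_combination p2 * e' - y * e
      exact hne (by linear_combination q3 * hpar)

end Cycle

theorem exists_vertex (T : FullyFourColored S)
    (h3 : ∀ {a c}, S a 0 c 0 → 0 < a → 0 < c → False)
    (h4 : ∀ {a d}, S a 0 0 d → 0 < a → 0 < d → False) : ∃ a, S a 0 0 0 := by
  obtain ⟨a, c, d, h, ha⟩ := T.swap12.exists_facet_diff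
  have h0 := T.nonneg h
  have hz := T.two_zeros h
  by_cases hc : c = 0
  · subst hc
    by_cases hd : d = 0
    · subst hd
      exact ⟨a, h⟩
    · exact (h4 h ha (by omega)).elim
  · obtain rfl : d = 0 := by omega
    exact (h3 h ha (by omega)).elim

/-- A path `3 - 1 - 2 - 4` of edges without further edges is impossible. -/
theorem not_path_of_no_other_edges (T : FullyFourColored S) (hp : S p1 p2 0 0) (hp1 : 0 < p1)
    (hp2 : 0 < p2) (hq : S q1 0 q3 0) (hq1 : 0 < q1) (hq3 : 0 < q3) (hr : S 0 r2 0 r4)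
    (hr2 : 0 < r2) (hr4 : 0 < r4) (h14 : ∀ {a d}, S a 0 0 d → 0 < a → 0 < d → False)
    (h23 : ∀ {b c}, S 0 b c 0 → 0 < b → 0 < c → False)
    (h34 : ∀ {c d}, S 0 0 c d → 0 < c → 0 < d → False) : False := by
  obtain ⟨t3, h3⟩ := T.swap13.swap23.exists_vertex (fun h ha hc => h23 h hc ha)
    (fun h ha hc => h34 h ha hc)
  obtain ⟨t4, h4⟩ := T.swap14.exists_vertex (fun h ha hc => h34 h hc ha)
    (fun h ha hc => h14 h hc ha)
  exact T.swap23.swap12.not_path hq hq3 hq1 hp hp1 hp2 hr hr2 hr4 h3 h4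

/-- There are no points on two edges through the same vertex. -/
theorem not_two_edges (T : FullyFourColored S) (hp : S p1 p2 0 0)
    (hp1 : 0 < p1) (hp2 : 0 < p2) (hq : S q1 0 q3 0) (hq1 : 0 < q1) (hq3 : 0 < q3) : False := by
  have h23 : ∀ {b c}, S 0 b c 0 → 0 < b → 0 < c → False := fun h hb hc =>
    T.not_triangle hp hp1 hp2 hq hq1 hq3 h hb hc
  have wedge : (∀ {b d}, S 0 b 0 d → 0 < b → 0 < d → False) →
      (∀ {c d}, S 0 0 c d → 0 < c → 0 < d → False) → False := by
    intro h24 h34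
    obtain ⟨t2, h2⟩ := T.swap12.exists_vertex h23 h24
    obtain ⟨t3, h3⟩ := T.swap13.swap23.exists_vertex (fun h ha hc => h23 h hc ha) h34
    obtain ⟨t4, h4⟩ := T.swap14.swap24.exists_vertex (fun h ha hc => h34 h hc ha)
      (fun h ha hc => h24 h hc ha)
    exact T.not_wedge hp hp1 hp2 hq hq1 hq3 h2 h3 h4
  by_cases h14 : ∃ a d, S a 0 0 d ∧ 0 < a ∧ 0 < d
  · obtain ⟨s1, s4, hs, hs1, hs4⟩ := h14
    exact wedge (fun h hb hd => T.swap34.not_triangle hp hp1 hp2 hs hs1 hs4 h hb hd)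
      (fun h hc hd => T.swap24.not_triangle hs hs1 hs4 hq hq1 hq3 h hd hc)
  have h14' : ∀ {a d}, S a 0 0 d → 0 < a → 0 < d → False := fun h ha hd =>
    h14 ⟨_, _, h, ha, hd⟩
  by_cases h24 : ∃ b d, S 0 b 0 d ∧ 0 < b ∧ 0 < d
  · obtain ⟨r2, r4, hr, hr2, hr4⟩ := h24
    by_cases h34 : ∃ c d, S 0 0 c d ∧ 0 < c ∧ 0 < d
    · obtain ⟨u, v, hu, hu0, hv0⟩ := h34
      exact T.swap34.not_cycle hp hp1 hp2 hr hr2 hr4 hu hv0 hu0 hq hq1 hq3 h23 h14'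
    · exact T.not_path_of_no_other_edges hp hp1 hp2 hq hq1 hq3 hr hr2 hr4 h14' h23
        fun h hc hd => h34 ⟨_, _, h, hc, hd⟩
  · by_cases h34 : ∃ c d, S 0 0 c d ∧ 0 < c ∧ 0 < d
    · obtain ⟨u, v, hu, hu0, hv0⟩ := h34
      exact T.swap23.not_path_of_no_other_edges hq hq1 hq3 hp hp1 hp2 hu hu0 hv0 h14'
        (fun h hb hc => h23 h hc hb) fun h hc hd => h24 ⟨_, _, h, hc, hd⟩
    · exact wedge (fun h hb hd => h24 ⟨_, _, h, hb, hd⟩) fun h hc hd => h34 ⟨_, _, h, hc, hd⟩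

/-- At most one edge at vertex 1 carries interior points. A facet that contains vertex 1 but not
this edge has a point with `x₁ > 0`, which must be the vertex. -/
theorem exists_first_vertex (T : FullyFourColored S) : ∃ a, S a 0 0 0 := by
  by_contra! hV
  by_cases h12 : ∃ a b, S a b 0 0 ∧ 0 < a ∧ 0 < b
  · obtain ⟨p1, p2, hp, hp1, hp2⟩ := h12
    by_cases h13 : ∃ a c, S a 0 c 0 ∧ 0 < a ∧ 0 < c
    · obtain ⟨q1, q3, hq, hq1, hq3⟩ := h13
      exact T.not_two_edges hp hp1 hp2 hq hq1 hq3
    · obtain ⟨a, h⟩ := T.exists_vertex (fun h ha hc => h13 ⟨_, _, h, ha, hc⟩)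
        (fun h ha hd => T.swap34.not_two_edges hp hp1 hp2 h ha hd)
      exact hV a h
  · by_cases h13 : ∃ a c, S a 0 c 0 ∧ 0 < a ∧ 0 < c
    · obtain ⟨q1, q3, hq, hq1, hq3⟩ := h13
      obtain ⟨a, h⟩ := T.swap23.exists_vertex (fun h ha hc => h12 ⟨_, _, h, ha, hc⟩)
        (fun h ha hd => T.swap24.not_two_edges h ha hd hq hq1 hq3)
      exact hV a h
    · obtain ⟨a, h⟩ := T.swap24.swap34.exists_vertex (fun h ha hc => h12 ⟨_, _, h, ha, hc⟩)
        (fun h ha hc => h13 ⟨_, _, h, ha, hc⟩)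
      exact hV a h

theorem contradiction (T : FullyFourColored S) : False := by
  obtain ⟨t1, h1⟩ := T.exists_first_vertex
  obtain ⟨t2, h2⟩ := T.swap12.exists_first_vertex
  obtain ⟨t3, h3⟩ := T.swap13.exists_first_vertex
  obtain ⟨t4, h4⟩ := T.swap14.exists_first_vertex
  have g1 := T.two_le_vertex h1
  have g2 := T.swap12.two_le_vertex h2
  have g3 := T.swap13.two_le_vertex h3
  have g4 := T.swap14.two_le_vertex h4
  have h := T.bad h1 h2 h3 h4 (by omega) (by omega) (by omega) (by omega)
  unfold det4 det3 at h
  exact absurd (show t1 * t2 * t3 * t4 = 0 by linear_combination h) (by positivity)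

end FullyFourColored

/-! ### Reduction of the number of colours -/

namespace SpansPositiveHyperplane

variable {S : ℤ → ℤ → ℤ → ℤ → Prop} {p1 p2 p3 p4 q1 q2 q3 q4 r1 r2 r3 r4 s1 s2 s3 s4 : ℤ}

theorem swap23 (T : SpansPositiveHyperplane S) :
    SpansPositiveHyperplane (fun a b c d => S a c b d) where
  nonneg h := by have := T.nonneg h; tauto
  lin := by
    obtain ⟨α, β, γ, δ, hα, hβ, hγ, hδ, h⟩ := T.lin
    exact ⟨α, γ, β, δ, hα, hγ, hβ, hδ, fun a b c d hs => by linarith [h _ _ _ _ hs]⟩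
  span t u v w h := by
    have := T.span t v u w (fun a b c d hs => by linarith [h _ _ _ _ hs])
    tauto

theorem swap34 (T : SpansPositiveHyperplane S) :
    SpansPositiveHyperplane (fun a b c d => S a b d c) where
  nonneg h := by have := T.nonneg h; tauto
  lin := by
    obtain ⟨α, β, γ, δ, hα, hβ, hγ, hδ, h⟩ := T.lin
    exact ⟨α, β, δ, γ, hα, hβ, hδ, hγ, fun a b c d hs => by linarith [h _ _ _ _ hs]⟩
  span t u v w h := by
    have := T.span t u w v (fun a b c d hs => by linarith [h _ _ _ _ hs])
    tauto

/-- On a hyperplane with positive normal covector, linear and affine dependence agree. -/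
theorem affine_det_eq_zero_iff (T : SpansPositiveHyperplane S) (hp : S p1 p2 p3 p4)
    (hq : S q1 q2 q3 q4) (hr : S r1 r2 r3 r4) (hs : S s1 s2 s3 s4) :
    det4 p1 p2 p3 1 q1 q2 q3 1 r1 r2 r3 1 s1 s2 s3 1 = 0 ↔
      det4 p1 p2 p3 p4 q1 q2 q3 q4 r1 r2 r3 r4 s1 s2 s3 s4 = 0 := by
  obtain ⟨α, β, γ, δ, -, -, -, hδ, h⟩ := T.lin
  have ep := h _ _ _ _ hp
  have eq := h _ _ _ _ hq
  have er := h _ _ _ _ hr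
  have es := h _ _ _ _ hs
  have key : ((det4 p1 p2 p3 1 q1 q2 q3 1 r1 r2 r3 1 s1 s2 s3 1 : ℤ) : ℝ) =
      δ * ((det4 p1 p2 p3 p4 q1 q2 q3 q4 r1 r2 r3 r4 s1 s2 s3 s4 : ℤ) : ℝ) := by
    unfold det4 det3
    push_cast
    -- The column of ones is the covector combination of the four coordinate columns; the
    -- coefficients are the cofactors of that column.
    linear_combination
      -((p1 : ℝ) * (q2 * r3 - q3 * r2) - p2 * (q1 * r3 - q3 * r1) + p3 * (q1 * r2 - q2 * r1)) * es
      + ((p1 : ℝ) * (q2 * s3 - q3 * s2) - p2 * (q1 * s3 - q3 * s1) + p3 * (q1 * s2 - q2 * s1)) * er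
      - ((p1 : ℝ) * (r2 * s3 - r3 * s2) - p2 * (r1 * s3 - r3 * s1) + p3 * (r1 * s2 - r2 * s1)) * eq
      + ((q1 : ℝ) * (r2 * s3 - r3 * s2) - q2 * (r1 * s3 - r3 * s1) + q3 * (r1 * s2 - r2 * s1)) * ep
  constructor
  · intro h0
    rw [h0, Int.cast_zero, eq_comm, mul_eq_zero] at key
    exact_mod_cast key.resolve_left hδ.ne'
  · intro h0
    rw [h0, Int.cast_zero, mul_zero] at key
    exact_mod_cast key

end SpansPositiveHyperplane

section Det

variable {p1 p2 p3 p4 q1 q2 q3 q4 r1 r2 r3 r4 s1 s2 s3 s4 : ℤ}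

theorem det4_cast_eq_det : ((det4 p1 p2 p3 p4 q1 q2 q3 q4 r1 r2 r3 r4 s1 s2 s3 s4 : ℤ) : ℝ) =
    Matrix.det !![(p1 : ℝ), p2, p3, p4; (q1 : ℝ), q2, q3, q4; (r1 : ℝ), r2, r3, r4;
      (s1 : ℝ), s2, s3, s4] := by
  unfold det4 det3
  simp [Matrix.det_succ_row_zero, Fin.sum_univ_succ, Fin.succAbove]
  ring

/-- A linear functional that vanishes on a basis is zero. -/
theorem functional_eq_zero (hd : det4 p1 p2 p3 p4 q1 q2 q3 q4 r1 r2 r3 r4 s1 s2 s3 s4 ≠ 0)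
    {t u v w : ℝ} (hp : t * p1 + u * p2 + v * p3 + w * p4 = 0)
    (hq : t * q1 + u * q2 + v * q3 + w * q4 = 0) (hr : t * r1 + u * r2 + v * r3 + w * r4 = 0)
    (hs : t * s1 + u * s2 + v * s3 + w * s4 = 0) : t = 0 ∧ u = 0 ∧ v = 0 ∧ w = 0 := by
  have hd' : Matrix.det !![(p1 : ℝ), p2, p3, p4; (q1 : ℝ), q2, q3, q4; (r1 : ℝ), r2, r3, r4;
      (s1 : ℝ), s2, s3, s4] ≠ 0 := by
    rw [← det4_cast_eq_det]
    exact_mod_cast hd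
  have h := Matrix.eq_zero_of_mulVec_eq_zero hd' (v := ![t, u, v, w]) (by
    ext i
    fin_cases i <;> simp [Matrix.mulVec, dotProduct, Fin.sum_univ_four] <;> linarith)
  exact ⟨congrFun h 0, congrFun h 1, congrFun h 2, congrFun h 3⟩

/-- A vanishing linear combination of a basis is trivial. -/
theorem combination_eq_zero (hd : det4 p1 p2 p3 p4 q1 q2 q3 q4 r1 r2 r3 r4 s1 s2 s3 s4 ≠ 0)
    {t u v w : ℝ} (h1 : t * p1 + u * q1 + v * r1 + w * s1 = 0)
    (h2 : t * p2 + u * q2 + v * r2 + w * s2 = 0) (h3 : t * p3 + u * q3 + v * r3 + w * s3 = 0)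
    (h4 : t * p4 + u * q4 + v * r4 + w * s4 = 0) : t = 0 ∧ u = 0 ∧ v = 0 ∧ w = 0 := by
  have hd' : Matrix.det !![(p1 : ℝ), p2, p3, p4; (q1 : ℝ), q2, q3, q4; (r1 : ℝ), r2, r3, r4;
      (s1 : ℝ), s2, s3, s4] ≠ 0 := by
    rw [← det4_cast_eq_det]
    exact_mod_cast hd
  have h := Matrix.eq_zero_of_vecMul_eq_zero hd' (v := ![t, u, v, w]) (by
    ext i
    fin_cases i <;> simp [Matrix.vecMul, dotProduct, Fin.sum_univ_four] <;> linarith)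
  exact ⟨congrFun h 0, congrFun h 1, congrFun h 2, congrFun h 3⟩

end Det

/-- There is exactly one point outside the first coordinate hyperplane, at height `1`. -/
def PyramidOverFirst (S : ℤ → ℤ → ℤ → ℤ → Prop) : Prop :=
  ∃ b c d, S 1 b c d ∧
    ∀ a' b' c' d', S a' b' c' d' → ¬ (a' = 1 ∧ b' = b ∧ c' = c ∧ d' = d) → a' = 0

/-- After a permutation of the coordinates, `S` is of one of the four types. -/
def Classified (S : ℤ → ℤ → ℤ → ℤ → Prop) : Prop :=
  ∃ R, Reorder S R ∧
    (PyramidOverFirst R ∨ TriangleProjection R ∨ FlatBorder R ∨ IsCrossPolytope R)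

theorem Classified.of_reorder {S R : ℤ → ℤ → ℤ → ℤ → Prop} (h : Reorder S R)
    (hR : Classified R) : Classified S := by
  obtain ⟨Q, hQ, h'⟩ := hR
  exact ⟨Q, h.trans hQ, h'⟩

/-- Every basis has some coordinate sum equal to `1`. -/
structure Colored (S : ℤ → ℤ → ℤ → ℤ → Prop) : Prop extends SpansPositiveHyperplane S where
  color : ∀ {p1 p2 p3 p4 q1 q2 q3 q4 r1 r2 r3 r4 s1 s2 s3 s4}, S p1 p2 p3 p4 → S q1 q2 q3 q4 →
    S r1 r2 r3 r4 → S s1 s2 s3 s4 →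
    det4 p1 p2 p3 p4 q1 q2 q3 q4 r1 r2 r3 r4 s1 s2 s3 s4 ≠ 0 →
    p1 + q1 + r1 + s1 = 1 ∨ p2 + q2 + r2 + s2 = 1 ∨ p3 + q3 + r3 + s3 = 1 ∨ p4 + q4 + r4 + s4 = 1

namespace Colored

variable {S R : ℤ → ℤ → ℤ → ℤ → Prop}

theorem swap12 (T : Colored S) : Colored (fun a b c d => S b a c d) where
  toSpansPositiveHyperplane := T.toSpansPositiveHyperplane.swap12
  color hp hq hr hs hd := by
    have := T.color hp hq hr hs (fun h => hd (by unfold det4 det3 at *; linear_combination -h))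
    tauto

theorem swap23 (T : Colored S) : Colored (fun a b c d => S a c b d) where
  toSpansPositiveHyperplane := T.toSpansPositiveHyperplane.swap23
  color hp hq hr hs hd := by
    have := T.color hp hq hr hs (fun h => hd (by unfold det4 det3 at *; linear_combination -h))
    tauto

theorem swap34 (T : Colored S) : Colored (fun a b c d => S a b d c) where
  toSpansPositiveHyperplane := T.toSpansPositiveHyperplane.swap34
  color hp hq hr hs hd := by
    have := T.color hp hq hr hs (fun h => hd (by unfold det4 det3 at *; linear_combination -h))
    tauto

theorem reorder (T : Colored S) (h : Reorder S R) : Colored R := by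
  induction h with
  | refl => exact T
  | swap12 _ ih => exact ih.swap12
  | swap23 _ ih => exact ih.swap23
  | swap34 _ ih => exact ih.swap34

theorem classified_of_two (T : Colored S)
    (bad : ∀ {p1 p2 p3 p4 q1 q2 q3 q4 r1 r2 r3 r4 s1 s2 s3 s4}, S p1 p2 p3 p4 → S q1 q2 q3 q4 →
      S r1 r2 r3 r4 → S s1 s2 s3 s4 → 2 ≤ p1 + q1 + r1 + s1 → 2 ≤ p2 + q2 + r2 + s2 →
      det4 p1 p2 p3 p4 q1 q2 q3 q4 r1 r2 r3 r4 s1 s2 s3 s4 = 0) : Classified S := by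
  by_cases h1 : ∃ p1 p2 p3 p4 q1 q2 q3 q4 r1 r2 r3 r4 s1 s2 s3 s4, S p1 p2 p3 p4 ∧ S q1 q2 q3 q4 ∧
    S r1 r2 r3 r4 ∧ S s1 s2 s3 s4 ∧ 2 ≤ p2 + q2 + r2 + s2 ∧
    det4 p1 p2 p3 p4 q1 q2 q3 q4 r1 r2 r3 r4 s1 s2 s3 s4 ≠ 0
  · by_cases h2 : ∃ p1 p2 p3 p4 q1 q2 q3 q4 r1 r2 r3 r4 s1 s2 s3 s4, S p1 p2 p3 p4 ∧
      S q1 q2 q3 q4 ∧ S r1 r2 r3 r4 ∧ S s1 s2 s3 s4 ∧ 2 ≤ p1 + q1 + r1 + s1 ∧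
      det4 p1 p2 p3 p4 q1 q2 q3 q4 r1 r2 r3 r4 s1 s2 s3 s4 ≠ 0
    · have T2 : TwoColored S := ⟨T.toSpansPositiveHyperplane, bad, h1, h2⟩
      exact ⟨S, .refl, by have := T2.classify; tauto⟩
    · refine ⟨S, .refl, Or.inl (T.pyramid_of_color fun hp hq hr hs h => ?_)⟩
      by_contra hd
      exact h2 ⟨_, _, _, _, _, _, _, _, _, _, _, _, _, _, _, _, hp, hq, hr, hs, h, hd⟩
  · refine ⟨_, .swap12 .refl, Or.inl (T.swap12.pyramid_of_color fun hp hq hr hs h => ?_)⟩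
    by_contra hd
    exact h1 ⟨_, _, _, _, _, _, _, _, _, _, _, _, _, _, _, _, hp, hq, hr, hs, h,
      fun h0 => hd (by unfold det4 det3 at *; linear_combination -h0)⟩

/-- Lifts a flat border from the projection: by the antichain property the first three coordinates
determine the fourth. -/
theorem flatBorder_of_projection (T : Colored S) {c c' e : ℤ} (h : ∃ d, S 0 0 c d)
    (h' : ∃ d, S 0 0 c' d) (hne : c ≠ c') (he : ∃ d, S 1 1 e d)
    (hu : ∀ x y z, (∃ d, S x y z d) → 0 < x → 0 < y → x = 1 ∧ y = 1 ∧ z = e) : FlatBorder S := by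
  obtain ⟨d, h⟩ := h
  obtain ⟨d', h'⟩ := h'
  obtain ⟨f, he⟩ := he
  refine ⟨c, d, c', d', e, f, h, h', fun h => hne h.1, he, fun x y z w hs hx hy => ?_⟩
  obtain ⟨rfl, rfl, rfl⟩ := hu _ _ _ ⟨_, hs⟩ hx hy
  refine ⟨rfl, rfl, rfl, ?_⟩
  rcases le_total w f with hle | hle
  · exact (T.anti hs he le_rfl le_rfl le_rfl hle).2.2.2
  · exact (T.anti he hs le_rfl le_rfl le_rfl hle).2.2.2.symm

theorem classified_of_three (T : Colored S)
    (bad : ∀ {p1 p2 p3 p4 q1 q2 q3 q4 r1 r2 r3 r4 s1 s2 s3 s4}, S p1 p2 p3 p4 → S q1 q2 q3 q4 →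
      S r1 r2 r3 r4 → S s1 s2 s3 s4 → 2 ≤ p1 + q1 + r1 + s1 → 2 ≤ p2 + q2 + r2 + s2 →
      2 ≤ p3 + q3 + r3 + s3 → det4 p1 p2 p3 p4 q1 q2 q3 q4 r1 r2 r3 r4 s1 s2 s3 s4 = 0) :
    Classified S := by
  by_contra hno
  have hflat : ∀ R, Reorder S R → ¬ FlatBorder R := fun R hR hf => hno ⟨R, hR, by tauto⟩
  have e1 : ∃ p1 p2 p3 p4 q1 q2 q3 q4 r1 r2 r3 r4 s1 s2 s3 s4, S p1 p2 p3 p4 ∧ S q1 q2 q3 q4 ∧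
      S r1 r2 r3 r4 ∧ S s1 s2 s3 s4 ∧ 2 ≤ p2 + q2 + r2 + s2 ∧ 2 ≤ p3 + q3 + r3 + s3 ∧
      det4 p1 p2 p3 p4 q1 q2 q3 q4 r1 r2 r3 r4 s1 s2 s3 s4 ≠ 0 := by
    by_contra h1
    refine hno (.of_reorder (.swap23 (.swap12 .refl))
      (T.swap12.swap23.classified_of_two fun hp hq hr hs h h' => ?_))
    by_contra hd
    exact h1 ⟨_, _, _, _, _, _, _, _, _, _, _, _, _, _, _, _, hp, hq, hr, hs, h, h',
      fun h0 => hd (by unfold det4 det3 at *; linear_combination h0)⟩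
  have e2 : ∃ p1 p2 p3 p4 q1 q2 q3 q4 r1 r2 r3 r4 s1 s2 s3 s4, S p1 p2 p3 p4 ∧ S q1 q2 q3 q4 ∧
      S r1 r2 r3 r4 ∧ S s1 s2 s3 s4 ∧ 2 ≤ p1 + q1 + r1 + s1 ∧ 2 ≤ p3 + q3 + r3 + s3 ∧
      det4 p1 p2 p3 p4 q1 q2 q3 q4 r1 r2 r3 r4 s1 s2 s3 s4 ≠ 0 := by
    by_contra h1
    refine hno (.of_reorder (.swap23 .refl)
      (T.swap23.classified_of_two fun hp hq hr hs h h' => ?_))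
    by_contra hd
    exact h1 ⟨_, _, _, _, _, _, _, _, _, _, _, _, _, _, _, _, hp, hq, hr, hs, h, h',
      fun h0 => hd (by unfold det4 det3 at *; linear_combination -h0)⟩
  have e3 : ∃ p1 p2 p3 p4 q1 q2 q3 q4 r1 r2 r3 r4 s1 s2 s3 s4, S p1 p2 p3 p4 ∧ S q1 q2 q3 q4 ∧
      S r1 r2 r3 r4 ∧ S s1 s2 s3 s4 ∧ 2 ≤ p1 + q1 + r1 + s1 ∧ 2 ≤ p2 + q2 + r2 + s2 ∧
      det4 p1 p2 p3 p4 q1 q2 q3 q4 r1 r2 r3 r4 s1 s2 s3 s4 ≠ 0 := by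
    by_contra h1
    refine hno (T.classified_of_two fun hp hq hr hs h h' => ?_)
    by_contra hd
    exact h1 ⟨_, _, _, _, _, _, _, _, _, _, _, _, _, _, _, _, hp, hq, hr, hs, h, h', hd⟩
  have T3 : ThreeColored (fun a b c => ∃ d, S a b c d) :=
    { spanning :=
        { nonneg := by
            rintro a b c _ ⟨⟨d, h⟩, rfl⟩
            have := T.nonneg h
            omega
          span := by
            intro t u v w h
            obtain ⟨p1, p2, p3, p4, q1, q2, q3, q4, r1, r2, r3, r4, s1, s2, s3, s4, hp, hq, hr, hs,
              -, -, hd⟩ := e1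
            have hd' := mt (T.affine_det_eq_zero_iff hp hq hr hs).1 hd
            have key := functional_eq_zero hd' (t := t) (u := u) (v := v) (w := w)
              (by exact_mod_cast h p1 p2 p3 1 ⟨⟨_, hp⟩, rfl⟩)
              (by exact_mod_cast h q1 q2 q3 1 ⟨⟨_, hq⟩, rfl⟩)
              (by exact_mod_cast h r1 r2 r3 1 ⟨⟨_, hr⟩, rfl⟩)
              (by exact_mod_cast h s1 s2 s3 1 ⟨⟨_, hs⟩, rfl⟩)
            exact_mod_cast key }
      bad := by
        rintro p1 p2 p3 q1 q2 q3 r1 r2 r3 s1 s2 s3 ⟨p4, hp⟩ ⟨q4, hq⟩ ⟨r4, hr⟩ ⟨s4, hs⟩ h1 h2 h3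
        exact (T.affine_det_eq_zero_iff hp hq hr hs).2 (bad hp hq hr hs h1 h2 h3)
      excl₁ := by
        obtain ⟨p1, p2, p3, p4, q1, q2, q3, q4, r1, r2, r3, r4, s1, s2, s3, s4, hp, hq, hr, hs,
          h, h', hd⟩ := e1
        exact ⟨_, _, _, _, _, _, _, _, _, _, _, _, ⟨_, hp⟩, ⟨_, hq⟩, ⟨_, hr⟩, ⟨_, hs⟩, h, h',
          mt (T.affine_det_eq_zero_iff hp hq hr hs).1 hd⟩
      excl₂ := by
        obtain ⟨p1, p2, p3, p4, q1, q2, q3, q4, r1, r2, r3, r4, s1, s2, s3, s4, hp, hq, hr, hs,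
          h, h', hd⟩ := e2
        exact ⟨_, _, _, _, _, _, _, _, _, _, _, _, ⟨_, hp⟩, ⟨_, hq⟩, ⟨_, hr⟩, ⟨_, hs⟩, h, h',
          mt (T.affine_det_eq_zero_iff hp hq hr hs).1 hd⟩
      excl₃ := by
        obtain ⟨p1, p2, p3, p4, q1, q2, q3, q4, r1, r2, r3, r4, s1, s2, s3, s4, hp, hq, hr, hs,
          h, h', hd⟩ := e3
        exact ⟨_, _, _, _, _, _, _, _, _, _, _, _, ⟨_, hp⟩, ⟨_, hq⟩, ⟨_, hr⟩, ⟨_, hs⟩, h, h',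
          mt (T.affine_det_eq_zero_iff hp hq hr hs).1 hd⟩
      flat₁₂ := fun h h' hne he hu =>
        hflat _ .refl (T.flatBorder_of_projection h h' hne he hu)
      flat₁₃ := fun h h' hne he hu =>
        hflat _ (.swap23 .refl) (T.swap23.flatBorder_of_projection h h' hne he
          fun x y z hs hx hy => hu x z y hs hx hy)
      flat₂₃ := fun h h' hne he hu =>
        hflat _ (.swap23 (.swap12 .refl)) (T.swap12.swap23.flatBorder_of_projection h h' hne he
          fun x y z hs hx hy => hu z x y hs hx hy) }
  exact T3.contradiction

theorem classified (T : Colored S) : Classified S := by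
  by_contra hno
  have e : ∀ R, Reorder S R → ∃ p1 p2 p3 p4 q1 q2 q3 q4 r1 r2 r3 r4 s1 s2 s3 s4,
      R p1 p2 p3 p4 ∧ R q1 q2 q3 q4 ∧ R r1 r2 r3 r4 ∧ R s1 s2 s3 s4 ∧
      2 ≤ p2 + q2 + r2 + s2 ∧ 2 ≤ p3 + q3 + r3 + s3 ∧ 2 ≤ p4 + q4 + r4 + s4 ∧
      det4 p1 p2 p3 p4 q1 q2 q3 q4 r1 r2 r3 r4 s1 s2 s3 s4 ≠ 0 := by
    intro R hR
    by_contra h1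
    have TR := T.reorder hR
    -- If the first coordinate of `R` is dispensable, move it to the last place and use the case of
    -- three colours.
    refine hno (.of_reorder hR (.of_reorder (.swap34 (.swap23 (.swap12 .refl)))
      (TR.swap12.swap23.swap34.classified_of_three fun hp hq hr hs h h' h'' => ?_)))
    by_contra hd
    exact h1 ⟨_, _, _, _, _, _, _, _, _, _, _, _, _, _, _, _, hp, hq, hr, hs, h, h', h'',
      fun h0 => hd (by unfold det4 det3 at *; linear_combination -h0)⟩
  have T4 : FullyFourColored S := fun R hR =>
    { toSpansPositiveHyperplane := (T.reorder hR).toSpansPositiveHyperplane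
      bad := fun hp hq hr hs h1 h2 h3 h4 => by
        by_contra hd
        have := (T.reorder hR).color hp hq hr hs hd
        omega
      excl := e R hR
      not_flat := fun h => hno ⟨R, hR, by tauto⟩
      not_triangle := fun h => hno ⟨R, hR, by tauto⟩
      not_cross := fun h => hno ⟨R, hR, by tauto⟩ }
  exact T4.contradiction

end Colored

theorem IsCrossPolytope.of_reorder {S R : ℤ → ℤ → ℤ → ℤ → Prop} (h : Reorder S R)
    (hR : IsCrossPolytope R) : IsCrossPolytope S := by
  induction h with
  | refl => exact hR
  | swap12 _ ih =>
    obtain ⟨h1, h2, h3, h4, h5, h6, h⟩ := hR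
    exact ih ⟨h1, h4, h5, h2, h3, h6, fun a b c d hs => by have := h _ _ _ _ hs; omega⟩
  | swap23 _ ih =>
    obtain ⟨h1, h2, h3, h4, h5, h6, h⟩ := hR
    exact ih ⟨h2, h1, h3, h4, h6, h5, fun a b c d hs => by have := h _ _ _ _ hs; omega⟩
  | swap34 _ ih =>
    obtain ⟨h1, h2, h3, h4, h5, h6, h⟩ := hR
    exact ih ⟨h1, h3, h2, h5, h4, h6, fun a b c d hs => by have := h _ _ _ _ hs; omega⟩

/-! ### Translation between finite sets of lattice points and quadruples -/

/-- The points of `τ`, as quadruples of integers with the coordinates in the order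
`i, j, k, l`. -/
def Quadruples (τ : Finset (Fin 4 → ℕ)) (i j k l : Fin 4) (a b c d : ℤ) : Prop :=
  ∃ p ∈ τ, (p i : ℤ) = a ∧ (p j : ℤ) = b ∧ (p k : ℤ) = c ∧ (p l : ℤ) = d

section Quadruples

variable {τ : Finset (Fin 4 → ℕ)} {i j k l : Fin 4}

theorem quadruples_mem {p : Fin 4 → ℕ} (hp : p ∈ τ) :
    Quadruples τ i j k l (p i) (p j) (p k) (p l) := ⟨p, hp, rfl, rfl, rfl, rfl⟩

/-- That the four indices exhaust `Fin 4` encodes that they form a permutation. -/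
theorem Reorder.exists_quadruples {S R : ℤ → ℤ → ℤ → ℤ → Prop} (h : Reorder S R)
    (hS : S = Quadruples τ 0 1 2 3) :
    ∃ i j k l : Fin 4, (∀ m, m = i ∨ m = j ∨ m = k ∨ m = l) ∧ R = Quadruples τ i j k l := by
  induction h with
  | refl => exact ⟨0, 1, 2, 3, by decide, hS⟩
  | swap12 _ ih =>
    obtain ⟨i, j, k, l, hm, rfl⟩ := ih
    refine ⟨j, i, k, l, fun m => by have := hm m; tauto, ?_⟩
    funext a b c d
    exact propext ⟨fun ⟨p, hp, h⟩ => ⟨p, hp, by tauto⟩, fun ⟨p, hp, h⟩ => ⟨p, hp, by tauto⟩⟩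
  | swap23 _ ih =>
    obtain ⟨i, j, k, l, hm, rfl⟩ := ih
    refine ⟨i, k, j, l, fun m => by have := hm m; tauto, ?_⟩
    funext a b c d
    exact propext ⟨fun ⟨p, hp, h⟩ => ⟨p, hp, by tauto⟩, fun ⟨p, hp, h⟩ => ⟨p, hp, by tauto⟩⟩
  | swap34 _ ih =>
    obtain ⟨i, j, k, l, hm, rfl⟩ := ih
    refine ⟨i, j, l, k, fun m => by have := hm m; tauto, ?_⟩
    funext a b c d
    exact propext ⟨fun ⟨p, hp, h⟩ => ⟨p, hp, by tauto⟩, fun ⟨p, hp, h⟩ => ⟨p, hp, by tauto⟩⟩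

theorem ne_of_cover : ∀ {i j k l : Fin 4}, (∀ m, m = i ∨ m = j ∨ m = k ∨ m = l) → i ≠ j := by
  decide

theorem eq_of_coordinates (hm : ∀ m : Fin 4, m = i ∨ m = j ∨ m = k ∨ m = l) {p q : Fin 4 → ℕ}
    (h : (p i : ℤ) = q i ∧ (p j : ℤ) = q j ∧ (p k : ℤ) = q k ∧ (p l : ℤ) = q l) : p = q := by
  funext m
  rcases hm m with rfl | rfl | rfl | rfl <;> omega

theorem isB1_of_pyramidOverFirst (hm : ∀ m : Fin 4, m = i ∨ m = j ∨ m = k ∨ m = l)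
    (h : PyramidOverFirst (Quadruples τ i j k l)) : IsB1 τ := by
  obtain ⟨b, c, d, ⟨p, hp, h1, rfl, rfl, rfl⟩, h⟩ := h
  refine ⟨i, p, hp, by exact_mod_cast h1, fun q hq hne => ?_⟩
  have := h _ _ _ _ (quadruples_mem hq) fun h' =>
    hne (eq_of_coordinates hm ⟨h'.1.trans h1.symm, h'.2⟩)
  exact_mod_cast this

/-- Spanning supplies the two corners that `TriangleProjection` does not assert: otherwise `x_i` or
`x_j` would vanish on `τ`. -/
theorem isB2_of_triangleProjection (hij : i ≠ j)
    (hs : NonnegSpanning (Quadruples τ i j k l))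
    (h : TriangleProjection (Quadruples τ i j k l)) : IsB2 τ := by
  obtain ⟨⟨c, d, p, hp, h1, h2, -, -⟩, h⟩ := h
  have key : ∀ q ∈ τ, q i = 0 ∧ q j = 0 ∨ q i = 1 ∧ q j = 0 ∨ q i = 0 ∧ q j = 1 :=
    fun q hq => by exact_mod_cast h _ _ _ _ (quadruples_mem hq)
  have e1 : ∃ q ∈ τ, q i = 1 ∧ q j = 0 := by
    by_contra! hno
    refine one_ne_zero (hs.span 1 0 0 0 ?_).1
    rintro _ _ _ _ ⟨q, hq, rfl, rfl, rfl, rfl⟩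
    have := key q hq
    have := hno q hq
    omega
  have e2 : ∃ q ∈ τ, q i = 0 ∧ q j = 1 := by
    by_contra! hno
    refine one_ne_zero (hs.span 0 1 0 0 ?_).2.1
    rintro _ _ _ _ ⟨q, hq, rfl, rfl, rfl, rfl⟩
    have := key q hq
    have := hno q hq
    omega
  obtain ⟨q, hq, hq'⟩ := e1
  obtain ⟨r, hr, hr'⟩ := e2
  refine ⟨i, j, hij, ?_⟩
  ext ⟨a, b⟩
  simp only [Finset.mem_image, Finset.mem_insert, Finset.mem_singleton, Prod.mk.injEq]
  constructor
  · rintro ⟨s, hs, rfl, rfl⟩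
    exact key s hs
  · rintro (⟨rfl, rfl⟩ | ⟨rfl, rfl⟩ | ⟨rfl, rfl⟩)
    · exact ⟨p, hp, by omega, by omega⟩
    · exact ⟨q, hq, hq'⟩
    · exact ⟨r, hr, hr'⟩

theorem toReal_injective {n : ℕ} : Function.Injective (toReal (n := n)) := fun p q h => by
  funext m
  have := congrFun h m
  simpa [toReal] using this

theorem affineIndependent_triangle {A B C : Fin 4 → ℕ} (hA : A i = 0) (hB : B i = 0) (hC : C i = 1)
    (hne : A ≠ B) : AffineIndependent ℝ ![toReal A, toReal B, toReal C] := by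
  rw [affineIndependent_iff_of_fintype]
  intro w hw h
  rw [Finset.weightedVSub_eq_linear_combination _ hw] at h
  simp only [Fin.sum_univ_three, Matrix.cons_val_zero, Matrix.cons_val_one, Matrix.cons_val] at hw h
  have hi := congrFun h i
  simp [toReal, hA, hB, hC] at hi
  have hw1 : w 1 = - w 0 := by linarith
  have hw0 : w 0 = 0 := by
    by_contra h0
    refine hne (toReal_injective ?_)
    rw [hi, hw1] at h
    refine smul_right_injective _ h0 ?_
    simpa [add_neg_eq_zero] using h
  intro m
  fin_cases m
  · exact hw0
  · simpa [hw0] using hw1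
  · exact hi

theorem isFlatBorder_of_flatBorder (hij : i ≠ j)
    (hm : ∀ m : Fin 4, m = i ∨ m = j ∨ m = k ∨ m = l)
    (h : FlatBorder (Quadruples τ i j k l)) : IsFlatBorder τ := by
  obtain ⟨_, _, _, _, _, _, ⟨A, hA, A1, A2, rfl, rfl⟩, ⟨B, hB, B1, B2, rfl, rfl⟩, hne,
    ⟨C, hC, C1, C2, rfl, rfl⟩, h⟩ := h
  norm_cast at A1 A2 B1 B2 C1 C2
  refine ⟨i, j, hij, A, hA, B, hB, C, hC, ?_, ⟨A1, A2⟩, ⟨B1, B2⟩, ⟨C1, C2⟩, ?_⟩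
  · exact affineIndependent_triangle A1 B1 C1 fun h => hne (by rw [h]; exact ⟨rfl, rfl⟩)
  · intro D hD _ _ hDC
    by_contra! hD0
    have := h _ _ _ _ (quadruples_mem hD) (by omega) (by omega)
    exact hDC (eq_of_coordinates hm (by omega))

theorem eq_standardCrossPolytope (h : IsCrossPolytope (Quadruples τ 0 1 2 3)) :
    τ = standardCrossPolytope := by
  obtain ⟨h1, h2, h3, h4, h5, h6, h⟩ := h
  have mem : ∀ {a b c d : ℕ}, Quadruples τ 0 1 2 3 a b c d → ![a, b, c, d] ∈ τ := by
    rintro a b c d ⟨p, hp, e⟩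
    convert hp
    exact (eq_of_coordinates (i := 0) (j := 1) (k := 2) (l := 3) (by decide) e).symm
  ext p
  simp only [standardCrossPolytope, Finset.mem_insert, Finset.mem_singleton]
  constructor
  · intro hp
    have := h _ _ _ _ (quadruples_mem hp)
    simp only [funext_iff, Fin.forall_fin_succ, Fin.succ_zero_eq_one, Fin.succ_one_eq_two]
    simp
    have h3 : Fin.succ (2 : Fin 3) = 3 := rfl
    omega
  · rintro (rfl | rfl | rfl | rfl | rfl | rfl)
    exacts [mem (by exact_mod_cast h1), mem (by exact_mod_cast h2), mem (by exact_mod_cast h3),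
      mem (by exact_mod_cast h4), mem (by exact_mod_cast h5), mem (by exact_mod_cast h6)]

end Quadruples

namespace IsBoundedFacet

variable {P : Set (Fin 4 → ℝ)} {τ : Finset (Fin 4 → ℕ)}

/-- If `b ≤ 0`, positivity of the covector puts every point at the origin, against dimension 3. -/
theorem exists_covector (h : IsBoundedFacet P τ) :
    ∃ (a : Fin 4 → ℝ) (b : ℝ), (∀ i, 0 < a i) ∧ 0 < b ∧ ∀ p ∈ τ, ∑ i, a i * p i = b := by
  obtain ⟨⟨a, b, ha, -, hc⟩, hd⟩ := h
  have hp : ∀ p ∈ τ, ∑ i, a i * p i = b := fun p hp => by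
    have : toReal p ∈ convexHull ℝ (toReal '' (τ : Set (Fin 4 → ℕ))) :=
      subset_convexHull _ _ ⟨p, hp, rfl⟩
    rw [hc] at this
    exact this.2
  refine ⟨a, b, ha, ?_, hp⟩
  by_contra hb
  have hz : ∀ p ∈ τ, toReal p = 0 := fun p hpτ => by
    have h0 : ∀ i ∈ Finset.univ, 0 ≤ a i * p i := fun i _ => mul_nonneg (ha i).le (by positivity)
    have h1 := (Finset.sum_eq_zero_iff_of_nonneg h0).1
      (le_antisymm (by rw [hp p hpτ]; exact not_lt.1 hb) (Finset.sum_nonneg h0))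
    funext i
    exact (mul_eq_zero.1 (h1 i (Finset.mem_univ i))).resolve_left (ha i).ne'
  have hs : (toReal '' (τ : Set (Fin 4 → ℕ))).Subsingleton := by
    rintro _ ⟨p, hp, rfl⟩ _ ⟨q, hq, rfl⟩
    rw [hz p hp, hz q hq]
  rw [vectorSpan_of_subsingleton ℝ hs] at hd
  simp at hd

/-- The direction space has dimension 3 and lies in the kernel of the covector, while the points
themselves do not; so their span is strictly larger. -/
theorem span_eq_top (h : IsBoundedFacet P τ) :
    Submodule.span ℝ (toReal '' (τ : Set (Fin 4 → ℕ))) = ⊤ := by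
  obtain ⟨a, b, -, hb, hp⟩ := h.exists_covector
  set X := toReal '' (τ : Set (Fin 4 → ℕ)) with hX
  have hle : vectorSpan ℝ X ≤ Submodule.span ℝ X := by
    rw [vectorSpan, Submodule.span_le]
    rintro _ ⟨x, hx, y, hy, rfl⟩
    exact Submodule.sub_mem _ (Submodule.subset_span hx) (Submodule.subset_span hy)
  have hker : ∀ x ∈ vectorSpan ℝ X, ∑ i, a i * x i = 0 := by
    intro x hx
    have : vectorSpan ℝ X ≤ LinearMap.ker (∑ i, a i • LinearMap.proj (R := ℝ) (φ := fun _ => ℝ) i) := by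
      rw [vectorSpan, Submodule.span_le]
      rintro _ ⟨_, ⟨p, hpτ, rfl⟩, _, ⟨q, hq, rfl⟩, rfl⟩
      have e := hp p hpτ
      have e' := hp q hq
      simp [toReal, mul_sub, e, e']
    simpa using this hx
  have hne : τ.Nonempty := by
    rw [Finset.nonempty_iff_ne_empty]
    rintro rfl
    have := h.2
    rw [Finset.coe_empty, Set.image_empty, vectorSpan_empty] at this
    simp at this
  obtain ⟨p, hpτ⟩ := hne
  have hlt : vectorSpan ℝ X < Submodule.span ℝ X :=
    lt_of_le_of_ne hle fun he => hb.ne' <| by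
      rw [← hp p hpτ]
      exact hker (toReal p) (he ▸ Submodule.subset_span ⟨p, hpτ, rfl⟩)
  have h1 := Submodule.finrank_lt_finrank_of_lt hlt
  have h2 : Module.finrank ℝ (vectorSpan ℝ X) + 1 = 4 := h.2
  refine Submodule.eq_top_of_finrank_eq (le_antisymm (Submodule.finrank_le _) ?_)
  simp only [Module.finrank_fin_fun]
  omega

theorem spansPositiveHyperplane (h : IsBoundedFacet P τ) :
    SpansPositiveHyperplane (Quadruples τ 0 1 2 3) where
  nonneg := by
    rintro _ _ _ _ ⟨p, -, rfl, rfl, rfl, rfl⟩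
    omega
  lin := by
    obtain ⟨a, b, ha, hb, hp⟩ := h.exists_covector
    refine ⟨a 0 / b, a 1 / b, a 2 / b, a 3 / b, div_pos (ha 0) hb, div_pos (ha 1) hb,
      div_pos (ha 2) hb, div_pos (ha 3) hb, ?_⟩
    rintro _ _ _ _ ⟨p, hpτ, rfl, rfl, rfl, rfl⟩
    have := hp p hpτ
    rw [Fin.sum_univ_four] at this
    field_simp
    exact_mod_cast this
  span t u v w h0 := by
    have hle : Submodule.span ℝ (toReal '' (τ : Set (Fin 4 → ℕ))) ≤ LinearMap.ker
        (∑ i, (![(t : ℝ), u, v, w] i) • LinearMap.proj (R := ℝ) (φ := fun _ => ℝ) i) := by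
      rw [Submodule.span_le]
      rintro _ ⟨p, hp, rfl⟩
      have := h0 _ _ _ _ (quadruples_mem hp)
      simp [Fin.sum_univ_four, toReal]
      exact_mod_cast this
    rw [h.span_eq_top, top_le_iff, LinearMap.ker_eq_top] at hle
    have e := fun m : Fin 4 => LinearMap.congr_fun hle (Pi.single m 1)
    have e0 := e 0
    have e1 := e 1
    have e2 := e 2
    have e3 := e 3
    simp [Fin.sum_univ_four] at e0 e1 e2 e3
    exact ⟨e0, e1, e2, e3⟩

end IsBoundedFacet

theorem affineIndependent_of_det4_ne_zero {p q r s : Fin 4 → ℕ}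
    (hd : det4 (p 0) (p 1) (p 2) (p 3) (q 0) (q 1) (q 2) (q 3) (r 0) (r 1) (r 2) (r 3)
      (s 0) (s 1) (s 2) (s 3) ≠ 0) :
    AffineIndependent ℝ (fun m => toReal (![p, q, r, s] m)) := by
  rw [affineIndependent_iff_of_fintype]
  intro w hw h
  rw [Finset.weightedVSub_eq_linear_combination _ hw] at h
  simp only [Fin.sum_univ_four, Matrix.cons_val_zero, Matrix.cons_val_one, Matrix.cons_val] at h
  have key := combination_eq_zero hd (t := w 0) (u := w 1) (v := w 2) (w := w 3)
    (congrFun h 0) (congrFun h 1) (congrFun h 2) (congrFun h 3)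
  simpa [Fin.forall_fin_succ] using key

theorem IsHeightOnePyramid.exists_sum_eq_one {v : Fin 4 → Fin 4 → ℕ} (hv : Function.Injective v)
    (h : IsHeightOnePyramid (Set.range v)) : ∃ i, ∑ m, v m i = 1 := by
  obtain ⟨i, _, ⟨m, rfl⟩, h1, h0⟩ := h
  refine ⟨i, ?_⟩
  rw [Finset.sum_eq_single m (fun n _ hn => h0 _ ⟨n, rfl⟩ (hv.ne hn)) (by simp), h1]

theorem IsBFacet.colored {P : Set (Fin 4 → ℝ)} {τ : Finset (Fin 4 → ℕ)} (h : IsBFacet P τ) :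
    Colored (Quadruples τ 0 1 2 3) where
  toSpansPositiveHyperplane := h.1.spansPositiveHyperplane
  color := by
    rintro _ _ _ _ _ _ _ _ _ _ _ _ _ _ _ _ ⟨p, hp, rfl, rfl, rfl, rfl⟩
      ⟨q, hq, rfl, rfl, rfl, rfl⟩ ⟨r, hr, rfl, rfl, rfl, rfl⟩ ⟨s, hs, rfl, rfl, rfl, rfl⟩ hd
    have ha := affineIndependent_of_det4_ne_zero hd
    obtain ⟨i, hi⟩ := (h.2 ![p, q, r, s] (by simp [Fin.forall_fin_succ, *]) ha).exists_sum_eq_one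
      (Function.Injective.of_comp (f := toReal) ha.injective)
    simp only [Fin.sum_univ_four, Matrix.cons_val_zero, Matrix.cons_val_one, Matrix.cons_val] at hi
    fin_cases i
    · exact Or.inl (by exact_mod_cast hi)
    · exact Or.inr (Or.inl (by exact_mod_cast hi))
    · exact Or.inr (Or.inr (Or.inl (by exact_mod_cast hi)))
    · exact Or.inr (Or.inr (Or.inr (by exact_mod_cast hi)))

theorem theorem1 (S : Set (Fin 4 → ℕ)) (τ : Finset (Fin 4 → ℕ))
    (hτ : IsBFacet (newtonPolyhedron S) τ) :
    IsB1 τ ∨ IsB2 τ ∨ IsFlatBorder τ ∨ τ = standardCrossPolytope := by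
  have T := hτ.colored
  obtain ⟨R, hR, h⟩ := T.classified
  have TR := T.reorder hR
  obtain ⟨i, j, k, l, hm, rfl⟩ := hR.exists_quadruples rfl
  have hij : i ≠ j := ne_of_cover hm
  rcases h with h | h | h | h
  · exact Or.inl (isB1_of_pyramidOverFirst hm h)
  · exact Or.inr (Or.inl (isB2_of_triangleProjection hij TR.toNonnegSpanning h))
  · exact Or.inr (Or.inr (Or.inl (isFlatBorder_of_flatBorder hij hm h)))
  · exact Or.inr (Or.inr (Or.inr (eq_standardCrossPolytope (.of_reorder hR h))))
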